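/- Let $\mathcal K$ be a field of characteristic $p>2$, let $n\ge 2$, $q\in\mathcal K$ and $1\le k\ne k'\le n$. Let $\mathcal O(n;\underline 1)$ be the truncated divided power algebra over $\mathcal K$ with basis $x^{(\alpha)}$, $0\le\alpha\le\tau=(p-1,\dots,p-1)$, product $x^{(\alpha)}x^{(\beta)}=\binom{\alpha+\beta}{\alpha}x^{(\alpha+\beta)}$ (with $x^{(\gamma)}=0$ unless $0\le\gamma\le\tau$) and partial derivatives $D_i\,x^{(\alpha)}=x^{(\alpha-\epsilon_i)}$; equivalently, $\mathcal O(n;\underline 1)=\mathcal K[x_1,\dots,x_n]/(x_1^p,\dots,x_n^p)$ with $x^{(\alpha)}=x^\alpha/\alpha!$. Let $\mathbf W(n;\underline 1)=\mathrm{Der}_{\mathcal K}\,\mathcal O(n;\underline 1)$, let $\mathbf S'(n;\underline 1)$ be the Lie subalgebra of all $\sum_j a_jD_j$ with $\sum_j D_j(a_j)=0$, and let $\mathbf S(n;\underline 1)=[\mathbf S'(n;\underline 1),\mathbf S'(n;\underline 1)]$ be the special algebra. It contains the elements $D_{ij}(f)=D_j(f)D_i-D_i(f)D_j$, $f\in\mathcal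 O(n;\underline 1)$. Let $\mathbf u(\mathbf S(n;\underline 1))$ be its restricted enveloping algebra, the quotient of $U(\mathbf S(n;\underline 1))$ by the ideal generated by $D_{ij}(x^{(\epsilon_i+\epsilon_j)})^p-D_{ij}(x^{(\epsilon_i+\epsilon_j)})$ and $D_{ij}(x^{(\alpha)})^p$ for $1\le j<i\le n$, $0\le\alpha\le\tau$, $\alpha\ne\epsilon_i+\epsilon_j$. Put $\mathcal K[t]_p^{(q)}=\mathcal K[t]/(t^p-qt)$ and $\mathbf u_{t,q}=\mathbf u(\mathbf S(n;\underline 1))\otimes_{\mathcal K}\mathcal K[t]_p^{(q)}$. Let $$h=D_{kk'}(x^{(\epsilon_k+\epsilon_{k'})}),\qquad e=2D_{kk'}(x^{(2\epsilon_k+\epsilon_{k'})}),\qquad d^{(\ell)}=\tfrac1{\ell!}(\mathrm{ad}\,e)^\ell\quad(0\le\ell<p),$$ and $h_a^{\langle \ell\rangle}=(h+a)(h+a+1)\cdots(h+a+\ell-1)$, $h^{\langle\ell\rangle}=h_0^{\langle\ell\rangle}$. Then $\mathbf u_{t,q}$ is noncommutative and has dimension $p^{1+(n-1)(p^n-1)}$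 over $\mathcal K$, the element $1-et$ is invertible in $\mathbf u_{t,q}$, and there is a noncocommutative Hopf algebra structure over $\mathcal K[t]_p^{(q)}$ on the algebra $\mathbf u_{t,q}$ (with the undeformed product and unit of the tensor product) such that, for all $1\le i,j\le n$ and $0\le\alpha\le\tau$, with $m=\alpha_k-\delta_{ik}-\delta_{jk}-\alpha_{k'}+\delta_{ik'}+\delta_{jk'}$, $$\Delta(D_{ij}(x^{(\alpha)}))=D_{ij}(x^{(\alpha)})\otimes(1-et)^{m}+\sum_{\ell=0}^{p-1}(-1)^\ell h^{\langle\ell\rangle}\otimes(1-et)^{-\ell}d^{(\ell)}(D_{ij}(x^{(\alpha)}))\,t^\ell,$$ $$S(D_{ij}(x^{(\alpha)}))=-(1-et)^{-m}\sum_{\ell=0}^{p-1}d^{(\ell)}(D_{ij}(x^{(\alpha)}))\,h_1^{\langle\ell\rangle}\,t^\ell,\qquad \varepsilon(D_{ij}(x^{(\alpha)}))=0.$$ Moreover, this Hopf algebra contains the Radford Hopf algebra. Precisely, let $R$ be the $\mathcal K$-algebra with generators $a,y$ and relations $a^p=1$, $y^p=y$, $ya-ay=a^2-a$. It has a Hopf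 algebra structure over $\mathcal K$ with $\Delta(a)=a\otimes a$, $\Delta(y)=y\otimes a+1\otimes y$, $\varepsilon(a)=1$, $\varepsilon(y)=0$, $S(a)=a^{-1}$, $S(y)=-ya^{-1}$ (the Radford Hopf algebra), and there is an injective $\mathcal K$-algebra homomorphism $\varphi:R\to\mathbf u_{t,q}$ with $\varphi(y)=h$ and $\varphi(a)=(1-et)^{-1}$ that commutes with the antipodes, with the counits (through $\mathcal K\to\mathcal K[t]_p^{(q)}$) and with the coproducts (through $R\otimes_{\mathcal K}R\to\mathbf u_{t,q}\otimes_{\mathcal K}\mathbf u_{t,q}\to\mathbf u_{t,q}\otimes_{\mathcal K[t]_p^{(q)}}\mathbf u_{t,q}$). -/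

import Mathlib

open scoped TensorProduct Nat

noncomputable section

set_option linter.unusedSectionVars false

namespace SpecialAlgebra

/-! ### The truncated divided power algebra `O(n;1)` and its derivations -/

/-- The ideal `(x₁ᵖ, …, xₙᵖ)` of `K[x₁, …, xₙ]`. -/
def truncIdeal (K : Type*) [Field K] (n p : ℕ) : Ideal (MvPolynomial (Fin n) K) :=
  Ideal.span (Set.range fun i : Fin n => (MvPolynomial.X i : MvPolynomial (Fin n) K) ^ p)

/-- The algebra `O(n;1)` over a field of characteristic `p`, in its truncated polynomial model
`K[x₁, …, xₙ] / (x₁ᵖ, …, xₙᵖ)`. The divided powers are `divPow` below. -/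
def O (K : Type*) [Field K] (n p : ℕ) : Type _ := MvPolynomial (Fin n) K ⧸ truncIdeal K n p

instance (K : Type*) [Field K] (n p : ℕ) : CommRing (O K n p) :=
  inferInstanceAs (CommRing (MvPolynomial (Fin n) K ⧸ truncIdeal K n p))

instance (K : Type*) [Field K] (n p : ℕ) : Algebra K (O K n p) :=
  inferInstanceAs (Algebra K (MvPolynomial (Fin n) K ⧸ truncIdeal K n p))

/-- The projection `K[x₁, …, xₙ] → O(n;1)`. -/
def mkO (K : Type*) [Field K] (n p : ℕ) : MvPolynomial (Fin n) K →ₐ[K] O K n p :=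
  Ideal.Quotient.mkₐ K (truncIdeal K n p)

theorem mkO_surjective (K : Type*) [Field K] (n p : ℕ) : Function.Surjective (mkO K n p) :=
  Ideal.Quotient.mkₐ_surjective K _

theorem mkO_eq_zero_iff {K : Type*} [Field K] {n p : ℕ} (f : MvPolynomial (Fin n) K) :
    mkO K n p f = 0 ↔ f ∈ truncIdeal K n p :=
  Ideal.Quotient.eq_zero_iff_mem

/-- The divided power `x^(α) = x^α / α!`. It vanishes if some `α i ≥ p`; for `α ≤ τ` the
factorials are units, and these elements are the standard basis of `O(n;1)`. -/
def divPow (K : Type*) [Field K] (n p : ℕ) (α : Fin n →₀ ℕ) : O K n p :=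
  mkO K n p (MvPolynomial.monomial α (∏ i, ((α i)! : K))⁻¹)

theorem divPow_eq_zero (K : Type*) [Field K] (n p : ℕ) (α : Fin n →₀ ℕ) (i : Fin n)
    (hi : p ≤ α i) : divPow K n p α = 0 := by
  rw [divPow, mkO_eq_zero_iff]
  refine Ideal.mem_of_dvd _ ?_ (Ideal.subset_span ⟨i, rfl⟩)
  change MvPolynomial.X i ^ p ∣ _
  rw [MvPolynomial.X_pow_eq_monomial, MvPolynomial.monomial_dvd_monomial]
  exact ⟨Or.inr (Finsupp.single_le_iff.2 hi), one_dvd _⟩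

/-- The multiplication rule of divided powers. -/
theorem divPow_mul (K : Type*) [Field K] (n p : ℕ) [Fact p.Prime] [CharP K p]
    (α β : Fin n →₀ ℕ) (hα : ∀ i, α i < p) (hβ : ∀ i, β i < p) :
    divPow K n p α * divPow K n p β =
      ((∏ i, (α i + β i).choose (α i) : ℕ) : K) • divPow K n p (α + β) := by
  have hp : p.Prime := Fact.out
  have fact_ne : ∀ m : ℕ, m < p → ((m ! : ℕ) : K) ≠ 0 := by
    intro m hm h0
    rw [CharP.cast_eq_zero_iff K p, hp.dvd_factorial] at h0
    omega
  by_cases hlt : ∀ i, α i + β i < p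
  · have e : (∏ i, ((α i)! : K))⁻¹ * (∏ i, ((β i)! : K))⁻¹ =
        ((∏ i, (α i + β i).choose (α i) : ℕ) : K) * (∏ i, (((α + β) i)! : K))⁻¹ := by
      rw [← mul_inv, ← div_eq_mul_inv, inv_eq_one_div, div_eq_div_iff, one_mul]
      · push_cast
        rw [← Finset.prod_mul_distrib, ← Finset.prod_mul_distrib]
        refine Finset.prod_congr rfl fun i _ => ?_
        have h := Nat.add_choose_mul_factorial_mul_factorial (α i) (β i)
        rw [← Nat.choose_symm_add] at h
        change (((α i + β i)! : ℕ) : K) = _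
        rw [← h]
        push_cast
        ring
      · refine mul_ne_zero ?_ ?_ <;> refine Finset.prod_ne_zero_iff.2 fun i _ => fact_ne _ ?_
        exacts [hα i, hβ i]
      · exact Finset.prod_ne_zero_iff.2 fun i _ => fact_ne _ (hlt i)
    unfold divPow
    rw [← map_mul, MvPolynomial.monomial_mul, ← map_smul, MvPolynomial.smul_monomial, e,
      smul_eq_mul]
  · push Not at hlt
    obtain ⟨i, hi⟩ := hlt
    rw [divPow_eq_zero K n p (α + β) i hi, smul_zero]
    unfold divPow
    rw [← map_mul, MvPolynomial.monomial_mul, mkO_eq_zero_iff]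
    refine Ideal.mem_of_dvd _ ?_ (Ideal.subset_span ⟨i, rfl⟩)
    change MvPolynomial.X i ^ p ∣ _
    rw [MvPolynomial.X_pow_eq_monomial, MvPolynomial.monomial_dvd_monomial]
    exact ⟨Or.inr (Finsupp.single_le_iff.2 hi), one_dvd _⟩

/-- The Jacobson–Witt algebra `W(n;1) = Der O(n;1)`, with the commutator bracket. -/
abbrev W (K : Type*) [Field K] (n p : ℕ) : Type _ := Derivation K (O K n p) (O K n p)

section

variable (K : Type*) [Field K] (n p : ℕ) [CharP K p]

theorem mkO_pderiv_eq_zero (i : Fin n) (f : MvPolynomial (Fin n) K) (hf : mkO K n p f = 0) :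
    mkO K n p (MvPolynomial.pderiv i f) = 0 := by
  rw [mkO_eq_zero_iff] at hf ⊢
  induction hf using Submodule.span_induction with
  | mem x h =>
    obtain ⟨j, rfl⟩ := h
    simp [Derivation.leibniz_pow]
  | zero => simp
  | add x y _ _ hx hy => rw [map_add]; exact add_mem hx hy
  | smul a x hx h =>
    rw [smul_eq_mul, Derivation.leibniz, smul_eq_mul, smul_eq_mul]
    exact add_mem (Ideal.mul_mem_left _ _ h) (Ideal.mul_mem_right _ _ hx)

/-- The partial derivative `D_i = ∂/∂x_i` on `O(n;1)`. -/
def D (i : Fin n) : W K n p :=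
  Derivation.liftOfSurjective (mkO_surjective K n p) (d := MvPolynomial.pderiv i)
    (mkO_pderiv_eq_zero K n p i)

variable {K n p}

theorem D_mk (i : Fin n) (f : MvPolynomial (Fin n) K) :
    D K n p i (mkO K n p f) = mkO K n p (MvPolynomial.pderiv i f) :=
  Derivation.liftOfSurjective_apply (mkO_surjective K n p) (mkO_pderiv_eq_zero K n p i) f

/-- The variable `x_i` of `O(n;1)`. -/
def x (i : Fin n) : O K n p := mkO K n p (MvPolynomial.X i)

theorem D_x (i j : Fin n) : D K n p i (x j) = if i = j then 1 else 0 := by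
  rw [x, D_mk, MvPolynomial.pderiv_X, Pi.single_apply]
  split_ifs <;> simp_all

/-- A derivation of `O(n;1)` is determined by its values on the variables. -/
theorem W_ext {E F : W K n p} (h : ∀ i, E (x i) = F (x i)) : E = F := by
  refine Derivation.ext_of_adjoin_eq_top (Set.range (x (K := K) (n := n) (p := p))) ?_ ?_
  · have h1 : Set.range (x (K := K) (n := n) (p := p)) =
        mkO K n p '' Set.range MvPolynomial.X := by
      rw [← Set.range_comp]; rfl
    rw [h1, ← AlgHom.map_adjoin, MvPolynomial.adjoin_range_X, Algebra.map_top,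
      AlgHom.range_eq_top]
    exact mkO_surjective K n p
  · rintro _ ⟨i, rfl⟩
    exact h i

theorem D_comm (i j : Fin n) (f : O K n p) : D K n p i (D K n p j f) = D K n p j (D K n p i f) := by
  have h : ⁅D K n p i, D K n p j⁆ = 0 := by
    refine W_ext fun m => ?_
    rw [Derivation.commutator_apply, D_x, D_x]
    split_ifs <;> simp
  have h2 := congrArg (fun E : W K n p => E f) h
  simpa [Derivation.commutator_apply, sub_eq_zero] using h2

theorem W_sum_apply {ι : Type*} (s : Finset ι) (E : ι → W K n p) (f : O K n p) :
    (∑ m ∈ s, E m) f = ∑ m ∈ s, E m f := by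
  classical
  induction s using Finset.induction_on with
  | empty => simp
  | insert a s ha ih => rw [Finset.sum_insert ha, Finset.sum_insert ha, ← ih]; rfl

theorem D_lie (i : Fin n) (E : W K n p) (f : O K n p) :
    E (D K n p i f) = D K n p i (E f) - ∑ m, D K n p i (E (x m)) * D K n p m f := by
  have h : ⁅D K n p i, E⁆ = ∑ m, D K n p i (E (x m)) • D K n p m := by
    refine W_ext fun j => ?_
    rw [Derivation.commutator_apply, D_x]
    have : E (if i = j then 1 else 0) = 0 := by split_ifs <;> simp
    rw [this, sub_zero, W_sum_apply]
    simp [D_x]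
  have h2 := congrArg (fun E : W K n p => E f) h
  simp only [Derivation.commutator_apply, W_sum_apply, Derivation.smul_apply, smul_eq_mul] at h2
  rw [← h2]; ring

variable (K n p)

/-- The divergence `Div (∑ a_j D_j) = ∑ D_j (a_j)`; here `a_j = E (x_j)`. -/
def Div : W K n p →ₗ[K] O K n p where
  toFun E := ∑ j, D K n p j (E (x j))
  map_add' E F := by simp [Finset.sum_add_distrib]
  map_smul' c E := by simp [Finset.smul_sum]

variable {K n p}

theorem Div_lie (E F : W K n p) : Div K n p ⁅E, F⁆ = E (Div K n p F) - F (Div K n p E) := by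
  simp only [Div, LinearMap.coe_mk, AddHom.coe_mk, Derivation.commutator_apply, map_sub, map_sum,
    D_lie, Finset.sum_sub_distrib]
  rw [Finset.sum_comm (f := fun i m => D K n p i (E (x m)) * D K n p m (F (x i)))]
  simp only [mul_comm]
  ring

theorem Div_smul_D (f : O K n p) (i : Fin n) : Div K n p (f • D K n p i) = D K n p i f := by
  simp only [Div, LinearMap.coe_mk, AddHom.coe_mk, Derivation.smul_apply, D_x, smul_eq_mul,
    mul_ite, mul_one, mul_zero]
  rw [Finset.sum_eq_single i] <;> simp +contextual [eq_comm]

variable (K n p)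

/-- The Lie algebra `S'(n;1) = {E ∈ W(n;1) | Div E = 0}`. -/
def S' : LieSubalgebra K (W K n p) where
  __ := LinearMap.ker (Div K n p)
  lie_mem' {E F} hE hF := by
    have hE' : Div K n p E = 0 := hE
    have hF' : Div K n p F = 0 := hF
    change Div K n p ⁅E, F⁆ = 0
    rw [Div_lie, hE', hF', map_zero, map_zero, sub_zero]

/-- The special algebra `S(n;1) = S'(n;1)^(1)`, the derived algebra `[S'(n;1), S'(n;1)]`. -/
abbrev S : LieIdeal K (S' K n p) := LieAlgebra.derivedSeries K (S' K n p) 1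

variable {K n p}

/-- `D_ij(f) = D_j(f) D_i - D_i(f) D_j` as an element of `W(n;1)`. -/
def DijW (i j : Fin n) : O K n p →ₗ[K] W K n p where
  toFun f := D K n p j f • D K n p i - D K n p i f • D K n p j
  map_add' f g := by simp only [map_add, add_smul]; abel
  map_smul' c f := by
    simp only [Derivation.map_smul, smul_assoc, RingHom.id_apply, smul_sub]

theorem DijW_mem_S' (i j : Fin n) (f : O K n p) : DijW i j f ∈ S' K n p := by
  change Div K n p (_ - _) = 0
  rw [map_sub, Div_smul_D, Div_smul_D, D_comm, sub_self]

/-- `D_ij(f)` as an element of `S'(n;1)`. -/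
def DijS' (i j : Fin n) : O K n p →ₗ[K] S' K n p :=
  LinearMap.codRestrict (S' K n p).toSubmodule (DijW i j) (DijW_mem_S' i j)

theorem DijS'_mem_S (i j : Fin n) (f : O K n p) : DijS' i j f ∈ S K n p := by
  rcases eq_or_ne i j with rfl | hij
  · have : DijS' i i f = 0 := Subtype.ext (sub_self _)
    rw [this]; exact zero_mem _
  obtain ⟨f, rfl⟩ := mkO_surjective K n p f
  induction f using MvPolynomial.induction_on' with
  | add f g hf hg => rw [map_add, map_add]; exact add_mem hf hg
  | monomial α c =>
    set g : O K n p := mkO K n p (MvPolynomial.monomial (α.erase j) c) with hg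
    set y : O K n p := mkO K n p (MvPolynomial.monomial (Finsupp.single j (α j)) 1) with hy
    have hf : (mkO K n p (MvPolynomial.monomial α c) : O K n p) = g * y := by
      rw [hg, hy, ← map_mul, MvPolynomial.monomial_mul, Finsupp.erase_add_single, mul_one]
    have h1 : D K n p j g = 0 := by
      rw [hg, D_mk, MvPolynomial.pderiv_monomial]; simp
    have h2 : D K n p i y = 0 := by
      rw [hy, D_mk, MvPolynomial.pderiv_monomial]; simp [hij]
    let u : S' K n p := ⟨g • D K n p j, by change Div K n p _ = 0; rw [Div_smul_D, h1]⟩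
    let v : S' K n p := ⟨y • D K n p i, by change Div K n p _ = 0; rw [Div_smul_D, h2]⟩
    have key : DijS' i j (g * y) = ⁅u, v⁆ := by
      apply Subtype.ext
      change D K n p j (g * y) • D K n p i - D K n p i (g * y) • D K n p j =
        ⁅g • D K n p j, y • D K n p i⁆
      ext f
      simp only [Derivation.commutator_apply, Derivation.sub_apply, Derivation.smul_apply,
        Derivation.leibniz, smul_eq_mul, h1, h2, D_comm i j]
      ring
    rw [hf, key]
    exact LieSubmodule.lie_mem_lie (LieSubmodule.mem_top _) (LieSubmodule.mem_top _)

/-- The element `D_ij(f)` of the special algebra `S(n;1)`. -/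
def Dij (i j : Fin n) : O K n p →ₗ[K] S K n p :=
  LinearMap.codRestrict (S K n p).toSubmodule (DijS' i j) (DijS'_mem_S i j)

end

/-! ### The restricted enveloping algebra -/

section

attribute [local instance] LieRing.ofAssociativeRing

variable (K : Type*) [Field K] (n p : ℕ) [CharP K p]

/-- The universal enveloping algebra `U(S(n;1))`. -/
abbrev U : Type _ := UniversalEnvelopingAlgebra K (S K n p)

variable {K n p} in
/-- The multi-index `ε_i`. -/
abbrev ε (i : Fin n) : Fin n →₀ ℕ := Finsupp.single i 1

variable {K n p} in
/-- The generator `D_ij(x^(α))` of `U(S(n;1))`. -/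
def genU (i j : Fin n) (α : Fin n →₀ ℕ) : U K n p :=
  UniversalEnvelopingAlgebra.ι K (Dij i j (divPow K n p α))

/-- The relations `D_ij(x^(ε_i+ε_j))^p = D_ij(x^(ε_i+ε_j))` and `D_ij(x^(α))^p = 0` for
`0 ≤ α ≤ τ`, `α ≠ ε_i + ε_j`; these are the relations `y^p = y^[p]` for the spanning set of
`S(n;1)` that consists of the elements `y = D_ij(x^(α))`. -/
inductive RestrictedRel : U K n p → U K n p → Prop
  | toral (i j : Fin n) (hij : j < i) :
      RestrictedRel (genU i j (ε i + ε j) ^ p) (genU i j (ε i + ε j))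
  | nil (i j : Fin n) (hij : j < i) (α : Fin n →₀ ℕ) (hα : ∀ m, α m < p) (h : α ≠ ε i + ε j) :
      RestrictedRel (genU i j α ^ p) 0

/-- The restricted enveloping algebra `u(S(n;1))`, the quotient of `U(S(n;1))` by the two-sided
ideal generated by the relations above. -/
abbrev u : Type _ := RingQuot (RestrictedRel K n p)

/-- The canonical map `S(n;1) → u(S(n;1))`. -/
def ιu : S K n p →ₗ[K] u K n p :=
  (RingQuot.mkAlgHom K (RestrictedRel K n p)).toLinearMap ∘ₗ
    (UniversalEnvelopingAlgebra.ι K (L := S K n p)).toLinearMap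

end

/-- The truncated polynomial ring `K[t] / (t^p - q t)`. -/
abbrev TruncRing (K : Type*) [Field K] (p : ℕ) (q : K) : Type _ :=
  AdjoinRoot (Polynomial.X ^ p - Polynomial.C q * Polynomial.X : Polynomial K)

section

variable (K : Type*) [Field K] (n p : ℕ) [CharP K p] (q : K)

/-- The algebra `u_{t,q}(S(n;1)) = u(S(n;1)) ⊗ K[t]/(t^p - q t)`, an algebra over
`K[t]/(t^p - q t)` with the product of the tensor product. -/
abbrev utq : Type _ := TruncRing K p q ⊗[K] u K n p

/-- The parameter `t`. -/
def t : TruncRing K p q := AdjoinRoot.root _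

variable {K n p q}

/-- The image in `u_{t,q}(S(n;1))` of an element of `S(n;1)`. -/
def emb (y : S K n p) : utq K n p q := 1 ⊗ₜ[K] ιu K n p y

/-- The element `D_ij(x^(α))` of `S(n;1)`. -/
def DS (i j : Fin n) (α : Fin n →₀ ℕ) : S K n p := Dij i j (divPow K n p α)

variable (K p) in
/-- The element `h = D_kk'(x^(ε_k+ε_k'))`. -/
def hS (k k' : Fin n) : S K n p := DS k k' (ε k + ε k')

variable (K p) in
/-- The element `e = 2 D_kk'(x^(2ε_k+ε_k'))`. -/
def eS (k k' : Fin n) : S K n p := (2 : K) • DS k k' (2 • ε k + ε k')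

/-- The operator `d^(ℓ) = (ad e)^ℓ / ℓ!` on `S(n;1)`, for `ℓ < p`. -/
def dOp (k k' : Fin n) (ℓ : ℕ) (y : S K n p) : S K n p :=
  ((ℓ ! : K))⁻¹ • ((LieAlgebra.ad K (S K n p) (eS K p k k')) ^ ℓ) y

/-- The exponent `α_k - δ_ik - δ_jk - α_k' + δ_ik' + δ_jk'`. -/
def wt (k k' i j : Fin n) (α : Fin n →₀ ℕ) : ℤ :=
  (α k : ℤ) - (if i = k then 1 else 0) - (if j = k then 1 else 0)
    - (α k' : ℤ) + (if i = k' then 1 else 0) + (if j = k' then 1 else 0)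

end

/-- The rising product `y_a^⟨m⟩ = (y + a)(y + a + 1) ⋯ (y + a + m - 1)`. -/
def rising {B : Type*} [Ring B] (y : B) (a : ℕ) : ℕ → B
  | 0 => 1
  | m + 1 => rising y a m * (y + a + m)

/-! ### Hopf algebra structures on a given algebra -/

/-- A Hopf algebra structure over `R` on a given `R`-algebra `B`: the product, the unit and the
scalars are those of `B`. -/
structure HopfStructure (R B : Type*) [CommRing R] [Ring B] [Algebra R B] where
  /-- The coproduct. -/
  Δ : B →ₐ[R] B ⊗[R] B
  /-- The counit. -/
  counit : B →ₐ[R] R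
  /-- The antipode. -/
  antipode : B →ₗ[R] B
  coassoc : TensorProduct.assoc R B B B ∘ₗ Δ.toLinearMap.rTensor B ∘ₗ Δ.toLinearMap =
    Δ.toLinearMap.lTensor B ∘ₗ Δ.toLinearMap
  counit_left : counit.toLinearMap.rTensor B ∘ₗ Δ.toLinearMap = TensorProduct.mk R R B 1
  counit_right : counit.toLinearMap.lTensor B ∘ₗ Δ.toLinearMap =
    (TensorProduct.mk R B R).flip 1
  antipode_left : LinearMap.mul' R B ∘ₗ antipode.rTensor B ∘ₗ Δ.toLinearMap =
    Algebra.linearMap R B ∘ₗ counit.toLinearMap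
  antipode_right : LinearMap.mul' R B ∘ₗ antipode.lTensor B ∘ₗ Δ.toLinearMap =
    Algebra.linearMap R B ∘ₗ counit.toLinearMap

namespace HopfStructure

variable {R B : Type*} [CommRing R] [Ring B] [Algebra R B] (X : HopfStructure R B)

/-- The Mathlib Hopf algebra of a Hopf structure. -/
@[reducible]
def toHopfAlgebra : HopfAlgebra R B :=
  letI : Coalgebra R B :=
    { comul := X.Δ.toLinearMap
      counit := X.counit.toLinearMap
      coassoc := X.coassoc
      rTensor_counit_comp_comul := X.counit_left
      lTensor_counit_comp_comul := X.counit_right }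
  letI : Bialgebra R B := Bialgebra.mk' R B (map_one X.counit) (fun {a b} => map_mul X.counit a b)
    (map_one X.Δ) (fun {a b} => map_mul X.Δ a b)
  { antipode := X.antipode
    mul_antipode_rTensor_comul := X.antipode_left
    mul_antipode_lTensor_comul := X.antipode_right }

theorem toHopfAlgebra_toAlgebra : X.toHopfAlgebra.toAlgebra = ‹Algebra R B› := rfl

/-- The coproduct is not invariant under the flip. -/
def Noncocommutative : Prop :=
  ∃ b : B, TensorProduct.comm R B B (X.Δ b) ≠ X.Δ b

end HopfStructure

/-! ### The Radford algebra -/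

/-- The relations `a^p = 1`, `y^p = y`, `y a - a y = a² - a` between the generators
`a = true`, `y = false`. -/
inductive RadfordRel (K : Type*) [Field K] (p : ℕ) :
    FreeAlgebra K Bool → FreeAlgebra K Bool → Prop
  | a_pow : RadfordRel K p (FreeAlgebra.ι K true ^ p) 1
  | y_pow : RadfordRel K p (FreeAlgebra.ι K false ^ p) (FreeAlgebra.ι K false)
  | comm : RadfordRel K p
      (FreeAlgebra.ι K false * FreeAlgebra.ι K true - FreeAlgebra.ι K true * FreeAlgebra.ι K false)
      (FreeAlgebra.ι K true ^ 2 - FreeAlgebra.ι K true)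

/-- The Radford algebra over a field `K` of characteristic `p`, as an algebra. -/
abbrev Radford (K : Type*) [Field K] (p : ℕ) : Type _ := RingQuot (RadfordRel K p)

/-- The generator `a` of the Radford algebra. -/
def Radford.a (K : Type*) [Field K] (p : ℕ) : Radford K p :=
  RingQuot.mkAlgHom K (RadfordRel K p) (FreeAlgebra.ι K true)

/-- The generator `y` of the Radford algebra. -/
def Radford.y (K : Type*) [Field K] (p : ℕ) : Radford K p :=
  RingQuot.mkAlgHom K (RadfordRel K p) (FreeAlgebra.ι K false)

/-- The Hopf structure of the Radford algebra: `a` is group-like, `Δ(y) = y ⊗ a + 1 ⊗ y`,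
`ε(y) = 0`, `S(a) = a⁻¹ = a^(p-1)` and `S(y) = -y a⁻¹`. The elements `a`, `y` generate the
algebra, so there is at most one such structure. -/
structure IsRadfordHopf {K : Type*} [Field K] {p : ℕ} (X : HopfStructure K (Radford K p)) :
    Prop where
  Δ_a : X.Δ (Radford.a K p) = Radford.a K p ⊗ₜ[K] Radford.a K p
  Δ_y : X.Δ (Radford.y K p) = Radford.y K p ⊗ₜ[K] Radford.a K p + 1 ⊗ₜ[K] Radford.y K p
  counit_a : X.counit (Radford.a K p) = 1
  counit_y : X.counit (Radford.y K p) = 0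
  antipode_a : X.antipode (Radford.a K p) = Radford.a K p ^ (p - 1)
  antipode_y : X.antipode (Radford.y K p) = -(Radford.y K p * Radford.a K p ^ (p - 1))

/-- A `K`-algebra map `f : C → B` from a Hopf algebra over `K` to a Hopf algebra over a
`K`-algebra `R` is a map of Hopf algebras along `K → R`: it commutes with the coproducts through
`C ⊗_K C → B ⊗_K B → B ⊗_R B`, with the counits through `K → R`, and with the antipodes. -/
structure IsHopfMap {K R C B : Type*} [CommRing K] [CommRing R] [Algebra K R] [Ring C]
    [Algebra K C] [Ring B] [Algebra R B] [Algebra K B] [IsScalarTower K R B]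
    (X : HopfStructure K C) (Y : HopfStructure R B) (f : C →ₐ[K] B) : Prop where
  Δ : ∀ c, Y.Δ (f c) = TensorProduct.mapOfCompatibleSMul R K K B B
    (TensorProduct.map f.toLinearMap f.toLinearMap (X.Δ c))
  counit : ∀ c, Y.counit (f c) = algebraMap K R (X.counit c)
  antipode : ∀ c, Y.antipode (f c) = f (X.antipode c)

end SpecialAlgebra

end

open SpecialAlgebra

open scoped TensorProduct Nat

noncomputable section

set_option linter.unusedSectionVars false

namespace SpecialAlgebra

/-! ### Toral elements and their idempotents -/

section Toral

variable {p : ℕ} [Fact p.Prime] {A : Type*} [Ring A] [CharP A p]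

/-- The prime field inside a ring of characteristic `p`. -/
def scal (A : Type*) [Ring A] [CharP A p] : ZMod p →+* A := ZMod.castHom (dvd_refl p) A

theorem scal_eq_natCast (s : ZMod p) : scal A s = ((s.val : ℕ) : A) := by
  conv_lhs => rw [← ZMod.natCast_zmod_val s]
  exact map_natCast (scal A) _

theorem scal_commute (s : ZMod p) (y : A) : Commute (scal A s) y := by
  rw [scal_eq_natCast]; exact Nat.cast_commute _ _

theorem map_scal {B : Type*} [Ring B] [CharP B p] (f : A →+* B) (s : ZMod p) :
    f (scal A s) = scal B s :=
  RingHom.congr_fun (Subsingleton.elim (f.comp (scal A)) (scal B)) s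

/-- The idempotent of eigenvalue `s` of a toral element `h`. -/
def eigenIdem (h : A) (s : ZMod p) : A := 1 - (h - scal A s) ^ (p - 1)

theorem map_eigenIdem {B : Type*} [Ring B] [CharP B p] (f : A →+* B) (h : A) (s : ZMod p) :
    f (eigenIdem h s) = eigenIdem (f h) s := by
  simp [eigenIdem, map_scal]

theorem sub_pow_prime {x y : A} (h : Commute x y) : (x - y) ^ p = x ^ p - y ^ p :=
  sub_pow_char_of_commute _ h

theorem eigenIdem_commute (h : A) (s : ZMod p) : Commute h (eigenIdem h s) := by
  have : Commute h (h - scal A s) := (Commute.refl h).sub_right (scal_commute s h).symm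
  exact (Commute.one_right h).sub_right (this.pow_right _)

theorem mul_eigenIdem {h : A} (hh : h ^ p = h) (s : ZMod p) :
    h * eigenIdem h s = scal A s * eigenIdem h s := by
  have hp : p.Prime := Fact.out
  rw [← sub_eq_zero, ← sub_mul, eigenIdem, mul_sub, mul_one, ← pow_succ',
    Nat.sub_add_cancel hp.one_le, sub_pow_prime (scal_commute s h).symm, hh, ← map_pow,
    ZMod.pow_card, sub_self]

theorem pow_mul_of_eigen {h x : A} {s : ZMod p} (hx : h * x = scal A s * x) (m : ℕ) :
    h ^ m * x = scal A (s ^ m) * x := by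
  induction m with
  | zero => simp
  | succ m ih => rw [pow_succ, mul_assoc, hx, ← mul_assoc, ← (scal_commute s _).eq, mul_assoc, ih,
      ← mul_assoc, ← map_mul, pow_succ']

theorem sub_scal_mul_of_eigen {h x : A} {s : ZMod p} (hx : h * x = scal A s * x) (r : ZMod p) :
    (h - scal A r) * x = scal A (s - r) * x := by
  rw [sub_mul, hx, map_sub, sub_mul]

theorem eigenIdem_mul_of_eigen {h x : A} {s : ZMod p} (hx : h * x = scal A s * x) (r : ZMod p) :
    eigenIdem h r * x = if r = s then x else 0 := by
  have hp : p.Prime := Fact.out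
  rw [eigenIdem, sub_mul, one_mul, pow_mul_of_eigen (sub_scal_mul_of_eigen hx r)]
  split_ifs with hrs
  · subst hrs
    rw [sub_self, zero_pow (Nat.sub_ne_zero_of_lt hp.one_lt), map_zero, zero_mul, sub_zero]
  · rw [ZMod.pow_card_sub_one_eq_one (sub_ne_zero.2 (Ne.symm hrs)), map_one, one_mul, sub_self]

theorem eigenIdem_mul_eigenIdem {h : A} (hh : h ^ p = h) (r s : ZMod p) :
    eigenIdem h r * eigenIdem h s = if r = s then eigenIdem h s else 0 :=
  eigenIdem_mul_of_eigen (mul_eigenIdem hh s) r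

theorem sum_eigenIdem (h : A) : ∑ s : ZMod p, eigenIdem h s = 1 := by
  have hp : p.Prime := Fact.out
  have key : ∀ s : ZMod p, (h - scal A s) ^ (p - 1) =
      ∑ m ∈ Finset.range (p - 1 + 1),
        h ^ m * scal A ((-s) ^ (p - 1 - m)) * ((p - 1).choose m : A) := by
    intro s
    rw [sub_eq_add_neg, ← map_neg, (scal_commute (-s) h).symm.add_pow]
    simp only [map_pow]
  have hsum : ∀ m ∈ Finset.range (p - 1 + 1), m ≠ 0 →
      ∑ s : ZMod p, (-s) ^ (p - 1 - m) = 0 := by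
    intro m _ hm
    have := Equiv.sum_comp (Equiv.neg (ZMod p)) (fun s : ZMod p => s ^ (p - 1 - m))
    simp only [Equiv.neg_apply] at this
    rw [this]
    apply FiniteField.sum_pow_lt_card_sub_one
    rw [ZMod.card]
    have := hp.two_le
    omega
  have hneg : ∑ s : ZMod p, (-s) ^ (p - 1) = -1 := by
    have h2 : ∀ s : ZMod p, (-s) ^ (p - 1) = 1 - if s = 0 then 1 else 0 := by
      intro s
      split_ifs with hs
      · rw [hs, neg_zero, zero_pow (Nat.sub_ne_zero_of_lt hp.one_lt), sub_self]
      · rw [ZMod.pow_card_sub_one_eq_one (neg_ne_zero.2 hs), sub_zero]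
    simp [h2]
  have htot : ∑ s : ZMod p, (h - scal A s) ^ (p - 1) = -1 := by
    rw [Finset.sum_congr rfl fun s _ => key s, Finset.sum_comm,
      Finset.sum_eq_single_of_mem 0 (by simp)]
    · simp only [pow_zero, one_mul, tsub_zero, Nat.choose_zero_right, Nat.cast_one, mul_one,
        ← map_sum, hneg, map_neg, map_one]
    · intro m hm hm0
      rw [← Finset.sum_mul, ← Finset.mul_sum, ← map_sum, hsum m hm hm0, map_zero, mul_zero,
        zero_mul]
  simp only [eigenIdem, Finset.sum_sub_distrib, htot]
  simp

/-- `y` has weight `m` with respect to `h`. -/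
theorem eigenIdem_mul_weight {h y : A} {m : ZMod p} (hy : h * y = y * (h + scal A m))
    (s : ZMod p) : eigenIdem h s * y = y * eigenIdem h (s - m) := by
  have h1 : SemiconjBy y (h - scal A (s - m)) (h - scal A s) := by
    have : y * (h - scal A (s - m)) = (h - scal A s) * y := by
      rw [sub_mul, hy, (scal_commute s y).eq, map_sub]; noncomm_ring
    exact this
  have h2 := (h1.pow_right (p - 1)).eq
  rw [eigenIdem, eigenIdem, sub_mul, mul_sub, h2]
  simp

theorem ext_eigenIdem {h x y : A}
    (hxy : ∀ s : ZMod p, eigenIdem h s * x = eigenIdem h s * y) : x = y := by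
  rw [← one_mul x, ← one_mul y, ← sum_eigenIdem (p := p) h, Finset.sum_mul, Finset.sum_mul]
  exact Finset.sum_congr rfl fun s _ => hxy s

end Toral

/-! ### Powers of a unipotent element, indexed by the prime field -/

section Unip

variable {p : ℕ} [Fact p.Prime] {A : Type*} [Ring A]

/-- The power `(1 + z)^s` for `s` in the prime field. -/
def unip (z : A) (s : ZMod p) : A := (1 + z) ^ s.val

theorem map_unip {B : Type*} [Ring B] (f : A →+* B) (z : A) (s : ZMod p) :
    f (unip z s) = unip (f z) s := by simp [unip]

theorem unip_zero (z : A) : unip z (0 : ZMod p) = 1 := by simp [unip]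

variable [CharP A p] {z : A}

theorem one_add_pow_prime (hz : z ^ p = 0) : (1 + z) ^ p = 1 := by
  rw [add_pow_char_of_commute _ (Commute.one_left z), one_pow, hz, add_zero]

theorem unip_natCast (hz : z ^ p = 0) (m : ℕ) : unip z (m : ZMod p) = (1 + z) ^ m := by
  rw [unip, ZMod.val_natCast]
  conv_rhs => rw [← Nat.div_add_mod m p, pow_add, pow_mul, one_add_pow_prime hz, one_pow, one_mul]

theorem unip_add (hz : z ^ p = 0) (r s : ZMod p) : unip z (r + s) = unip z r * unip z s := by
  rw [← ZMod.natCast_zmod_val r, ← ZMod.natCast_zmod_val s, ← Nat.cast_add, unip_natCast hz,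
    unip_natCast hz, unip_natCast hz, pow_add]

theorem unip_one (hz : z ^ p = 0) : unip z (1 : ZMod p) = 1 + z := by
  rw [← Nat.cast_one, unip_natCast hz, pow_one]

theorem unip_mul_neg (hz : z ^ p = 0) (s : ZMod p) : unip z s * unip z (-s) = 1 := by
  rw [← unip_add hz, add_neg_cancel, unip_zero]

theorem unip_neg_mul (hz : z ^ p = 0) (s : ZMod p) : unip z (-s) * unip z s = 1 := by
  rw [← unip_add hz, neg_add_cancel, unip_zero]

theorem unip_commute (z : A) (s : ZMod p) : Commute z (unip z s) :=
  ((Commute.one_right z).add_right (Commute.refl z)).pow_right _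

/-- The unit `1 + z`. -/
def unipUnit (hz : z ^ p = 0) : Aˣ where
  val := 1 + z
  inv := unip z (-1 : ZMod p)
  val_inv := by rw [← unip_one (p := p) hz, unip_mul_neg hz]
  inv_val := by rw [← unip_one (p := p) hz, unip_neg_mul hz]

theorem unipUnit_zpow (hz : z ^ p = 0) (m : ℤ) :
    ((unipUnit hz ^ m : Aˣ) : A) = unip z (m : ZMod p) := by
  induction m with
  | zero => simp [unip_zero]
  | succ i ih =>
    rw [zpow_add_one, Units.val_mul, ih, Int.cast_add, Int.cast_one, unip_add hz, unip_one hz]; rfl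
  | pred i ih =>
    rw [zpow_sub_one, Units.val_mul, ih, Int.cast_sub, Int.cast_one, sub_eq_add_neg _ (1 : ZMod p),
      unip_add hz]; rfl

end Unip

/-! ### The two-dimensional situation `h ^ p = h`, `z ^ p = 0`, `[h, z] = z` -/

/-- A toral element `h` and a nilpotent element `z` of weight one. -/
structure ToralPair (p : ℕ) {A : Type*} [Ring A] (h z : A) : Prop where
  toral : h ^ p = h
  nil : z ^ p = 0
  comm : h * z = z * (h + 1)

namespace ToralPair

variable {p : ℕ} [Fact p.Prime] {A : Type*} [Ring A] [CharP A p] {h z : A}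

/-- The element `∑ π_s (1 + z)^s`. -/
def V (p : ℕ) [Fact p.Prime] {A : Type*} [Ring A] [CharP A p] (h z : A) : A :=
  ∑ s : ZMod p, eigenIdem h s * unip z s

theorem neg (H : ToralPair p h z) : ToralPair p h (-z) where
  toral := H.toral
  nil := by rw [neg_pow, H.nil, mul_zero]
  comm := by rw [mul_neg, H.comm, neg_mul]

theorem eigenIdem_mul_z (H : ToralPair p h z) (s : ZMod p) :
    eigenIdem h s * z = z * eigenIdem h (s - 1) :=
  eigenIdem_mul_weight (by rw [H.comm, map_one]) s

theorem eigenIdem_mul_V (H : ToralPair p h z) (s : ZMod p) :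
    eigenIdem h s * V p h z = eigenIdem h s * unip z s := by
  rw [V, Finset.mul_sum, Finset.sum_eq_single s]
  · rw [← mul_assoc, eigenIdem_mul_eigenIdem H.toral, if_pos rfl]
  · intro r _ hr
    rw [← mul_assoc, eigenIdem_mul_eigenIdem H.toral, if_neg hr.symm, zero_mul]
  · simp

theorem V_mul_z (H : ToralPair p h z) : V p h z * z = z * (V p h z * (1 + z)) := by
  simp only [V, Finset.sum_mul, Finset.mul_sum]
  rw [← Equiv.sum_comp (Equiv.addRight (1 : ZMod p))]
  refine Finset.sum_congr rfl fun s _ => ?_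
  rw [Equiv.coe_addRight, mul_assoc, ← (unip_commute z _).eq, ← mul_assoc, H.eigenIdem_mul_z,
    add_sub_cancel_right, unip_add H.nil, unip_one H.nil]
  simp only [mul_assoc]

theorem one_sub_mul_V (H : ToralPair p h z) : (1 + -z) * (V p h z * (1 + z)) = V p h z := by
  rw [add_mul, neg_mul, ← H.V_mul_z]; noncomm_ring

theorem unip_neg_mul_V (H : ToralPair p h z) (s : ZMod p) :
    unip (-z) s * V p h z = V p h z * unip z (-s) := by
  have h1 : ∀ m : ℕ, (1 + -z) ^ m * (V p h z * (1 + z) ^ m) = V p h z := by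
    intro m
    induction m with
    | zero => simp
    | succ m ih =>
      rw [pow_succ, pow_succ', mul_assoc, ← mul_assoc (V p h z), ← mul_assoc (1 + -z),
        H.one_sub_mul_V, ih]
  have h2 : unip (-z) s * (V p h z * unip z s) = V p h z := h1 _
  calc unip (-z) s * V p h z = unip (-z) s * (V p h z * unip z s) * unip z (-s) := by
        rw [mul_assoc, mul_assoc, unip_mul_neg H.nil, mul_one]
    _ = _ := by rw [h2]

theorem V_neg_mul_V (H : ToralPair p h z) : V p h (-z) * V p h z = 1 := by
  refine ext_eigenIdem (h := h) (p := p) fun s => ?_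
  rw [← mul_assoc, H.neg.eigenIdem_mul_V, mul_assoc, H.unip_neg_mul_V, ← mul_assoc,
    H.eigenIdem_mul_V, mul_assoc, unip_mul_neg H.nil]

theorem V_mul_V_neg (H : ToralPair p h z) : V p h z * V p h (-z) = 1 := by
  simpa using H.neg.V_neg_mul_V

/-- Moving `h` across a power of `1 + z`. -/
theorem unip_mul_h (H : ToralPair p h z) (r : ZMod p) :
    unip z r * h = h * unip z r - scal A r * (z * unip z (r - 1)) := by
  have h1 : ∀ m : ℕ, unip z (m : ZMod p) * h =
      h * unip z (m : ZMod p) - scal A (m : ZMod p) * (z * unip z ((m : ZMod p) - 1)) := by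
    intro m
    induction m with
    | zero => simp [unip_zero]
    | succ m ih =>
      have e : unip z ((m : ZMod p) - 1) * (1 + z) = unip z (m : ZMod p) := by
        rw [← unip_one (p := p) H.nil, ← unip_add H.nil, sub_add_cancel]
      have e2 : (1 + z) * h = h * (1 + z) - z := by
        rw [mul_add, H.comm]; noncomm_ring
      have e3 : unip z (m : ZMod p) * z = z * unip z (m : ZMod p) := ((unip_commute z _).eq).symm
      push_cast
      rw [add_sub_cancel_right, unip_add H.nil, unip_one H.nil, mul_assoc, e2, mul_sub, ← mul_assoc,
        ih, sub_mul, e3, mul_assoc (scal A _), mul_assoc z, e, map_add, map_one]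
      noncomm_ring
  rw [← ZMod.natCast_zmod_val r]
  exact h1 _

/-- `∏_{l < ℓ} (h - m - l)` acts between `π_s (1+z)^r` and the right hand side as a falling
factorial when `s = r + m`. -/
theorem eigenIdem_unip_mul_h (H : ToralPair p h z) (r m : ZMod p) :
    eigenIdem h (r + m) * unip z r * (h - scal A m) =
      scal A r * (eigenIdem h (r + m) * unip z (r - 1)) := by
  have e : unip z r = unip z (r - 1) * (1 + z) := by
    rw [← unip_one (p := p) H.nil, ← unip_add H.nil, sub_add_cancel]
  rw [mul_sub, mul_assoc, H.unip_mul_h, mul_sub, ← mul_assoc, ← (eigenIdem_commute h _).eq,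
    mul_eigenIdem H.toral, map_add, ← (scal_commute m _).eq]
  have e4 : eigenIdem h (r + m) * (scal A r * (z * unip z (r - 1))) =
      scal A r * (eigenIdem h (r + m) * (z * unip z (r - 1))) := by
    rw [← mul_assoc, ← (scal_commute r _).eq, mul_assoc]
  rw [e4, e, mul_add, mul_one, ← (unip_commute z _).eq]
  noncomm_ring

end ToralPair

/-- The algebra map `b ↦ u f(b) v` for mutually inverse `u`, `v`. -/
def conjHom {R B C : Type*} [CommRing R] [Ring B] [Algebra R B] [Ring C] [Algebra R C]
    (f : B →ₐ[R] C) (u v : C) (huv : u * v = 1) (hvu : v * u = 1) : B →ₐ[R] C :=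
  AlgHom.ofLinearMap (LinearMap.mulLeft R u ∘ₗ LinearMap.mulRight R v ∘ₗ f.toLinearMap)
    (by simp [huv])
    (fun a b => by
      simp only [LinearMap.comp_apply, LinearMap.mulRight_apply, LinearMap.mulLeft_apply,
        AlgHom.toLinearMap_apply, map_mul, mul_assoc]
      rw [← mul_assoc v u, hvu, one_mul])

theorem conjHom_apply {R B C : Type*} [CommRing R] [Ring B] [Algebra R B] [Ring C] [Algebra R C]
    (f : B →ₐ[R] C) (u v : C) (huv : u * v = 1) (hvu : v * u = 1) (b : B) :
    conjHom f u v huv hvu b = u * f b * v := by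
  simp [conjHom, mul_assoc]

/-! ### Hopf structures from their values on generators -/

namespace HopfStructure

variable {R B : Type*} [CommRing R] [Ring B] [Algebra R B]

/-- The linear map underlying an anti-endomorphism. -/
def antiLin (S : B →ₐ[R] Bᵐᵒᵖ) : B →ₗ[R] B :=
  (MulOpposite.opLinearEquiv R).symm.toLinearMap ∘ₗ S.toLinearMap

theorem antiLin_apply (S : B →ₐ[R] Bᵐᵒᵖ) (b : B) : antiLin S b = (S b).unop := rfl

theorem antiLin_mul (S : B →ₐ[R] Bᵐᵒᵖ) (a b : B) :
    antiLin S (a * b) = antiLin S b * antiLin S a := by simp [antiLin_apply]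

theorem antiLin_one (S : B →ₐ[R] Bᵐᵒᵖ) : antiLin S 1 = 1 := by simp [antiLin_apply]

theorem antiLin_natCast (S : B →ₐ[R] Bᵐᵒᵖ) (m : ℕ) : antiLin S (m : B) = m := by
  simp [antiLin_apply]

theorem antiLin_pow (S : B →ₐ[R] Bᵐᵒᵖ) (a : B) (m : ℕ) : antiLin S (a ^ m) = antiLin S a ^ m := by
  simp [antiLin_apply]

theorem mul'_rTensor_mul (S : B →ₐ[R] Bᵐᵒᵖ) {w : B ⊗[R] B} {c : R}
    (hw : LinearMap.mul' R B ((antiLin S).rTensor B w) = algebraMap R B c) (w' : B ⊗[R] B) :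
    LinearMap.mul' R B ((antiLin S).rTensor B (w * w')) =
      algebraMap R B c * LinearMap.mul' R B ((antiLin S).rTensor B w') := by
  induction w' using TensorProduct.induction_on with
  | zero => simp
  | add x y hx hy => rw [mul_add, map_add, map_add, hx, hy, map_add, map_add, mul_add]
  | tmul x y =>
    have key : ∀ v : B ⊗[R] B, LinearMap.mul' R B ((antiLin S).rTensor B (v * x ⊗ₜ[R] y)) =
        antiLin S x * LinearMap.mul' R B ((antiLin S).rTensor B v) * y := by
      intro v
      induction v using TensorProduct.induction_on with
      | zero => simp
      | add a b ha hb => rw [add_mul, map_add, map_add, ha, hb, map_add, map_add, mul_add, add_mul]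
      | tmul a b =>
        simp only [Algebra.TensorProduct.tmul_mul_tmul, LinearMap.rTensor_tmul,
          LinearMap.mul'_apply, antiLin_mul, mul_assoc]
    rw [key, hw, ← (Algebra.commute_algebraMap_left c _).eq, mul_assoc, LinearMap.rTensor_tmul,
      LinearMap.mul'_apply]

theorem mul'_lTensor_mul (S : B →ₐ[R] Bᵐᵒᵖ) {w' : B ⊗[R] B} {c : R}
    (hw : LinearMap.mul' R B ((antiLin S).lTensor B w') = algebraMap R B c) (w : B ⊗[R] B) :
    LinearMap.mul' R B ((antiLin S).lTensor B (w * w')) =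
      algebraMap R B c * LinearMap.mul' R B ((antiLin S).lTensor B w) := by
  induction w using TensorProduct.induction_on with
  | zero => simp
  | add x y hx hy => rw [add_mul, map_add, map_add, hx, hy, map_add, map_add, mul_add]
  | tmul x y =>
    have key : ∀ v : B ⊗[R] B, LinearMap.mul' R B ((antiLin S).lTensor B (x ⊗ₜ[R] y * v)) =
        x * LinearMap.mul' R B ((antiLin S).lTensor B v) * antiLin S y := by
      intro v
      induction v using TensorProduct.induction_on with
      | zero => simp
      | add a b ha hb => rw [mul_add, map_add, map_add, ha, hb, map_add, map_add, mul_add, add_mul]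
      | tmul a b =>
        simp only [Algebra.TensorProduct.tmul_mul_tmul, LinearMap.lTensor_tmul,
          LinearMap.mul'_apply, antiLin_mul, mul_assoc]
    rw [key, hw, ← (Algebra.commute_algebraMap_left c x).eq, mul_assoc, LinearMap.lTensor_tmul,
      LinearMap.mul'_apply]

/-- A Hopf structure whose axioms are checked on generators. -/
def ofGenerators (Δ : B →ₐ[R] B ⊗[R] B) (ε : B →ₐ[R] R) (S : B →ₐ[R] Bᵐᵒᵖ) (G : Set B)
    (hG : Algebra.adjoin R G = ⊤)
    (coassoc : ∀ b ∈ G, Algebra.TensorProduct.assoc R R R B B B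
        (Algebra.TensorProduct.map Δ (AlgHom.id R B) (Δ b)) =
      Algebra.TensorProduct.map (AlgHom.id R B) Δ (Δ b))
    (counit_left : ∀ b ∈ G, Algebra.TensorProduct.map ε (AlgHom.id R B) (Δ b) = 1 ⊗ₜ[R] b)
    (counit_right : ∀ b ∈ G, Algebra.TensorProduct.map (AlgHom.id R B) ε (Δ b) = b ⊗ₜ[R] 1)
    (antipode_left : ∀ b ∈ G, LinearMap.mul' R B ((antiLin S).rTensor B (Δ b)) =
      algebraMap R B (ε b))
    (antipode_right : ∀ b ∈ G, LinearMap.mul' R B ((antiLin S).lTensor B (Δ b)) =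
      algebraMap R B (ε b)) : HopfStructure R B where
  Δ := Δ
  counit := ε
  antipode := antiLin S
  coassoc := by
    have h : ((Algebra.TensorProduct.assoc R R R B B B).toAlgHom.comp
        (Algebra.TensorProduct.map Δ (AlgHom.id R B))).comp Δ =
        (Algebra.TensorProduct.map (AlgHom.id R B) Δ).comp Δ :=
      AlgHom.ext_of_adjoin_eq_top hG fun b hb => coassoc b hb
    exact congrArg AlgHom.toLinearMap h
  counit_left := by
    have h : (Algebra.TensorProduct.map ε (AlgHom.id R B)).comp Δ =
        Algebra.TensorProduct.includeRight :=
      AlgHom.ext_of_adjoin_eq_top hG fun b hb => counit_left b hb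
    exact congrArg AlgHom.toLinearMap h
  counit_right := by
    have h : (Algebra.TensorProduct.map (AlgHom.id R B) ε).comp Δ =
        Algebra.TensorProduct.includeLeft :=
      AlgHom.ext_of_adjoin_eq_top hG fun b hb => counit_right b hb
    exact congrArg AlgHom.toLinearMap h
  antipode_left := by
    ext b
    change LinearMap.mul' R B ((antiLin S).rTensor B (Δ b)) = algebraMap R B (ε b)
    have hb : b ∈ Algebra.adjoin R G := hG ▸ Algebra.mem_top
    induction hb using Algebra.adjoin_induction with
    | mem b hb => exact antipode_left b hb
    | algebraMap r =>
      rw [AlgHom.commutes, AlgHom.commutes, Algebra.algebraMap_eq_smul_one, map_smul, map_smul,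
        Algebra.TensorProduct.one_def, LinearMap.rTensor_tmul, antiLin_one, LinearMap.mul'_apply,
        mul_one]
      simp [Algebra.algebraMap_eq_smul_one]
    | add x y _ _ hx hy => simp only [map_add, hx, hy]
    | mul x y _ _ hx hy => rw [map_mul, mul'_rTensor_mul S hx, hy, map_mul, map_mul]
  antipode_right := by
    ext b
    change LinearMap.mul' R B ((antiLin S).lTensor B (Δ b)) = algebraMap R B (ε b)
    have hb : b ∈ Algebra.adjoin R G := hG ▸ Algebra.mem_top
    induction hb using Algebra.adjoin_induction with
    | mem b hb => exact antipode_right b hb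
    | algebraMap r =>
      rw [AlgHom.commutes, AlgHom.commutes, Algebra.algebraMap_eq_smul_one, map_smul, map_smul,
        Algebra.TensorProduct.one_def, LinearMap.lTensor_tmul, antiLin_one, LinearMap.mul'_apply,
        mul_one]
      simp [Algebra.algebraMap_eq_smul_one]
    | add x y _ _ hx hy => simp only [map_add, hx, hy]
    | mul x y _ _ hx hy =>
      rw [map_mul, mul'_lTensor_mul S hy, hx, map_mul, map_mul]
      exact Algebra.commutes _ _

end HopfStructure

/-! ### The twist attached to a primitive toral pair -/

section Twist

variable {p : ℕ} [Fact p.Prime] {R B : Type*} [CommRing R] [Ring B] [Algebra R B]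
  [CharP B p] {h z : B}

/-- The twist `∑ π_s ⊗ (1 + z)^s`. -/
def twistF (p : ℕ) [Fact p.Prime] (R : Type*) {B : Type*} [CommRing R] [Ring B] [Algebra R B]
    [CharP B p] (h z : B) : B ⊗[R] B := ∑ s : ZMod p, eigenIdem h s ⊗ₜ[R] unip z s

/-- The inverse `∑ π_s ⊗ (1 + z)^(-s)` of the twist. -/
def twistFinv (p : ℕ) [Fact p.Prime] (R : Type*) {B : Type*} [CommRing R] [Ring B] [Algebra R B]
    [CharP B p] (h z : B) : B ⊗[R] B := ∑ s : ZMod p, eigenIdem h s ⊗ₜ[R] unip z (-s)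

theorem sum_eigenIdem_tmul_mul (hh : h ^ p = h) (f g : ZMod p → B) :
    (∑ s : ZMod p, eigenIdem h s ⊗ₜ[R] f s) * (∑ s : ZMod p, eigenIdem h s ⊗ₜ[R] g s) =
      ∑ s : ZMod p, eigenIdem h s ⊗ₜ[R] (f s * g s) := by
  rw [Finset.sum_mul]
  refine Finset.sum_congr rfl fun s _ => ?_
  rw [Finset.mul_sum, Finset.sum_eq_single s]
  · rw [Algebra.TensorProduct.tmul_mul_tmul, eigenIdem_mul_eigenIdem hh, if_pos rfl]
  · intro r _ hr
    rw [Algebra.TensorProduct.tmul_mul_tmul, eigenIdem_mul_eigenIdem hh, if_neg hr.symm,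
      TensorProduct.zero_tmul]
  · simp

theorem sum_eigenIdem_tmul_one : ∑ s : ZMod p, eigenIdem h s ⊗ₜ[R] (1 : B) = 1 := by
  rw [← TensorProduct.sum_tmul, sum_eigenIdem, Algebra.TensorProduct.one_def]

variable (H : ToralPair p h z)
include H

theorem twistF_mul_inv : twistF p R h z * twistFinv p R h z = 1 := by
  rw [twistF, twistFinv, sum_eigenIdem_tmul_mul H.toral]
  simp only [unip_mul_neg H.nil, sum_eigenIdem_tmul_one]

theorem twistFinv_mul : twistFinv p R h z * twistF p R h z = 1 := by
  rw [twistF, twistFinv, sum_eigenIdem_tmul_mul H.toral]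
  simp only [unip_neg_mul H.nil, sum_eigenIdem_tmul_one]

theorem twistF_mul_weight_tmul_one {y : B} {m : ZMod p} (hy : h * y = y * (h + scal B m)) :
    twistF p R h z * y ⊗ₜ[R] 1 = y ⊗ₜ[R] unip z m * twistF p R h z := by
  rw [twistF, Finset.sum_mul, Finset.mul_sum, ← Equiv.sum_comp (Equiv.addRight m)]
  refine Finset.sum_congr rfl fun s _ => ?_
  rw [Equiv.coe_addRight, Algebra.TensorProduct.tmul_mul_tmul, Algebra.TensorProduct.tmul_mul_tmul,
    eigenIdem_mul_weight hy, add_sub_cancel_right, mul_one]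
  change _ ⊗ₜ[R] unip z (s + m) = _
  rw [add_comm, unip_add H.nil]

theorem twistF_conj_one_tmul (y : B) :
    twistF p R h z * 1 ⊗ₜ[R] y * twistFinv p R h z =
      ∑ s : ZMod p, eigenIdem h s ⊗ₜ[R] (unip z s * y * unip z (-s)) := by
  rw [← sum_eigenIdem_tmul_mul H.toral, twistF, twistFinv, Finset.sum_mul]
  simp

theorem twistF_conj_weight {y : B} {m : ZMod p} (hy : h * y = y * (h + scal B m)) :
    twistF p R h z * (y ⊗ₜ[R] 1 + 1 ⊗ₜ[R] y) * twistFinv p R h z =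
      y ⊗ₜ[R] unip z m +
        ∑ s : ZMod p, eigenIdem h s ⊗ₜ[R] (unip z s * y * unip z (-s)) := by
  rw [mul_add, add_mul, twistF_conj_one_tmul H, twistF_mul_weight_tmul_one H hy, mul_assoc,
    twistF_mul_inv H, mul_one]

theorem twistF_mul_primitive_z :
    twistF p R h z * (1 + (z ⊗ₜ[R] 1 + 1 ⊗ₜ[R] z)) =
      (1 + z) ⊗ₜ[R] (1 + z) * twistF p R h z := by
  have hz : h * z = z * (h + scal B (1 : ZMod p)) := by rw [map_one, H.comm]
  have h1 : twistF p R h z * 1 ⊗ₜ[R] z = 1 ⊗ₜ[R] z * twistF p R h z := by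
    rw [twistF, Finset.sum_mul, Finset.mul_sum]
    refine Finset.sum_congr rfl fun s _ => ?_
    rw [Algebra.TensorProduct.tmul_mul_tmul, Algebra.TensorProduct.tmul_mul_tmul, mul_one, one_mul,
      (unip_commute z s).eq]
  rw [mul_add, mul_add, twistF_mul_weight_tmul_one H hz, h1, unip_one H.nil, mul_one,
    TensorProduct.add_tmul, TensorProduct.tmul_add 1 1 z, ← Algebra.TensorProduct.one_def]
  simp only [add_mul, one_mul]
  abel

theorem twistF_mul_unip (Δ : B →ₐ[R] B ⊗[R] B) (hΔz : Δ z = z ⊗ₜ[R] 1 + 1 ⊗ₜ[R] z) (a : ZMod p) :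
    twistF p R h z * Δ (unip z a) = unip z a ⊗ₜ[R] unip z a * twistF p R h z := by
  have h1 : SemiconjBy (twistF p R h z) (Δ (1 + z)) ((1 + z) ⊗ₜ[R] (1 + z)) := by
    rw [map_add, map_one, hΔz]; exact twistF_mul_primitive_z H
  have := (h1.pow_right a.val).eq
  rwa [← map_pow, Algebra.TensorProduct.tmul_pow] at this

theorem comul_eigenIdem [CharP (B ⊗[R] B) p] (Δ : B →ₐ[R] B ⊗[R] B)
    (hΔh : Δ h = h ⊗ₜ[R] 1 + 1 ⊗ₜ[R] h) (s : ZMod p) :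
    Δ (eigenIdem h s) = ∑ a : ZMod p, eigenIdem h a ⊗ₜ[R] eigenIdem h (s - a) := by
  have hl : ∀ a : ZMod p, scal (B ⊗[R] B) a = scal B a ⊗ₜ[R] 1 := fun a =>
    (map_scal (Algebra.TensorProduct.includeLeft : B →ₐ[R] B ⊗[R] B).toRingHom a).symm
  have hr : ∀ a : ZMod p, scal (B ⊗[R] B) a = 1 ⊗ₜ[R] scal B a := fun a =>
    (map_scal (Algebra.TensorProduct.includeRight : B →ₐ[R] B ⊗[R] B).toRingHom a).symm
  have hev : ∀ a b : ZMod p, Δ h * (eigenIdem h a ⊗ₜ[R] eigenIdem h b) =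
      scal (B ⊗[R] B) (a + b) * (eigenIdem h a ⊗ₜ[R] eigenIdem h b) := by
    intro a b
    rw [map_add, add_mul, hl a, hr b, hΔh, add_mul]
    simp only [Algebra.TensorProduct.tmul_mul_tmul, one_mul, mul_eigenIdem H.toral]
  have h1 : (1 : B ⊗[R] B) =
      ∑ a : ZMod p, ∑ b : ZMod p, eigenIdem h a ⊗ₜ[R] eigenIdem h b := by
    simp only [← TensorProduct.tmul_sum, ← TensorProduct.sum_tmul, sum_eigenIdem,
      Algebra.TensorProduct.one_def]
  have h2 : Δ (eigenIdem h s) = eigenIdem (Δ h) s := map_eigenIdem Δ.toRingHom h s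
  rw [h2, ← mul_one (eigenIdem (Δ h) s), h1, Finset.mul_sum]
  refine Finset.sum_congr rfl fun a _ => ?_
  rw [Finset.mul_sum, Finset.sum_eq_single (s - a)]
  · rw [eigenIdem_mul_of_eigen (hev _ _), if_pos (by abel)]
  · intro b _ hb
    rw [eigenIdem_mul_of_eigen (hev _ _), if_neg]
    rintro rfl
    exact hb (by abel)
  · simp

theorem twist_cocycle [CharP (B ⊗[R] B) p] (Δ : B →ₐ[R] B ⊗[R] B)
    (hΔh : Δ h = h ⊗ₜ[R] 1 + 1 ⊗ₜ[R] h) (hΔz : Δ z = z ⊗ₜ[R] 1 + 1 ⊗ₜ[R] z) :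
    Algebra.TensorProduct.assoc R R R B B B (twistF p R h z ⊗ₜ[R] 1 *
        Algebra.TensorProduct.map Δ (AlgHom.id R B) (twistF p R h z)) =
      (1 ⊗ₜ[R] twistF p R h z) *
        Algebra.TensorProduct.map (AlgHom.id R B) Δ (twistF p R h z) := by
  have hl : twistF p R h z ⊗ₜ[R] 1 *
      Algebra.TensorProduct.map Δ (AlgHom.id R B) (twistF p R h z) =
      ∑ s : ZMod p, ∑ a : ZMod p,
        (eigenIdem h a ⊗ₜ[R] (unip z a * eigenIdem h (s - a))) ⊗ₜ[R] unip z s := by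
    conv_lhs => rw [twistF]
    rw [map_sum, Finset.mul_sum]
    refine Finset.sum_congr rfl fun s _ => ?_
    rw [Algebra.TensorProduct.map_tmul, comul_eigenIdem H Δ hΔh, AlgHom.id_apply,
      Algebra.TensorProduct.tmul_mul_tmul, one_mul, sum_eigenIdem_tmul_mul H.toral,
      TensorProduct.sum_tmul]
  have hr : (1 ⊗ₜ[R] twistF p R h z) *
      Algebra.TensorProduct.map (AlgHom.id R B) Δ (twistF p R h z) =
      ∑ a : ZMod p, ∑ b : ZMod p,
        eigenIdem h a ⊗ₜ[R] ((unip z a * eigenIdem h b) ⊗ₜ[R] unip z (a + b)) := by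
    conv_lhs => enter [2]; rw [twistF]
    rw [map_sum, Finset.mul_sum]
    refine Finset.sum_congr rfl fun a _ => ?_
    rw [Algebra.TensorProduct.map_tmul, AlgHom.id_apply, Algebra.TensorProduct.tmul_mul_tmul,
      one_mul, twistF_mul_unip H Δ hΔz, twistF, Finset.mul_sum, TensorProduct.tmul_sum]
    simp only [Algebra.TensorProduct.tmul_mul_tmul, unip_add H.nil]
  rw [hl, hr, Finset.sum_comm]
  simp only [map_sum, Algebra.TensorProduct.assoc_tmul]
  refine Finset.sum_congr rfl fun a _ => ?_
  rw [← Equiv.sum_comp (Equiv.addLeft a)]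
  simp

end Twist

namespace HopfStructure

variable {p : ℕ} [Fact p.Prime] {R B : Type*} [CommRing R] [Ring B] [Algebra R B]
  [CharP R p] [CharP B p] [CharP (B ⊗[R] B) p] {h z : B}

/-- The twist of a Hopf structure by a primitive toral pair. -/
def twist (hp : 2 < p) (X : HopfStructure R B) (S : B →ₐ[R] Bᵐᵒᵖ) (hS : X.antipode = antiLin S)
    (H : ToralPair p h z) (hΔh : X.Δ h = h ⊗ₜ[R] 1 + 1 ⊗ₜ[R] h)
    (hΔz : X.Δ z = z ⊗ₜ[R] 1 + 1 ⊗ₜ[R] z) (hεh : X.counit h = 0) (hεz : X.counit z = 0)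
    (hSh : X.antipode h = -h) (hSz : X.antipode z = -z) : HopfStructure R B where
  Δ := conjHom X.Δ _ _ (twistF_mul_inv H) (twistFinv_mul H)
  counit := X.counit
  antipode := LinearMap.mulLeft R (ToralPair.V p h (-z)) ∘ₗ
    LinearMap.mulRight R (ToralPair.V p h z) ∘ₗ X.antipode
  coassoc := by
    have hcoassoc : ∀ b, Algebra.TensorProduct.assoc R R R B B B
        (Algebra.TensorProduct.map X.Δ (AlgHom.id R B) (X.Δ b)) =
        Algebra.TensorProduct.map (AlgHom.id R B) X.Δ (X.Δ b) :=
      fun b => LinearMap.congr_fun X.coassoc b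
    set F := twistF p R h z with hF
    set F' := twistFinv p R h z with hF'
    have hFF : F * F' = 1 := twistF_mul_inv H
    have hFF' : F' * F = 1 := twistFinv_mul H
    set Δ' := conjHom X.Δ F F' hFF hFF' with hΔ'
    have h1 : ∀ w, Algebra.TensorProduct.map Δ' (AlgHom.id R B) w =
        F ⊗ₜ[R] 1 * Algebra.TensorProduct.map X.Δ (AlgHom.id R B) w * F' ⊗ₜ[R] 1 := by
      intro w
      induction w using TensorProduct.induction_on with
      | zero => simp
      | add x y hx hy => simp only [map_add, hx, hy, mul_add, add_mul]
      | tmul x y => simp [hΔ', conjHom_apply]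
    have h2 : ∀ w, Algebra.TensorProduct.map (AlgHom.id R B) Δ' w =
        1 ⊗ₜ[R] F * Algebra.TensorProduct.map (AlgHom.id R B) X.Δ w * 1 ⊗ₜ[R] F' := by
      intro w
      induction w using TensorProduct.induction_on with
      | zero => simp
      | add x y hx hy => simp only [map_add, hx, hy, mul_add, add_mul]
      | tmul x y => simp [hΔ', conjHom_apply]
    have hC := twist_cocycle H X.Δ hΔh hΔz
    have hC' : Algebra.TensorProduct.assoc R R R B B B
        (Algebra.TensorProduct.map X.Δ (AlgHom.id R B) F' * F' ⊗ₜ[R] 1) =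
        Algebra.TensorProduct.map (AlgHom.id R B) X.Δ F' * 1 ⊗ₜ[R] F' := by
      refine left_inv_eq_right_inv (a := Algebra.TensorProduct.assoc R R R B B B (F ⊗ₜ[R] 1 *
        Algebra.TensorProduct.map X.Δ (AlgHom.id R B) F)) ?_ ?_
      · rw [← map_mul, mul_assoc, ← mul_assoc (F' ⊗ₜ[R] (1 : B)),
          Algebra.TensorProduct.tmul_mul_tmul, hFF', one_mul, ← Algebra.TensorProduct.one_def,
          one_mul, ← map_mul, hFF', map_one, map_one]
      · rw [hC, mul_assoc, ← mul_assoc (Algebra.TensorProduct.map (AlgHom.id R B) X.Δ F),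
          ← map_mul, hFF, map_one, one_mul, Algebra.TensorProduct.tmul_mul_tmul, hFF, one_mul,
          ← Algebra.TensorProduct.one_def]
    ext b
    change Algebra.TensorProduct.assoc R R R B B B
      (Algebra.TensorProduct.map Δ' (AlgHom.id R B) (Δ' b)) =
      Algebra.TensorProduct.map (AlgHom.id R B) Δ' (Δ' b)
    have e : Δ' b = F * X.Δ b * F' := conjHom_apply ..
    have e1 : F ⊗ₜ[R] (1 : B) * (Algebra.TensorProduct.map X.Δ (AlgHom.id R B) (F * X.Δ b * F')) *
        F' ⊗ₜ[R] (1 : B) = (F ⊗ₜ[R] 1 * Algebra.TensorProduct.map X.Δ (AlgHom.id R B) F) *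
          (Algebra.TensorProduct.map X.Δ (AlgHom.id R B) (X.Δ b)) *
          (Algebra.TensorProduct.map X.Δ (AlgHom.id R B) F' * F' ⊗ₜ[R] 1) := by
      simp only [map_mul, mul_assoc]
    rw [h1, h2, e, e1, map_mul, map_mul, hC, hC', hcoassoc]
    simp only [map_mul, mul_assoc, hF]
  counit_left := by
    have hcl : ∀ b, Algebra.TensorProduct.map X.counit (AlgHom.id R B) (X.Δ b) = 1 ⊗ₜ[R] b :=
      fun b => LinearMap.congr_fun X.counit_left b
    have hπ : ∀ s : ZMod p, X.counit (eigenIdem h s) = if s = 0 then 1 else 0 := by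
      intro s
      have h1 : X.counit (eigenIdem h s) = eigenIdem (X.counit h) s :=
        map_eigenIdem X.counit.toRingHom h s
      have h2 : (0 : R) * 1 = scal R (0 : ZMod p) * 1 := by simp
      rw [h1, hεh, ← mul_one (eigenIdem (0 : R) s), eigenIdem_mul_of_eigen h2]
    have hsum : ∀ f : ZMod p → B, f 0 = 1 → Algebra.TensorProduct.map X.counit (AlgHom.id R B)
        (∑ s : ZMod p, eigenIdem h s ⊗ₜ[R] f s) = 1 := by
      intro f hf
      rw [map_sum, Finset.sum_eq_single 0]
      · simp [hπ, hf, Algebra.TensorProduct.one_def]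
      · intro s _ hs
        simp [hπ, hs]
      · simp
    ext b
    change Algebra.TensorProduct.map X.counit (AlgHom.id R B)
      (conjHom X.Δ _ _ (twistF_mul_inv H) (twistFinv_mul H) b) = 1 ⊗ₜ[R] b
    rw [conjHom_apply, map_mul, map_mul, hcl, twistF, twistFinv, hsum _ (unip_zero z),
      hsum (fun s => unip z (-s)) (by simp [unip_zero]), one_mul, mul_one]
  counit_right := by
    have hcl : ∀ b, Algebra.TensorProduct.map (AlgHom.id R B) X.counit (X.Δ b) = b ⊗ₜ[R] 1 :=
      fun b => LinearMap.congr_fun X.counit_right b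
    have hu : ∀ s : ZMod p, X.counit (unip z s) = 1 := by
      intro s
      have h1 : X.counit (unip z s) = unip (X.counit z) s := map_unip X.counit.toRingHom z s
      rw [h1, hεz]; simp [unip]
    have hsum : ∀ f : ZMod p → ZMod p, Algebra.TensorProduct.map (AlgHom.id R B) X.counit
        (∑ s : ZMod p, eigenIdem h s ⊗ₜ[R] unip z (f s)) = 1 := by
      intro f
      simp only [map_sum, Algebra.TensorProduct.map_tmul, hu, AlgHom.id_apply]
      rw [← TensorProduct.sum_tmul, sum_eigenIdem, Algebra.TensorProduct.one_def]
    ext b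
    change Algebra.TensorProduct.map (AlgHom.id R B) X.counit
      (conjHom X.Δ _ _ (twistF_mul_inv H) (twistFinv_mul H) b) = b ⊗ₜ[R] 1
    rw [conjHom_apply, map_mul, map_mul, hcl, twistF, twistFinv, hsum (fun s => s),
      hsum (fun s => -s), one_mul, mul_one]
  antipode_left := by
    have hal : ∀ b, LinearMap.mul' R B (X.antipode.rTensor B (X.Δ b)) = algebraMap R B (X.counit b) :=
      fun b => LinearMap.congr_fun X.antipode_left b
    have hmul : ∀ a b, X.antipode (a * b) = X.antipode b * X.antipode a := by
      rw [hS]; exact antiLin_mul S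
    have hπ : ∀ s : ZMod p, X.antipode (eigenIdem h s) = eigenIdem h (-s) := by
      intro s
      have hpar : Even (p - 1) :=
        (Fact.out : p.Prime).even_sub_one hp.ne'
      have e : -h - scal B s = -(h - scal B (-s)) := by rw [map_neg]; abel
      rw [eigenIdem, map_sub, hS, antiLin_one, antiLin_pow, map_sub, scal_eq_natCast,
        antiLin_natCast, ← scal_eq_natCast, ← hS, hSh, e, hpar.neg_pow, eigenIdem]
    set v := ToralPair.V p h (-z)
    set v' := ToralPair.V p h z
    set T : B →ₗ[R] B := LinearMap.mulLeft R v ∘ₗ LinearMap.mulRight R v' ∘ₗ X.antipode with hT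
    have hTa : ∀ b, T b = v * (X.antipode b * v') := fun b => rfl
    have hv : ∑ r : ZMod p, eigenIdem h (-r) * v' * unip z r = 1 := by
      rw [← sum_eigenIdem (p := p) h, ← Equiv.sum_comp (Equiv.neg (ZMod p))]
      refine Finset.sum_congr rfl fun s _ => ?_
      rw [Equiv.neg_apply, neg_neg, H.eigenIdem_mul_V, mul_assoc, unip_mul_neg H.nil, mul_one]
    have key : ∀ w, LinearMap.mul' R B (T.rTensor B (twistF p R h z * w * twistFinv p R h z)) =
        v * ∑ s : ZMod p, eigenIdem h (-s) * LinearMap.mul' R B (X.antipode.rTensor B w) *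
          unip z (-s) := by
      intro w
      induction w using TensorProduct.induction_on with
      | zero => simp
      | add x y hx hy =>
        rw [mul_add, add_mul, map_add, map_add, hx, hy, ← mul_add, ← Finset.sum_add_distrib]
        simp only [map_add, mul_add, add_mul]
      | tmul x y =>
        simp only [twistF, twistFinv, Finset.mul_sum, Finset.sum_mul, map_sum,
          Algebra.TensorProduct.tmul_mul_tmul, LinearMap.rTensor_tmul, LinearMap.mul'_apply, hTa,
          hmul, hπ]
        refine Finset.sum_congr rfl fun s _ => ?_
        calc _ = v * (eigenIdem h (-s) * (X.antipode x *
              (∑ r : ZMod p, eigenIdem h (-r) * v' * unip z r) * y) * unip z (-s)) := by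
              simp only [Finset.mul_sum, Finset.sum_mul, mul_assoc]
          _ = _ := by rw [hv, mul_one]
    ext b
    change LinearMap.mul' R B (T.rTensor B
      (conjHom X.Δ _ _ (twistF_mul_inv H) (twistFinv_mul H) b)) = algebraMap R B (X.counit b)
    rw [conjHom_apply, key, hal]
    have e : ∀ s : ZMod p, eigenIdem h (-s) * algebraMap R B (X.counit b) * unip z (-s) =
        algebraMap R B (X.counit b) * (eigenIdem h (-s) * unip z (-s)) := fun s => by
      rw [← Algebra.commutes, mul_assoc]
    simp only [e]
    have e2 : ∑ s : ZMod p, eigenIdem h (-s) * unip z (-s) = v' :=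
      Equiv.sum_comp (Equiv.neg (ZMod p)) fun s => eigenIdem h s * unip z s
    rw [← Finset.mul_sum, e2, ← mul_assoc, ← Algebra.commutes, mul_assoc, H.V_neg_mul_V, mul_one]
  antipode_right := by
    have har : ∀ b, LinearMap.mul' R B (X.antipode.lTensor B (X.Δ b)) = algebraMap R B (X.counit b) :=
      fun b => LinearMap.congr_fun X.antipode_right b
    have hmul : ∀ a b, X.antipode (a * b) = X.antipode b * X.antipode a := by
      rw [hS]; exact antiLin_mul S
    have hu : ∀ s : ZMod p, X.antipode (unip z s) = unip (-z) s := by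
      intro s
      rw [unip, hS, antiLin_pow, map_add, antiLin_one, ← hS, hSz, unip]
    set v := ToralPair.V p h (-z) with hvdef
    set v' := ToralPair.V p h z
    set T : B →ₗ[R] B := LinearMap.mulLeft R v ∘ₗ LinearMap.mulRight R v' ∘ₗ X.antipode with hT
    have hTa : ∀ b, T b = v * (X.antipode b * v') := fun b => rfl
    have hv : ∑ s : ZMod p, eigenIdem h s * v * unip (-z) (-s) = 1 := by
      rw [← sum_eigenIdem (p := p) h]
      refine Finset.sum_congr rfl fun s _ => ?_
      rw [H.neg.eigenIdem_mul_V, mul_assoc, unip_mul_neg H.neg.nil, mul_one]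
    have key : ∀ w, LinearMap.mul' R B (T.lTensor B (twistF p R h z * w * twistFinv p R h z)) =
        (∑ s : ZMod p, eigenIdem h s * LinearMap.mul' R B (X.antipode.lTensor B w) *
          unip (-z) s) * v' := by
      intro w
      induction w using TensorProduct.induction_on with
      | zero => simp
      | add x y hx hy =>
        rw [mul_add, add_mul, map_add, map_add, hx, hy, ← add_mul, ← Finset.sum_add_distrib]
        simp only [map_add, mul_add, add_mul]
      | tmul x y =>
        simp only [twistF, twistFinv, Finset.mul_sum, Finset.sum_mul, map_sum,
          Algebra.TensorProduct.tmul_mul_tmul, LinearMap.lTensor_tmul, LinearMap.mul'_apply, hTa,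
          hmul, hu]
        rw [Finset.sum_comm]
        refine Finset.sum_congr rfl fun s _ => ?_
        calc _ = eigenIdem h s * (x * (∑ r : ZMod p, eigenIdem h r * v * unip (-z) (-r)) *
              X.antipode y) * unip (-z) s * v' := by
              simp only [Finset.mul_sum, Finset.sum_mul, mul_assoc]
          _ = _ := by rw [hv, mul_one]
    ext b
    change LinearMap.mul' R B (T.lTensor B
      (conjHom X.Δ _ _ (twistF_mul_inv H) (twistFinv_mul H) b)) = algebraMap R B (X.counit b)
    rw [conjHom_apply, key, har]
    have e : ∀ s : ZMod p, eigenIdem h s * algebraMap R B (X.counit b) * unip (-z) s =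
        algebraMap R B (X.counit b) * (eigenIdem h s * unip (-z) s) := fun s => by
      rw [← Algebra.commutes, mul_assoc]
    simp only [e]
    rw [← Finset.mul_sum, mul_assoc]
    change _ * (v * v') = _
    rw [H.V_neg_mul_V, mul_one]

end HopfStructure

section RisingFalling

/-- The falling product `r (r - 1) ⋯ (r - ℓ + 1)`. -/
def falling {A : Type*} [Ring A] (r : A) : ℕ → A
  | 0 => 1
  | ℓ + 1 => r * falling (r - 1) ℓ

theorem falling_succ {A : Type*} [CommRing A] (r : A) (ℓ : ℕ) :
    falling r (ℓ + 1) = falling r ℓ * (r - ℓ) := by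
  induction ℓ generalizing r with
  | zero => simp [falling]
  | succ ℓ ih =>
    rw [falling, ih (r - 1), falling]
    push_cast
    ring

theorem natCast_descFactorial {A : Type*} [CommRing A] (r ℓ : ℕ) :
    ((r.descFactorial ℓ : ℕ) : A) = falling (r : A) ℓ := by
  induction ℓ generalizing r with
  | zero => simp [falling]
  | succ ℓ ih =>
    cases r with
    | zero => simp [falling]
    | succ r => rw [Nat.succ_descFactorial_succ, falling, Nat.cast_mul, ih]; simp

theorem falling_neg {A : Type*} [CommRing A] (s : A) (ℓ : ℕ) :
    falling (-s) ℓ = (-1) ^ ℓ * rising s 0 ℓ := by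
  induction ℓ with
  | zero => simp [falling, rising]
  | succ ℓ ih => rw [falling_succ, ih, rising, pow_succ]; push_cast; ring

theorem rising_commute {A : Type*} [Ring A] {x y : A} (h : Commute x y) (a ℓ : ℕ) :
    Commute x (rising y a ℓ) := by
  induction ℓ with
  | zero => exact Commute.one_right x
  | succ ℓ ih =>
    exact ih.mul_right ((h.add_right (Nat.commute_cast x a)).add_right (Nat.commute_cast x ℓ))

theorem semiconjBy_rising {A : Type*} [Ring A] {w x y : A} (h : SemiconjBy w x y) (a ℓ : ℕ) :
    SemiconjBy w (rising x a ℓ) (rising y a ℓ) := by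
  induction ℓ with
  | zero => exact SemiconjBy.one_right w
  | succ ℓ ih =>
    exact ih.mul_right ((h.add_right (Nat.commute_cast w a)).add_right (Nat.commute_cast w ℓ))

end RisingFalling

section

variable {p : ℕ} [Fact p.Prime] {R B : Type*} [CommRing R] [Ring B] [Algebra R B]
  [CharP B p] {h z : B}

theorem rising_mul_eigenIdem (hh : h ^ p = h) (s : ZMod p) (a ℓ : ℕ) :
    rising h a ℓ * eigenIdem h s = scal B (rising s a ℓ) * eigenIdem h s := by
  induction ℓ with
  | zero => simp [rising]
  | succ ℓ ih =>
    have e : (h + a + ℓ) * eigenIdem h s = scal B (s + a + ℓ) * eigenIdem h s := by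
      rw [add_mul, add_mul, mul_eigenIdem hh, map_add, map_add, map_natCast, map_natCast]
      noncomm_ring
    rw [rising, mul_assoc, e, ← mul_assoc, ← (scal_commute _ _).eq, mul_assoc, ih, rising, map_mul,
      ← mul_assoc, (scal_commute _ _).eq]

theorem sum_eigenIdem_scal_rising (hh : h ^ p = h) (a ℓ : ℕ) :
    ∑ s : ZMod p, scal B (rising s a ℓ) * eigenIdem h s = rising h a ℓ := by
  simp only [← rising_mul_eigenIdem hh, ← Finset.mul_sum, sum_eigenIdem, mul_one]

theorem mul_one_add_pow (y z : B) (r : ℕ) : y * (1 + z) ^ r = ∑ ℓ ∈ Finset.range (r + 1),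
    (r.choose ℓ : B) *
      ((1 + z) ^ (r - ℓ) * ((LinearMap.mulRight R z - LinearMap.mulLeft R z) ^ ℓ) y) := by
  set N := LinearMap.mulRight R z - LinearMap.mulLeft R z with hN
  have h1 : LinearMap.mulRight R (1 + z) = N + LinearMap.mulLeft R (1 + z) := by
    ext y; simp only [hN, LinearMap.mulRight_apply, LinearMap.add_apply, LinearMap.sub_apply,
      LinearMap.mulLeft_apply]; noncomm_ring
  have h2 : Commute N (LinearMap.mulLeft R (1 + z)) := by
    ext y
    simp only [hN, Module.End.mul_apply, LinearMap.mulRight_apply, LinearMap.sub_apply,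
      LinearMap.mulLeft_apply]
    noncomm_ring
  have h3 : y * (1 + z) ^ r = (LinearMap.mulRight R (1 + z) ^ r) y := by
    rw [LinearMap.pow_mulRight, LinearMap.mulRight_apply]
  rw [h3, h1, h2.add_pow, LinearMap.sum_apply]
  refine Finset.sum_congr rfl fun ℓ _ => ?_
  have h4 : ∀ c : ℕ, N ^ ℓ * LinearMap.mulLeft R (1 + z) ^ (r - ℓ) * (c : Module.End R B) =
      c • (LinearMap.mulLeft R (1 + z) ^ (r - ℓ) * N ^ ℓ) := by
    intro c
    rw [(h2.pow_pow _ _).eq, ← nsmul_eq_mul', ]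
  rw [h4, LinearMap.smul_apply, Module.End.mul_apply, LinearMap.pow_mulLeft,
    LinearMap.mulLeft_apply, nsmul_eq_mul]

theorem mul_unip (H : ToralPair p h z) {y : B} {W : ℕ → B}
    (hW : ∀ ℓ < p, ((LinearMap.mulRight R z - LinearMap.mulLeft R z) ^ ℓ) y = (ℓ ! : B) * W ℓ)
    (r : ZMod p) :
    y * unip z r = ∑ ℓ ∈ Finset.range p, scal B (falling r ℓ) * (unip z (r - (ℓ : ZMod p)) * W ℓ) := by
  rw [unip, mul_one_add_pow (R := R)]
  have hr : r.val + 1 ≤ p := ZMod.val_lt r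
  rw [← Finset.sum_subset (Finset.range_mono hr)]
  · refine Finset.sum_congr rfl fun ℓ hℓ => ?_
    have hℓ' : ℓ ≤ r.val := by simpa [Nat.lt_succ_iff] using hℓ
    have e : (r - ℓ : ZMod p) = ((r.val - ℓ : ℕ) : ZMod p) := by
      rw [Nat.cast_sub hℓ', ZMod.natCast_zmod_val]
    have e2 : falling r ℓ = ((r.val.descFactorial ℓ : ℕ) : ZMod p) := by
      rw [natCast_descFactorial, ZMod.natCast_zmod_val]
    rw [hW ℓ (by omega), e, unip_natCast H.nil, e2, map_natCast, Nat.descFactorial_eq_factorial_mul_choose,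
      ← mul_assoc _ (ℓ ! : B), ← (Nat.cast_commute ℓ ! _).eq, mul_assoc, ← mul_assoc, ← Nat.cast_mul,
      mul_comm (ℓ !)]
  · intro ℓ _ hℓ
    have hℓ' : r.val < ℓ := by simpa using hℓ
    have e2 : falling r ℓ = 0 := by
      rw [← ZMod.natCast_zmod_val r, ← natCast_descFactorial,
        Nat.descFactorial_eq_zero_iff_lt.2 hℓ', Nat.cast_zero]
    rw [e2, map_zero, zero_mul]

/-- The twisted coproduct of a primitive element, second summand. -/
theorem sum_eigenIdem_tmul_conj (H : ToralPair p h z) {y : B} {W : ℕ → B}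
    (hW : ∀ ℓ < p, ((LinearMap.mulRight R z - LinearMap.mulLeft R z) ^ ℓ) y = (ℓ ! : B) * W ℓ) :
    ∑ s : ZMod p, eigenIdem h s ⊗ₜ[R] (unip z s * y * unip z (-s)) =
      ∑ ℓ ∈ Finset.range p, (-1 : ℤ) ^ ℓ •
        (rising h 0 ℓ ⊗ₜ[R] (unip z (-(ℓ : ZMod p)) * W ℓ)) := by
  have h1 : ∀ s : ZMod p, unip z s * y * unip z (-s) = ∑ ℓ ∈ Finset.range p,
      (((-1 : ℤ) ^ ℓ * ((rising s 0 ℓ).val : ℤ) : ℤ) • (unip z (-(ℓ : ZMod p)) * W ℓ)) := by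
    intro s
    rw [mul_assoc, mul_unip H hW, Finset.mul_sum]
    refine Finset.sum_congr rfl fun ℓ _ => ?_
    rw [← mul_assoc, ← (scal_commute _ _).eq, mul_assoc, ← mul_assoc (unip z s), ← unip_add H.nil,
      add_sub_assoc', add_neg_cancel, zero_sub, falling_neg, zsmul_eq_mul, map_mul, map_pow,
      map_neg, map_one, scal_eq_natCast]
    push_cast
    rfl
  simp only [h1, TensorProduct.tmul_sum]
  rw [Finset.sum_comm]
  refine Finset.sum_congr rfl fun ℓ _ => ?_
  rw [← sum_eigenIdem_scal_rising H.toral, TensorProduct.sum_tmul, Finset.smul_sum]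
  refine Finset.sum_congr rfl fun s _ => ?_
  rw [TensorProduct.tmul_smul, mul_smul, scal_eq_natCast, ← nsmul_eq_mul, ← TensorProduct.smul_tmul',
    natCast_zsmul]

theorem eigenIdem_unip_mul_rising (H : ToralPair p h z) (r m : ZMod p) (ℓ : ℕ) :
    eigenIdem h (r + m) * unip z r * rising (h - scal B (m + ℓ)) 1 ℓ =
      scal B (falling r ℓ) * (eigenIdem h (r + m) * unip z (r - (ℓ : ZMod p))) := by
  induction ℓ generalizing r m with
  | zero => simp [rising, falling]
  | succ ℓ ih =>
    have e1 : h - scal B (m + ((ℓ + 1 : ℕ) : ZMod p)) + (1 : ℕ) + ℓ = h - scal B m := by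
      simp only [map_add, map_natCast]; push_cast; abel
    have e2 : m + ((ℓ + 1 : ℕ) : ZMod p) = (m + 1) + ℓ := by push_cast; ring
    have e3 : Commute (h - scal B m) (h - scal B (m + 1 + ℓ)) :=
      ((Commute.refl h).sub_right (scal_commute _ h).symm).sub_left
        ((scal_commute m h).sub_right (scal_commute m _))
    have e4 : r + m = (r - 1) + (m + 1) := by ring
    have e5 : r - 1 - ℓ = r - ((ℓ + 1 : ℕ) : ZMod p) := by push_cast; ring
    rw [rising, e1, e2, ← (rising_commute e3 1 ℓ).eq, ← mul_assoc, H.eigenIdem_unip_mul_h, mul_assoc,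
      e4, ih, ← mul_assoc, ← map_mul, e5, falling]

/-- The twisted antipode of a primitive element. -/
theorem mul_V_eq (H : ToralPair p h z) {y : B} {W : ℕ → B} {m : ZMod p}
    (hy : h * y = y * (h + scal B m))
    (hW : ∀ ℓ < p, ((LinearMap.mulRight R z - LinearMap.mulLeft R z) ^ ℓ) y = (ℓ ! : B) * W ℓ)
    (hWm : ∀ ℓ < p, h * W ℓ = W ℓ * (h + scal B (m + ℓ))) :
    y * ToralPair.V p h z = ToralPair.V p h z *
      (unip z (-m) * ∑ ℓ ∈ Finset.range p, W ℓ * rising h 1 ℓ) := by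
  refine ext_eigenIdem (h := h) (p := p) fun s => ?_
  rw [← mul_assoc, eigenIdem_mul_weight hy, mul_assoc, H.eigenIdem_mul_V, ← mul_assoc,
    ← eigenIdem_mul_weight hy, mul_assoc, mul_unip H hW, ← mul_assoc, H.eigenIdem_mul_V,
    mul_assoc (eigenIdem h s), ← mul_assoc (unip z s), ← unip_add H.nil, ← sub_eq_add_neg,
    ← mul_assoc, Finset.mul_sum, Finset.mul_sum]
  refine Finset.sum_congr rfl fun ℓ hℓ => ?_
  have h1 : SemiconjBy (W ℓ) h (h - scal B (m + ℓ)) := by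
    change W ℓ * h = (h - scal B (m + ℓ)) * W ℓ
    rw [sub_mul, hWm ℓ (by simpa using hℓ), mul_add, ← (scal_commute _ (W ℓ)).eq]; noncomm_ring
  have h2 := eigenIdem_unip_mul_rising H (s - m) m ℓ
  rw [sub_add_cancel] at h2
  rw [(semiconjBy_rising h1 1 ℓ).eq, ← mul_assoc _ (rising _ _ _), h2, ← mul_assoc,
    ← (scal_commute _ _).eq]
  simp only [mul_assoc]

end

/-! ### The standard basis of `O(n;1)` -/

/-- The multi-indices `0 ≤ α ≤ τ`. -/
abbrev Idx (n p : ℕ) : Type := {α : Fin n →₀ ℕ // ∀ m, α m < p}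

/-- Multi-indices as functions into `Fin p`. -/
def idxEquiv (n p : ℕ) : Idx n p ≃ (Fin n → Fin p) where
  toFun α m := ⟨α.1 m, α.2 m⟩
  invFun f := ⟨Finsupp.equivFunOnFinite.symm fun m => (f m : ℕ), fun m => (f m).2⟩
  left_inv α := by ext; rfl
  right_inv f := rfl

instance (n p : ℕ) : Fintype (Idx n p) := Fintype.ofEquiv _ (idxEquiv n p).symm

theorem card_idx (n p : ℕ) : Fintype.card (Idx n p) = p ^ n := by
  rw [Fintype.card_congr (idxEquiv n p)]; simp

section

variable {K : Type*} [Field K] {n p : ℕ} [Fact p.Prime] [CharP K p]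

variable (K) in
theorem factorial_cast_ne_zero {m : ℕ} (hm : m < p) : (m ! : K) ≠ 0 := by
  intro h0
  rw [CharP.cast_eq_zero_iff K p, (Fact.out : p.Prime).dvd_factorial] at h0
  omega

variable (K) in
theorem prod_factorial_ne_zero {α : Fin n →₀ ℕ} (hα : ∀ m, α m < p) :
    (∏ i, ((α i)! : K)) ≠ 0 :=
  Finset.prod_ne_zero_iff.2 fun i _ => factorial_cast_ne_zero K (hα i)

theorem mkO_monomial_mem_span (α : Fin n →₀ ℕ) (c : K) :
    mkO K n p (MvPolynomial.monomial α c) ∈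
      Submodule.span K (Set.range fun α : Idx n p => divPow K n p α.1) := by
  by_cases hα : ∀ m, α m < p
  · have : mkO K n p (MvPolynomial.monomial α c) =
        (c * ∏ i, ((α i)! : K)) • divPow K n p α := by
      rw [divPow, ← map_smul, MvPolynomial.smul_monomial, smul_eq_mul, mul_assoc,
        mul_inv_cancel₀ (prod_factorial_ne_zero K hα), mul_one]
    rw [this]
    exact Submodule.smul_mem _ _ (Submodule.subset_span ⟨⟨α, hα⟩, rfl⟩)
  · push Not at hα
    obtain ⟨i, hi⟩ := hα
    have : mkO K n p (MvPolynomial.monomial α c) = 0 := by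
      rw [mkO_eq_zero_iff]
      refine Ideal.mem_of_dvd _ ?_ (Ideal.subset_span ⟨i, rfl⟩)
      change MvPolynomial.X i ^ p ∣ _
      rw [MvPolynomial.X_pow_eq_monomial, MvPolynomial.monomial_dvd_monomial]
      exact ⟨Or.inr (Finsupp.single_le_iff.2 hi), one_dvd _⟩
    rw [this]; exact zero_mem _

variable (K n p) in
theorem span_divPow :
    ⊤ ≤ Submodule.span K (Set.range fun α : Idx n p => divPow K n p α.1) := by
  rintro f -
  obtain ⟨f, rfl⟩ := mkO_surjective K n p f
  induction f using MvPolynomial.induction_on' with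
  | monomial α c => exact mkO_monomial_mem_span α c
  | add f g hf hg => rw [map_add]; exact add_mem hf hg

variable (K n p) in
theorem linearIndependent_divPow :
    LinearIndependent K fun α : Idx n p => divPow K n p α.1 := by
  classical
  rw [Fintype.linearIndependent_iff]
  intro g hg α
  set P : MvPolynomial (Fin n) K :=
    ∑ α : Idx n p, g α • MvPolynomial.monomial α.1 (∏ i, ((α.1 i)! : K))⁻¹ with hP
  have h1 : P ∈ truncIdeal K n p := by
    rw [← mkO_eq_zero_iff, hP, map_sum, ← hg]
    simp only [map_smul]
    rfl
  have h2 : P.coeff α.1 = g α * (∏ i, ((α.1 i)! : K))⁻¹ := by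
    rw [hP, MvPolynomial.coeff_sum, Finset.sum_eq_single α]
    · simp
    · intro β _ hβ
      have : β.1 ≠ α.1 := fun h => hβ (Subtype.ext h)
      simp [this]
    · simp
  have h3 : P.coeff α.1 = 0 := by
    by_contra hne
    have h4 : truncIdeal K n p = Ideal.span ((fun s : Fin n →₀ ℕ =>
        (MvPolynomial.monomial s (1 : K))) '' Set.range fun i : Fin n => Finsupp.single i p) := by
      rw [truncIdeal, ← Set.range_comp]
      congr 1
      ext1
      simp [MvPolynomial.X_pow_eq_monomial, Function.comp_def]
    rw [h4, MvPolynomial.mem_ideal_span_monomial_image] at h1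
    obtain ⟨_, ⟨i, rfl⟩, hi⟩ := h1 α.1 (MvPolynomial.mem_support_iff.2 hne)
    have := Finsupp.single_le_iff.1 hi
    exact absurd (α.2 i) (by omega)
  rw [h2] at h3
  exact (mul_eq_zero.1 h3).resolve_right (inv_ne_zero (prod_factorial_ne_zero K α.2))

variable (K n p) in
/-- The basis of divided powers of `O(n;1)`. -/
def basisO : Module.Basis (Idx n p) K (O K n p) :=
  Module.Basis.mk (linearIndependent_divPow K n p) (span_divPow K n p)

theorem basisO_apply (α : Idx n p) : basisO K n p α = divPow K n p α.1 := by simp [basisO]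

instance : Module.Finite K (O K n p) := Module.Finite.of_basis (basisO K n p)

/-- The coefficient of `x^(α)`. -/
def dcoef (α : Idx n p) : O K n p →ₗ[K] K := (basisO K n p).coord α

theorem dcoef_divPow (α β : Idx n p) :
    dcoef α (divPow K n p β.1) = if β = α then 1 else 0 := by
  rw [dcoef, ← basisO_apply, Module.Basis.coord_apply, Module.Basis.repr_self,
    Finsupp.single_apply]

theorem divPow_ne_zero (α : Idx n p) : divPow K n p α.1 ≠ 0 := by
  intro h
  have := dcoef_divPow (K := K) α α
  simp [h] at this

theorem D_divPow {i : Fin n} {α : Fin n →₀ ℕ} (hi : α i < p) :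
    D K n p i (divPow K n p α) = if α i = 0 then 0 else divPow K n p (α - ε i) := by
  rw [divPow, D_mk, MvPolynomial.pderiv_monomial]
  split_ifs with h0
  · simp [h0]
  · have hpos : 0 < α i := Nat.pos_of_ne_zero h0
    have hne : ((α i : ℕ) : K) ≠ 0 := by
      rw [Ne, CharP.cast_eq_zero_iff K p]
      exact fun h => absurd (Nat.le_of_dvd hpos h) (by omega)
    rw [divPow]
    congr 2
    rw [← Finset.mul_prod_erase _ _ (Finset.mem_univ i),
      ← Finset.mul_prod_erase (a := i) _ (fun j => (((α - ε i) j)! : K)) (Finset.mem_univ i)]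
    have h1 : ∏ j ∈ Finset.univ.erase i, (((α - ε i) j)! : K) =
        ∏ j ∈ Finset.univ.erase i, ((α j)! : K) := by
      refine Finset.prod_congr rfl fun j hj => ?_
      have : i ≠ j := (Finset.ne_of_mem_erase hj).symm
      simp [this]
    have h2 : ((α i)! : K) = (α i : K) * ((α - ε i) i)! := by
      rw [← Nat.cast_mul, Finsupp.tsub_apply, Finsupp.single_eq_same,
        Nat.mul_factorial_pred hpos.ne']
    rw [h1, h2, mul_inv, mul_inv, mul_inv]
    rw [mul_comm, ← mul_assoc, ← mul_assoc, mul_inv_cancel₀ hne, one_mul]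

theorem D_divPow_add {i : Fin n} {α : Fin n →₀ ℕ} (hi : α i + 1 < p) :
    D K n p i (divPow K n p (α + ε i)) = divPow K n p α := by
  rw [D_divPow (by simpa using hi), if_neg (by simp), add_tsub_cancel_right]

theorem D_divPow_eq_zero {i : Fin n} {α : Fin n →₀ ℕ} (hi : α i = 0) :
    D K n p i (divPow K n p α) = 0 := by
  rw [D_divPow (hi ▸ (Fact.out : p.Prime).pos), if_pos hi]

theorem dcoef_D_eq_zero {i : Fin n} {α : Idx n p} (hα : α.1 i + 1 = p) (f : O K n p) :
    dcoef α (D K n p i f) = 0 := by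
  have : (dcoef α) ∘ₗ (D K n p i).toLinearMap = 0 := by
    refine (basisO K n p).ext fun β => ?_
    simp only [LinearMap.comp_apply, basisO_apply, Derivation.coeFn_coe, LinearMap.zero_apply]
    rw [D_divPow (β.2 i)]
    split_ifs with h0
    · simp
    · have hβ : ∀ m, (β.1 - ε i) m < p := fun m => lt_of_le_of_lt (Nat.sub_le _ _) (β.2 m)
      have := dcoef_divPow (K := K) α ⟨β.1 - ε i, hβ⟩
      rw [this, if_neg]
      rintro rfl
      have h1 := β.2 i
      simp at hα
      omega
  exact LinearMap.congr_fun this f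

/-! ### The space `W(n;1)` and the dimension of `S(n;1)` -/

theorem W_eq_sum (E : W K n p) : E = ∑ j, E (x j) • D K n p j := by
  refine W_ext fun i => ?_
  rw [W_sum_apply]
  simp [D_x]

variable (K n p) in
/-- `W(n;1)` is free over `O(n;1)` on the partial derivatives. -/
def eW : W K n p ≃ₗ[K] (Fin n → O K n p) where
  toFun E j := E (x j)
  invFun a := ∑ j, a j • D K n p j
  map_add' _ _ := rfl
  map_smul' _ _ := rfl
  left_inv E := (W_eq_sum E).symm
  right_inv a := by
    ext1 i
    change (∑ j, a j • D K n p j) (x i) = a i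
    rw [W_sum_apply]
    simp [D_x]

variable (K n p) in
theorem finrank_W : Module.finrank K (W K n p) = n * p ^ n := by
  rw [(eW K n p).finrank_eq, Module.finrank_pi_fintype]
  simp [Module.finrank_eq_card_basis (basisO K n p), card_idx]

instance : Module.Finite K (W K n p) := Module.Finite.equiv (eW K n p).symm

theorem W_linearMap_ext {X : Type*} [AddCommGroup X] [Module K X] {f g : W K n p →ₗ[K] X}
    (h : ∀ (j : Fin n) (β : Idx n p),
      f (divPow K n p β.1 • D K n p j) = g (divPow K n p β.1 • D K n p j)) : f = g := by
  have h1 : ∀ j : Fin n, ∀ a : O K n p, f (a • D K n p j) = g (a • D K n p j) := by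
    intro j a
    let L : O K n p →ₗ[K] W K n p :=
      { toFun := fun a => a • D K n p j
        map_add' := fun a b => add_smul a b _
        map_smul' := fun c a => smul_assoc c a _ }
    have : f ∘ₗ L = g ∘ₗ L := (basisO K n p).ext fun β => by
      rw [basisO_apply]; exact h j β
    exact LinearMap.congr_fun this a
  ext1 E
  rw [W_eq_sum E, map_sum, map_sum]
  exact Finset.sum_congr rfl fun j _ => h1 j _

variable (n p) in
/-- The multi-index `τ`. -/
def topIdx : Idx n p :=
  ⟨Finsupp.equivFunOnFinite.symm fun _ => p - 1,
    fun _ => Nat.sub_lt (Fact.out : p.Prime).pos one_pos⟩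

/-- The multi-index `τ - (p - 1) ε_j`. -/
def badIdx (j : Fin n) : Idx n p :=
  ⟨(topIdx n p).1.erase j, fun m => by
    rw [Finsupp.erase_apply]
    split_ifs
    · exact (Fact.out : p.Prime).pos
    · exact (topIdx n p).2 m⟩

theorem topIdx_apply (m : Fin n) : (topIdx n p).1 m = p - 1 := rfl

theorem badIdx_same (j : Fin n) : (badIdx (p := p) j).1 j = 0 := Finsupp.erase_same

theorem badIdx_ne {j m : Fin n} (h : m ≠ j) : (badIdx (p := p) j).1 m = p - 1 :=
  Finsupp.erase_ne h

variable (K n p) in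
/-- The linear conditions that cut `S(n;1)` out of `W(n;1)`. -/
def obstruction : W K n p →ₗ[K] ({γ : Idx n p // γ ≠ topIdx n p} → K) × (Fin n → K) :=
  LinearMap.prod
    (LinearMap.pi fun γ => dcoef γ.1 ∘ₗ Div K n p)
    (LinearMap.pi fun i => dcoef (badIdx i) ∘ₗ LinearMap.proj i ∘ₗ (eW K n p).toLinearMap)

theorem obstruction_fst (E : W K n p) (γ : {γ : Idx n p // γ ≠ topIdx n p}) :
    (obstruction K n p E).1 γ = dcoef γ.1 (Div K n p E) := rfl

theorem obstruction_snd (E : W K n p) (i : Fin n) :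
    (obstruction K n p E).2 i = dcoef (badIdx i) (E (x i)) := rfl

theorem exists_lt_of_ne_top (γ : {γ : Idx n p // γ ≠ topIdx n p}) : ∃ j, γ.1.1 j + 1 < p := by
  by_contra h
  push Not at h
  refine γ.2 (Subtype.ext (Finsupp.ext fun m => ?_))
  rw [topIdx_apply]
  have := h m; have := γ.1.2 m
  omega

/-- A direction in which `γ` can be raised. -/
def raiseDir (γ : {γ : Idx n p // γ ≠ topIdx n p}) : Fin n := (exists_lt_of_ne_top γ).choose

theorem raiseDir_spec (γ : {γ : Idx n p // γ ≠ topIdx n p}) : γ.1.1 (raiseDir γ) + 1 < p :=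
  (exists_lt_of_ne_top γ).choose_spec

theorem raise_lt {γ : Fin n →₀ ℕ} (hγ : ∀ m, γ m < p) {j : Fin n} (hj : γ j + 1 < p) (m : Fin n) :
    (γ + ε j) m < p := by
  rw [Finsupp.add_apply, Finsupp.single_apply]
  split_ifs with h
  · exact h ▸ hj
  · exact hγ m

variable (K n p) in
/-- A section of `obstruction`. -/
def obstructionSection :
    ({γ : Idx n p // γ ≠ topIdx n p} → K) × (Fin n → K) →ₗ[K] W K n p :=
  LinearMap.coprod
    (Fintype.linearCombination K fun γ : {γ : Idx n p // γ ≠ topIdx n p} =>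
      divPow K n p (γ.1.1 + ε (raiseDir γ)) • D K n p (raiseDir γ))
    (Fintype.linearCombination K fun j : Fin n => divPow K n p (badIdx (p := p) j).1 • D K n p j)

theorem obstruction_raise (γ : {γ : Idx n p // γ ≠ topIdx n p}) {j : Fin n}
    (hj : γ.1.1 j + 1 < p) :
    obstruction K n p (divPow K n p (γ.1.1 + ε j) • D K n p j) = (Pi.single γ 1, 0) := by
  refine Prod.ext ?_ ?_
  · ext1 γ'
    rw [obstruction_fst, Div_smul_D, D_divPow_add hj, dcoef_divPow]
    change _ = (Pi.single γ (1 : K) : _ → K) γ'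
    rw [Pi.single_apply]
    simp only [Subtype.ext_iff, eq_comm]
  · ext1 i
    rw [obstruction_snd, Derivation.smul_apply, D_x]
    split_ifs with h
    · subst h
      have := dcoef_divPow (K := K) (badIdx j) ⟨_, raise_lt γ.1.2 hj⟩
      rw [smul_eq_mul, mul_one, this, if_neg]
      · rfl
      · intro h
        have := congrArg (fun a : Idx n p => a.1 j) h
        simp [badIdx_same] at this
    · simp

theorem obstruction_bad (j : Fin n) :
    obstruction K n p (divPow K n p (badIdx (p := p) j).1 • D K n p j) = (0, Pi.single j 1) := by
  refine Prod.ext ?_ ?_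
  · ext1 γ'
    rw [obstruction_fst, Div_smul_D, D_divPow_eq_zero (badIdx_same j)]
    simp
  · ext1 i
    rw [obstruction_snd, Derivation.smul_apply, D_x]
    change _ = (Pi.single j (1 : K) : _ → K) i
    rw [Pi.single_apply]
    by_cases h : i = j
    · subst h
      rw [if_pos rfl, if_pos rfl, smul_eq_mul, mul_one, dcoef_divPow, if_pos rfl]
    · rw [if_neg h, if_neg (Ne.symm h), smul_zero, map_zero]

theorem obstructionSection_inl (γ : {γ : Idx n p // γ ≠ topIdx n p}) :
    obstructionSection K n p (Pi.single γ 1, 0) =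
      divPow K n p (γ.1.1 + ε (raiseDir γ)) • D K n p (raiseDir γ) := by
  rw [obstructionSection, LinearMap.coprod_apply, map_zero, add_zero,
    Fintype.linearCombination_apply_single, one_smul]

theorem obstructionSection_inr (j : Fin n) :
    obstructionSection K n p (0, Pi.single j 1) =
      divPow K n p (badIdx (p := p) j).1 • D K n p j := by
  rw [obstructionSection, LinearMap.coprod_apply, map_zero, zero_add,
    Fintype.linearCombination_apply_single, one_smul]

theorem obstruction_comp_section :
    obstruction K n p ∘ₗ obstructionSection K n p = LinearMap.id := by
  refine LinearMap.prod_ext ?_ ?_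
  · refine LinearMap.pi_ext' fun γ => LinearMap.ext_ring ?_
    change obstruction K n p (obstructionSection K n p (Pi.single γ 1, 0)) = (Pi.single γ 1, 0)
    rw [obstructionSection_inl, obstruction_raise γ (raiseDir_spec γ)]
  · refine LinearMap.pi_ext' fun j => LinearMap.ext_ring ?_
    change obstruction K n p (obstructionSection K n p (0, Pi.single j 1)) = (0, Pi.single j 1)
    rw [obstructionSection_inr, obstruction_bad]

variable (K n p) in
/-- The span of the elements `D_ij(x^(α))`, `j < i`, `α ≤ τ`. -/
def spanDij : Submodule K (W K n p) :=
  Submodule.span K {E | ∃ i j : Fin n, j < i ∧ ∃ α : Idx n p, E = DijW i j (divPow K n p α.1)}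

theorem DijW_swap (i j : Fin n) (f : O K n p) : DijW i j f = -DijW j i f := by
  change D K n p j f • D K n p i - D K n p i f • D K n p j =
    -(D K n p i f • D K n p j - D K n p j f • D K n p i)
  abel

theorem DijW_mem_spanDij {i j : Fin n} (hij : i ≠ j) (α : Idx n p) :
    DijW i j (divPow K n p α.1) ∈ spanDij K n p := by
  rcases lt_or_gt_of_ne hij with h | h
  · rw [DijW_swap]
    exact neg_mem (Submodule.subset_span ⟨j, i, h, α, rfl⟩)
  · exact Submodule.subset_span ⟨i, j, h, α, rfl⟩

theorem section_obstruction_sub_mem (E : W K n p) :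
    E - obstructionSection K n p (obstruction K n p E) ∈ spanDij K n p := by
  rw [← Submodule.Quotient.mk_eq_zero]
  have key : (spanDij K n p).mkQ ∘ₗ
      (LinearMap.id - obstructionSection K n p ∘ₗ obstruction K n p) = 0 := by
    refine W_linearMap_ext fun j β => ?_
    simp only [LinearMap.comp_apply, LinearMap.sub_apply, LinearMap.id_apply, LinearMap.zero_apply,
      Submodule.mkQ_apply, Submodule.Quotient.mk_eq_zero]
    by_cases hβ : β.1 j = 0
    · by_cases hbad : β = badIdx j
      · rw [hbad, obstruction_bad, obstructionSection_inr, sub_self]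
        exact zero_mem _
      · obtain ⟨i, hij, hi⟩ : ∃ i, i ≠ j ∧ β.1 i + 1 < p := by
          by_contra h
          push Not at h
          refine hbad (Subtype.ext (Finsupp.ext fun m => ?_))
          by_cases hm : m = j
          · rw [hm, hβ, badIdx_same]
          · rw [badIdx_ne hm]
            have := h m hm; have := β.2 m
            omega
        have e : divPow K n p β.1 • D K n p j = DijW j i (divPow K n p (β.1 + ε i)) := by
          change _ = D K n p i _ • D K n p j - D K n p j _ • D K n p i
          rw [D_divPow_add hi, D_divPow_eq_zero (by simp [hβ, hij]), zero_smul, sub_zero]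
        have h0 : obstruction K n p (divPow K n p β.1 • D K n p j) = 0 := by
          refine Prod.ext ?_ ?_
          · ext1 γ'
            rw [obstruction_fst, Div_smul_D, D_divPow_eq_zero hβ]
            simp
          · ext1 l
            rw [obstruction_snd, Derivation.smul_apply, D_x]
            split_ifs with h
            · subst h
              rw [smul_eq_mul, mul_one, dcoef_divPow, if_neg hbad]; rfl
            · simp
        rw [h0, map_zero, sub_zero, e]
        exact DijW_mem_spanDij hij.symm ⟨_, raise_lt β.2 hi⟩
    · have hβ' : ∀ m, (β.1 - ε j) m < p := fun m => lt_of_le_of_lt (Nat.sub_le _ _) (β.2 m)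
      have hj : (β.1 - ε j) j + 1 < p := by
        have := β.2 j
        simp; omega
      have hback : β.1 - ε j + ε j = β.1 :=
        tsub_add_cancel_of_le (Finsupp.single_le_iff.2 (Nat.one_le_iff_ne_zero.2 hβ))
      let γ : {γ : Idx n p // γ ≠ topIdx n p} := ⟨⟨β.1 - ε j, hβ'⟩, fun h => by
        have := congrArg (fun a : Idx n p => a.1 j) h
        simp only [topIdx_apply] at this
        omega⟩
      have e : divPow K n p β.1 • D K n p j = divPow K n p (γ.1.1 + ε j) • D K n p j := by
        rw [hback]
      have hγj : γ.1.1 j + 1 < p := hj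
      rw [e, obstruction_raise γ hj, obstructionSection_inl]
      by_cases hjj : raiseDir γ = j
      · rw [hjj, sub_self]; exact zero_mem _
      · have hj' := raiseDir_spec γ
        generalize raiseDir γ = i at hj' hjj
        have hlt : ∀ m, (γ.1.1 + ε j + ε i) m < p :=
          raise_lt (raise_lt γ.1.2 hj) (by simpa [Ne.symm hjj] using hj')
        have e2 : divPow K n p (γ.1.1 + ε j) • D K n p j - divPow K n p (γ.1.1 + ε i) • D K n p i =
            DijW j i (divPow K n p (γ.1.1 + ε j + ε i)) := by
          change _ = D K n p i _ • D K n p j - D K n p j _ • D K n p i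
          rw [D_divPow_add (by simpa [Ne.symm hjj] using hj'), add_right_comm,
            D_divPow_add (by simpa [hjj] using hγj)]
        rw [e2]
        exact DijW_mem_spanDij (Ne.symm hjj) ⟨_, hlt⟩
  exact LinearMap.congr_fun key E

variable (K n p) in
/-- The inclusion of `S(n;1)` in `W(n;1)`. -/
def inclS : S K n p →ₗ[K] W K n p :=
  (S' K n p).toSubmodule.subtype ∘ₗ (S K n p).toSubmodule.subtype

theorem inclS_injective : Function.Injective (inclS K n p) :=
  Subtype.val_injective.comp Subtype.val_injective

theorem inclS_lie (y w : S K n p) : inclS K n p ⁅y, w⁆ = ⁅inclS K n p y, inclS K n p w⁆ := rfl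

theorem obstruction_lie {E F : W K n p} (hE : Div K n p E = 0) (hF : Div K n p F = 0) :
    obstruction K n p ⁅E, F⁆ = 0 := by
  refine Prod.ext ?_ ?_
  · ext1 γ
    rw [obstruction_fst, Div_lie, hE, hF]
    simp
  · ext1 j
    have e : ∀ E F : W K n p, Div K n p E = 0 →
        ∑ i, D K n p i (E (x i) * F (x j)) = E (F (x j)) := by
      intro E F hE
      have hE' : ∑ i, D K n p i (E (x i)) = 0 := hE
      conv_rhs => rw [W_eq_sum E, W_sum_apply]
      simp only [Derivation.leibniz, smul_eq_mul, Finset.sum_add_distrib, ← Finset.mul_sum, hE',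
        mul_zero, add_zero, Derivation.smul_apply]
    rw [obstruction_snd, Derivation.commutator_apply, ← e E F hE, ← e F E hF,
      ← Finset.sum_sub_distrib, map_sum]
    refine Finset.sum_eq_zero fun i _ => ?_
    rw [← map_sub]
    by_cases hij : i = j
    · subst hij
      rw [mul_comm, sub_self, map_zero, map_zero]
    · refine dcoef_D_eq_zero ?_ _
      rw [badIdx_ne hij]
      exact Nat.sub_add_cancel (Fact.out : p.Prime).one_le

theorem obstruction_inclS (y : S K n p) : obstruction K n p (inclS K n p y) = 0 := by
  have hy : (y : S' K n p) ∈ (⁅(⊤ : LieIdeal K (S' K n p)), (⊤ : LieIdeal K (S' K n p))⁆ :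
      LieIdeal K (S' K n p)).toSubmodule := y.2
  rw [LieSubmodule.lieIdeal_oper_eq_linear_span'] at hy
  have key : ∀ w ∈ Submodule.span K {⁅v, w⁆ | (v ∈ (⊤ : LieIdeal K (S' K n p)))
      (w ∈ (⊤ : LieIdeal K (S' K n p)))}, obstruction K n p (w : S' K n p).1 = 0 := by
    intro w hw
    induction hw using Submodule.span_induction with
    | mem w hw =>
      obtain ⟨v, -, w, -, rfl⟩ := hw
      exact obstruction_lie v.2 w.2
    | zero => exact map_zero _
    | add v w _ _ hv hw => exact (map_add (obstruction K n p) v.1 w.1).trans (by rw [hv, hw, add_zero])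
    | smul c v _ hv =>
      exact (map_smul (obstruction K n p) c v.1).trans (by rw [hv, smul_zero])
  exact key _ hy

theorem ker_obstruction : LinearMap.ker (obstruction K n p) = LinearMap.range (inclS K n p) := by
  apply le_antisymm
  · intro E hE
    have h1 := section_obstruction_sub_mem E
    rw [LinearMap.mem_ker.1 hE, map_zero, sub_zero] at h1
    refine (Submodule.span_le.2 ?_ : spanDij K n p ≤ _) h1
    rintro _ ⟨i, j, -, α, rfl⟩
    exact ⟨Dij i j _, rfl⟩
  · rintro _ ⟨y, rfl⟩
    exact obstruction_inclS y

instance : Module.Finite K (S K n p) :=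
  Module.Finite.of_injective (inclS K n p) inclS_injective

variable (K n p) in
theorem finrank_S (hn : 1 ≤ n) : Module.finrank K (S K n p) = (n - 1) * (p ^ n - 1) := by
  have h1 := LinearMap.finrank_range_add_finrank_ker (obstruction K n p)
  have hsurj : Function.Surjective (obstruction K n p) := fun v =>
    ⟨obstructionSection K n p v, LinearMap.congr_fun obstruction_comp_section v⟩
  rw [ker_obstruction, LinearMap.finrank_range_of_inj inclS_injective,
    LinearMap.range_eq_top.2 hsurj, finrank_top, finrank_W, Module.finrank_prod,
    Module.finrank_pi, Module.finrank_pi, Fintype.card_subtype_compl, card_idx,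
    Fintype.card_subtype_eq, Fintype.card_fin] at h1
  have hp : 1 ≤ p ^ n := Nat.one_le_pow _ _ (Fact.out : p.Prime).pos
  obtain ⟨m, rfl⟩ := Nat.exists_eq_add_of_le hn
  obtain ⟨r, hr⟩ := Nat.exists_eq_add_of_le hp
  rw [hr] at h1 ⊢
  simp only [Nat.add_sub_cancel_left] at h1 ⊢
  nlinarith

variable (K n p) in
theorem span_DS : Submodule.span K
    {y : S K n p | ∃ i j : Fin n, j < i ∧ ∃ α : Idx n p, y = DS i j α.1} = ⊤ := by
  rw [eq_top_iff]
  rintro y -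
  have h1 : inclS K n p y ∈ spanDij K n p := by
    have := section_obstruction_sub_mem (inclS K n p y)
    rwa [obstruction_inclS, map_zero, sub_zero] at this
  have h2 : spanDij K n p = (Submodule.span K
      {y : S K n p | ∃ i j : Fin n, j < i ∧ ∃ α : Idx n p, y = DS i j α.1}).map (inclS K n p) := by
    rw [Submodule.map_span, spanDij]
    congr 1
    ext E
    constructor
    · rintro ⟨i, j, hij, α, rfl⟩
      exact ⟨DS i j α.1, ⟨i, j, hij, α, rfl⟩, rfl⟩
    · rintro ⟨_, ⟨i, j, hij, α, rfl⟩, rfl⟩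
      exact ⟨i, j, hij, α, rfl⟩
  rw [h2] at h1
  obtain ⟨w, hw, hwy⟩ := h1
  exact inclS_injective hwy ▸ hw

end

section

variable {K : Type*} [Field K] {n p : ℕ} [Fact p.Prime] [CharP K p]

/-! ### `p`-th powers of the derivations `D_ij(x^(α))` -/

theorem O_linearMap_ext {X : Type*} [AddCommGroup X] [Module K X] {f g : O K n p →ₗ[K] X}
    (h : ∀ r : Fin n →₀ ℕ, f (mkO K n p (MvPolynomial.monomial r 1)) =
      g (mkO K n p (MvPolynomial.monomial r 1))) : f = g := by
  refine (basisO K n p).ext fun α => ?_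
  have : divPow K n p α.1 =
      (∏ i, ((α.1 i)! : K))⁻¹ • mkO K n p (MvPolynomial.monomial α.1 1) := by
    rw [divPow, ← map_smul, MvPolynomial.smul_monomial, smul_eq_mul, mul_one]
  rw [basisO_apply, this, map_smul, map_smul, h]

theorem mkO_monomial_eq_zero {r : Fin n →₀ ℕ} {i : Fin n} (hi : p ≤ r i) (c : K) :
    mkO K n p (MvPolynomial.monomial r c) = 0 := by
  rw [mkO_eq_zero_iff]
  refine Ideal.mem_of_dvd _ ?_ (Ideal.subset_span ⟨i, rfl⟩)
  change MvPolynomial.X i ^ p ∣ _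
  rw [MvPolynomial.X_pow_eq_monomial, MvPolynomial.monomial_dvd_monomial]
  exact ⟨Or.inr (Finsupp.single_le_iff.2 hi), one_dvd _⟩

variable (K p) in
theorem D_pow_prime (i : Fin n) : ((D K n p i : O K n p →ₗ[K] O K n p)) ^ p = 0 := by
  have h : ∀ s : ℕ, ∀ α : Fin n →₀ ℕ, α i < p → α i < s →
      ((D K n p i : O K n p →ₗ[K] O K n p) ^ s) (divPow K n p α) = 0 := by
    intro s
    induction s with
    | zero => intro α _ h; omega
    | succ s ih =>
      intro α hα hs
      rw [pow_succ, Module.End.mul_apply, Derivation.coeFn_coe, D_divPow hα]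
      split_ifs with h0
      · exact map_zero _
      · refine ih _ ?_ ?_ <;> rw [Finsupp.tsub_apply, Finsupp.single_eq_same] <;> omega
  refine (basisO K n p).ext fun α => ?_
  rw [basisO_apply, h p α.1 (α.2 i) (α.2 i)]
  rfl

theorem smul_D_pow_prime {f : O K n p} {i : Fin n} (hf : D K n p i f = 0) :
    ((f • D K n p i : W K n p) : O K n p →ₗ[K] O K n p) ^ p = 0 := by
  have h1 : ((f • D K n p i : W K n p) : O K n p →ₗ[K] O K n p) =
      LinearMap.mulLeft K f * (D K n p i : O K n p →ₗ[K] O K n p) := rfl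
  have h2 : Commute (LinearMap.mulLeft K f) (D K n p i : O K n p →ₗ[K] O K n p) := by
    refine LinearMap.ext fun g => ?_
    simp [hf]
  rw [h1, h2.mul_pow, D_pow_prime, mul_zero]

theorem DijW_monomial {i j : Fin n} (l r : Fin n →₀ ℕ) (c : K) :
    DijW i j (mkO K n p (MvPolynomial.monomial (l + ε i + ε j) c))
      (mkO K n p (MvPolynomial.monomial r 1)) =
    (c * (((l + ε i + ε j) j : K) * r i - ((l + ε i + ε j) i : K) * r j)) •
      mkO K n p (MvPolynomial.monomial (r + l) 1) := by
  have key : ∀ (i j : Fin n), D K n p j (mkO K n p (MvPolynomial.monomial (l + ε i + ε j) c)) *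
      D K n p i (mkO K n p (MvPolynomial.monomial r 1)) =
      (c * (((l + ε i + ε j) j : K) * r i)) • mkO K n p (MvPolynomial.monomial (r + l) 1) := by
    intro i j
    rw [D_mk, D_mk, MvPolynomial.pderiv_monomial, MvPolynomial.pderiv_monomial, ← map_mul,
      MvPolynomial.monomial_mul, ← map_smul, MvPolynomial.smul_monomial]
    by_cases hr : r i = 0
    · simp [hr]
    · have h1 : l + ε i + ε j - ε j + (r - ε i) = r + l := by
        rw [add_tsub_cancel_right, add_assoc, add_tsub_cancel_of_le
          (Finsupp.single_le_iff.2 (Nat.one_le_iff_ne_zero.2 hr)), add_comm]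
      rw [h1, smul_eq_mul]
      congr 2
      ring
  change D K n p j _ * D K n p i _ - D K n p i _ * D K n p j _ = _
  rw [key, add_right_comm, key, ← sub_smul]
  congr 1
  ring

theorem DijW_toral_pow {i j : Fin n} :
    ((DijW i j (divPow K n p (ε i + ε j)) : W K n p) : O K n p →ₗ[K] O K n p) ^ p =
      (DijW i j (divPow K n p (ε i + ε j)) : W K n p) := by
  refine O_linearMap_ext fun r => ?_
  set E := DijW i j (divPow K n p (ε i + ε j)) with hE
  obtain ⟨c, hc, hcE⟩ : ∃ c : K, c ^ p = c ∧ E (mkO K n p (MvPolynomial.monomial r 1)) =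
      c • mkO K n p (MvPolynomial.monomial r 1) := by
    have h := DijW_monomial (p := p) (i := i) (j := j) 0 r (∏ l, (((ε i + ε j) l)! : K))⁻¹
    rw [zero_add, add_zero] at h
    refine ⟨_, ?_, h⟩
    have hnat : ∀ m : ℕ, (m : K) ^ p = m := fun m => by
      have := map_natCast (frobenius K p) m
      rwa [frobenius_def] at this
    rw [mul_pow, sub_pow_char, mul_pow, mul_pow, inv_pow, ← Finset.prod_pow]
    simp only [hnat]
  have h2 : ∀ s : ℕ, ((E : O K n p →ₗ[K] O K n p) ^ s) (mkO K n p (MvPolynomial.monomial r 1)) =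
      c ^ s • mkO K n p (MvPolynomial.monomial r 1) := by
    intro s
    induction s with
    | zero => simp
    | succ s ih =>
      rw [pow_succ, Module.End.mul_apply, Derivation.coeFn_coe, hcE, map_smul, ih, smul_smul,
        pow_succ']
  rw [h2, hc, Derivation.coeFn_coe, hcE]

theorem DijW_nil_pow {i j : Fin n} (hij : i ≠ j) {α : Fin n →₀ ℕ} (hα : α ≠ ε i + ε j) :
    ((DijW i j (divPow K n p α) : W K n p) : O K n p →ₗ[K] O K n p) ^ p = 0 := by
  by_cases hi : α i = 0
  · have h1 : DijW i j (divPow K n p α) = D K n p j (divPow K n p α) • D K n p i := by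
      change D K n p j _ • D K n p i - D K n p i _ • D K n p j = _
      rw [D_divPow_eq_zero hi, zero_smul, sub_zero]
    rw [h1]
    exact smul_D_pow_prime (by rw [D_comm, D_divPow_eq_zero hi, map_zero])
  by_cases hj : α j = 0
  · have h1 : DijW i j (divPow K n p α) = (-D K n p i (divPow K n p α)) • D K n p j := by
      change D K n p j _ • D K n p i - D K n p i _ • D K n p j = _
      rw [D_divPow_eq_zero hj, zero_smul, zero_sub, neg_smul]
    rw [h1]
    exact smul_D_pow_prime (by rw [map_neg, D_comm, D_divPow_eq_zero hj, map_zero, neg_zero])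
  obtain ⟨l, rfl⟩ : ∃ l, α = l + ε i + ε j := by
    refine ⟨α - (ε i + ε j), ?_⟩
    rw [add_assoc, tsub_add_cancel_of_le]
    intro m
    rw [Finsupp.add_apply, Finsupp.single_apply, Finsupp.single_apply]
    split_ifs with h1 h2 h2
    · exact absurd (h1.trans h2.symm) hij
    · subst h1; omega
    · subst h2; omega
    · omega
  have hl : l ≠ 0 := by rintro rfl; exact hα (by rw [zero_add])
  obtain ⟨m, hm⟩ := Finsupp.ne_iff.1 hl
  rw [Finsupp.zero_apply] at hm
  set E := DijW i j (divPow K n p (l + ε i + ε j)) with hE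
  have h2 : ∀ s : ℕ, ∀ r, ∃ c : K,
      ((E : O K n p →ₗ[K] O K n p) ^ s) (mkO K n p (MvPolynomial.monomial r 1)) =
      c • mkO K n p (MvPolynomial.monomial (r + s • l) 1) := by
    intro s
    induction s with
    | zero => exact fun r => ⟨1, by simp⟩
    | succ s ih =>
      intro r
      obtain ⟨c, hc⟩ := ih (r + l)
      rw [pow_succ, Module.End.mul_apply, Derivation.coeFn_coe, hE, divPow, DijW_monomial, map_smul]
      rw [hE, divPow] at hc
      rw [hc, smul_smul, add_assoc r, ← succ_nsmul']
      exact ⟨_, rfl⟩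
  refine O_linearMap_ext fun r => ?_
  obtain ⟨c, hc⟩ := h2 p r
  rw [hc, mkO_monomial_eq_zero (i := m), smul_zero, LinearMap.zero_apply]
  rw [Finsupp.add_apply, Finsupp.smul_apply, smul_eq_mul]
  have := Nat.le_mul_of_pos_right p (Nat.pos_of_ne_zero hm)
  omega

/-! ### Weights -/

theorem divPow_single (k : Fin n) : divPow K n p (ε k) = x k := by
  have : ∏ i, (((ε k) i)! : K) = 1 := by
    refine Finset.prod_eq_one fun i _ => ?_
    rw [Finsupp.single_apply]; split_ifs <;> simp
  rw [divPow, this, inv_one]; rfl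

theorem DijW_toral {k k' : Fin n} (hk : k ≠ k') :
    DijW k k' (divPow K n p (ε k + ε k')) =
      (x k : O K n p) • D K n p k - (x k' : O K n p) • D K n p k' := by
  have hp := (Fact.out : p.Prime).one_lt
  change D K n p k' (divPow K n p (ε k + ε k')) • D K n p k -
    D K n p k (divPow K n p (ε k + ε k')) • D K n p k' = _
  rw [D_divPow_add (by simpa [hk] using hp), add_comm (ε k), D_divPow_add
    (by simpa [hk.symm] using hp), divPow_single, divPow_single]

theorem x_mul_D_monomial (k : Fin n) (α : Fin n →₀ ℕ) (c : K) :
    x k * D K n p k (mkO K n p (MvPolynomial.monomial α c)) =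
      (α k : K) • mkO K n p (MvPolynomial.monomial α c) := by
  rw [D_mk, x, ← map_mul, MvPolynomial.X_mul_pderiv_monomial, map_nsmul, Nat.cast_smul_eq_nsmul]

theorem hS_apply_monomial {k k' : Fin n} (hk : k ≠ k') (α : Fin n →₀ ℕ) (c : K) :
    inclS K n p (hS K p k k') (mkO K n p (MvPolynomial.monomial α c)) =
      (((α k : ℤ) - α k' : ℤ) : K) • mkO K n p (MvPolynomial.monomial α c) := by
  change DijW k k' _ _ = _
  rw [DijW_toral hk, Derivation.sub_apply, Derivation.smul_apply, Derivation.smul_apply,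
    smul_eq_mul, smul_eq_mul, x_mul_D_monomial, x_mul_D_monomial, ← sub_smul]
  push_cast; rfl

theorem hS_apply_x {k k' : Fin n} (hk : k ≠ k') (l : Fin n) :
    inclS K n p (hS K p k k') (x l) =
      (((if l = k then 1 else 0) - (if l = k' then 1 else 0) : ℤ) : K) • x l := by
  have := hS_apply_monomial (p := p) hk (ε l) (1 : K)
  simp only [Finsupp.single_apply] at this
  push_cast at this ⊢
  exact this

theorem hS_apply_D_monomial {k k' : Fin n} (hk : k ≠ k') (i : Fin n) (α : Fin n →₀ ℕ) (c : K) :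
    inclS K n p (hS K p k k') (D K n p i (mkO K n p (MvPolynomial.monomial α c))) =
      (((α k : ℤ) - (if i = k then 1 else 0) - (α k' : ℤ) + (if i = k' then 1 else 0) : ℤ) : K) •
        D K n p i (mkO K n p (MvPolynomial.monomial α c)) := by
  rw [D_mk, MvPolynomial.pderiv_monomial]
  by_cases hi : α i = 0
  · simp [hi]
  · rw [hS_apply_monomial hk]
    congr 2
    have h1 : ∀ m : Fin n, (((α - ε i) m : ℕ) : ℤ) = (α m : ℤ) - (if i = m then 1 else 0) := by
      intro m
      rw [Finsupp.tsub_apply, Finsupp.single_apply]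
      split_ifs with h
      · subst h; omega
      · simp
    rw [h1, h1]; ring

theorem lie_hS_DS {k k' : Fin n} (hk : k ≠ k') (i j : Fin n) (α : Fin n →₀ ℕ) :
    ⁅hS K p k k', DS i j α⁆ = ((wt k k' i j α : ℤ) : K) • (DS i j α : S K n p) := by
  apply inclS_injective
  rw [inclS_lie, map_smul]
  change ⁅inclS K n p (hS K p k k'), DijW i j (divPow K n p α)⁆ = _ • DijW i j (divPow K n p α)
  refine W_ext fun l => ?_
  have e : ∀ f : O K n p, DijW i j f (x l) = (if i = l then 1 else 0 : K) • D K n p j f -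
      (if j = l then 1 else 0 : K) • D K n p i f := by
    intro f
    change D K n p j f * D K n p i (x l) - D K n p i f * D K n p j (x l) = _
    rw [D_x, D_x]
    split_ifs <;> simp
  rw [Derivation.commutator_apply, hS_apply_x hk, Derivation.map_smul, Derivation.smul_apply, e, map_sub,
    Derivation.map_smul, Derivation.map_smul, divPow, hS_apply_D_monomial hk, hS_apply_D_monomial hk]
  simp only [smul_sub, smul_smul]
  rw [sub_sub_sub_comm, ← sub_smul, ← sub_smul]
  congr 2
  · by_cases hil : i = l
    · subst hil
      simp only [wt, if_true]
      push_cast; ring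
    · simp [hil]
  · by_cases hil : j = l
    · subst hil
      simp only [wt, if_true]
      push_cast; ring
    · simp [hil]

theorem wt_e {k k' : Fin n} (hk : k ≠ k') : wt k k' k k' (2 • ε k + ε k') = 1 := by
  simp [wt, hk, hk.symm]

theorem lie_hS_eS {k k' : Fin n} (hk : k ≠ k') : ⁅hS K p k k', eS K p k k'⁆ = eS K p k k' := by
  rw [eS, lie_smul, lie_hS_DS hk, wt_e hk]; simp

theorem e_idx_lt (hp : 2 < p) {k k' : Fin n} (hk : k ≠ k') (m : Fin n) :
    (2 • ε k + ε k') m < p := by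
  simp only [Finsupp.add_apply, Finsupp.smul_apply, Finsupp.single_apply]
  split_ifs with h1 h2
  · exact absurd (h1.trans h2.symm) hk
  all_goals simp; try omega

theorem eS_ne_zero (hp : 2 < p) {k k' : Fin n} (hk : k ≠ k') : eS K p k k' ≠ 0 := by
  intro h
  have h1 : inclS K n p (eS K p k k') (x k) = (2 : K) • divPow K n p (2 • ε k) := by
    change (2 : K) • (D K n p k' _ * D K n p k (x k) - D K n p k _ * D K n p k' (x k)) = _
    rw [D_x, D_x, if_pos rfl, if_neg hk.symm, mul_one, mul_zero, sub_zero,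
      D_divPow_add (by simp [hk]; omega)]
  rw [h, map_zero] at h1
  have h2 : ∀ m, (2 • ε k) m < p := by
    intro m
    simp only [Finsupp.smul_apply, Finsupp.single_apply]
    split_ifs <;> simp <;> omega
  have h3 := divPow_ne_zero (K := K) (⟨2 • ε k, h2⟩ : Idx n p)
  have h4 : (2 : K) ≠ 0 := by
    have := factorial_cast_ne_zero K hp
    simpa using this
  exact smul_ne_zero h4 h3 h1.symm

theorem linearIndependent_hS_eS (hp : 2 < p) {k k' : Fin n} (hk : k ≠ k') :
    LinearIndependent K ![hS K p k k', eS K p k k'] := by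
  rw [LinearIndependent.pair_iff]
  intro a b h
  have he := eS_ne_zero (K := K) hp hk
  have h1 := congrArg (fun y => ⁅hS K p k k', y⁆) h
  simp only [lie_add, lie_smul, lie_self, smul_zero, zero_add, lie_hS_eS hk, lie_zero] at h1
  have hb := (smul_eq_zero.1 h1).resolve_right he
  rw [hb, zero_smul, add_zero] at h
  have h2 := congrArg (fun y => ⁅y, eS K p k k'⁆) h
  simp only [smul_lie, lie_hS_eS hk, zero_lie] at h2
  exact ⟨(smul_eq_zero.1 h2).resolve_right he, hb⟩

theorem lie_hS_ad_pow {k k' : Fin n} (hk : k ≠ k') {y : S K n p} {c : K}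
    (hy : ⁅hS K p k k', y⁆ = c • y) (ℓ : ℕ) :
    ⁅hS K p k k', (LieAlgebra.ad K (S K n p) (eS K p k k') ^ ℓ) y⁆ =
      (c + ℓ) • (LieAlgebra.ad K (S K n p) (eS K p k k') ^ ℓ) y := by
  induction ℓ with
  | zero => simpa using hy
  | succ ℓ ih =>
    rw [pow_succ', Module.End.mul_apply, LieAlgebra.ad_apply, leibniz_lie, lie_hS_eS hk, ih,
      lie_smul, Nat.cast_succ, ← add_assoc, add_smul _ (1 : K), one_smul, add_comm]

theorem lie_hS_dOp {k k' : Fin n} (hk : k ≠ k') (i j : Fin n) (α : Fin n →₀ ℕ) (ℓ : ℕ) :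
    ⁅hS K p k k', dOp k k' ℓ (DS i j α)⁆ =
      (((wt k k' i j α : ℤ) : K) + ℓ) • (dOp k k' ℓ (DS i j α) : S K n p) := by
  rw [dOp, lie_smul, lie_hS_ad_pow hk (lie_hS_DS hk i j α), smul_comm]

end

/-! ### Ordered monomials in noncommuting elements -/

section OrderedProducts

theorem prod_ofFn_sum {A X : Type*} [Semiring A] [Fintype X] :
    ∀ (N : ℕ) (f : Fin N → X → A), (List.ofFn fun i => ∑ x, f i x).prod =
      ∑ b : Fin N → X, (List.ofFn fun i => f i (b i)).prod
  | 0, f => by simp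
  | N + 1, f => by
    rw [List.ofFn_succ, List.prod_cons, prod_ofFn_sum N, Finset.sum_mul_sum,
      ← Fintype.sum_prod_type', ← (Fin.consEquiv fun _ : Fin (N + 1) => X).sum_comp]
    simp [Fin.consEquiv, List.ofFn_succ]

theorem prod_ofFn_smul_tmul {R A : Type*} [CommRing R] [Ring A] [Algebra R A] :
    ∀ (N : ℕ) (s : Fin N → R) (u v : Fin N → A),
      (List.ofFn fun i => s i • (u i ⊗ₜ[R] v i)).prod =
        (∏ i, s i) • ((List.ofFn u).prod ⊗ₜ[R] (List.ofFn v).prod)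
  | 0, s, u, v => by simp [Algebra.TensorProduct.one_def]
  | N + 1, s, u, v => by
    rw [List.ofFn_succ, List.prod_cons, prod_ofFn_smul_tmul N, List.ofFn_succ, List.ofFn_succ,
      List.prod_cons, List.prod_cons, Fin.prod_univ_succ, smul_mul_smul_comm,
      Algebra.TensorProduct.tmul_mul_tmul]

theorem prod_ofFn_one {A : Type*} [Monoid A] : ∀ N : ℕ, (List.ofFn fun _ : Fin N => (1 : A)).prod = 1
  | 0 => by simp
  | N + 1 => by rw [List.ofFn_succ, List.prod_cons, prod_ofFn_one N, mul_one]

theorem prod_ofFn_mulSingle {A : Type*} [Monoid A] :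
    ∀ (N : ℕ) (j : Fin N) (y : A), (List.ofFn (Pi.mulSingle j y : Fin N → A)).prod = y
  | 0, j, _ => j.elim0
  | N + 1, j, y => by
    rw [List.ofFn_succ, List.prod_cons]
    induction j using Fin.cases with
    | zero =>
      have : (fun i : Fin N => (Pi.mulSingle 0 y : Fin (N + 1) → A) i.succ) = fun _ => 1 := by
        ext i; exact Pi.mulSingle_eq_of_ne (Fin.succ_ne_zero i) y
      rw [this, prod_ofFn_one, Pi.mulSingle_eq_same, mul_one]
    | succ j =>
      have : (fun i : Fin N => (Pi.mulSingle j.succ y : Fin (N + 1) → A) i.succ) =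
          Pi.mulSingle j y := by
        ext i
        by_cases h : i = j
        · subst h; simp
        · rw [Pi.mulSingle_eq_of_ne h, Pi.mulSingle_eq_of_ne (fun h' => h (Fin.succ_injective _ h'))]
      rw [this, prod_ofFn_mulSingle N, Pi.mulSingle_eq_of_ne (Fin.succ_ne_zero j).symm, one_mul]

theorem prod_ofFn_smul {R A : Type*} [CommRing R] [Ring A] [Algebra R A] :
    ∀ (N : ℕ) (s : Fin N → R) (u : Fin N → A),
      (List.ofFn fun i => s i • u i).prod = (∏ i, s i) • (List.ofFn u).prod
  | 0, s, u => by simp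
  | N + 1, s, u => by
    rw [List.ofFn_succ, List.prod_cons, prod_ofFn_smul N, List.ofFn_succ, List.prod_cons,
      Fin.prod_univ_succ, smul_mul_smul_comm]

/-- The ordered monomial `y_1^(a_1) ⋯ y_N^(a_N)`. -/
def orderedMonomial {A : Type*} [Monoid A] {N : ℕ} (y : Fin N → A) (a : Fin N → ℕ) : A :=
  (List.ofFn fun i => y i ^ a i).prod

end OrderedProducts

/-! ### Linear independence of ordered monomials in primitive elements -/

section Independence

variable {K H : Type*} [Field K] [Ring H] [Algebra K H] {p : ℕ} [Fact p.Prime] [CharP K p] {N : ℕ}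

/-- The divided power `y^m / m!`. -/
def divPowElem (K : Type*) {H : Type*} [Field K] [Ring H] [Algebra K H] (y : H) (m : ℕ) : H :=
  (m ! : K)⁻¹ • y ^ m

theorem comul_divPowElem (Δ : H →ₐ[K] H ⊗[K] H) {y : H} (hy : Δ y = y ⊗ₜ[K] 1 + 1 ⊗ₜ[K] y)
    (m : Fin p) : Δ (divPowElem K y m) = ∑ x : Fin p × Fin p,
      (if (x.1 : ℕ) + x.2 = m then (1 : K) else 0) •
        (divPowElem K y x.1 ⊗ₜ[K] divPowElem K y x.2) := by
  have hc : Commute (y ⊗ₜ[K] (1 : H)) (1 ⊗ₜ[K] y) := by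
    simp [Commute, SemiconjBy]
  have h1 : Δ (divPowElem K y m) = ∑ x ∈ Finset.HasAntidiagonal.antidiagonal (m : ℕ),
      divPowElem K y x.1 ⊗ₜ[K] divPowElem K y x.2 := by
    rw [divPowElem, map_smul, map_pow, hy, hc.add_pow', Finset.smul_sum]
    refine Finset.sum_congr rfl fun x hx => ?_
    rw [Finset.HasAntidiagonal.mem_antidiagonal] at hx
    have hm := m.2
    rw [divPowElem, divPowElem, TensorProduct.smul_tmul_smul, Algebra.TensorProduct.tmul_pow,
      Algebra.TensorProduct.tmul_pow, one_pow, one_pow, Algebra.TensorProduct.tmul_mul_tmul,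
      one_mul, mul_one, ← Nat.cast_smul_eq_nsmul K, smul_smul]
    congr 1
    have h2 := Nat.add_choose_mul_factorial_mul_factorial x.1 x.2
    rw [hx] at h2
    have h3 := factorial_cast_ne_zero K (hm : (m : ℕ) < p)
    have h4 := factorial_cast_ne_zero K (show x.1 < p by omega)
    have h5 := factorial_cast_ne_zero K (show x.2 < p by omega)
    rw [← h2]
    rw [← h2] at h3
    push_cast at h3 ⊢
    have hs : (m : ℕ).choose x.1 = (m : ℕ).choose x.2 := by rw [← hx]; exact Nat.choose_symm_add
    have h6 : (((m : ℕ).choose x.2 : ℕ) : K) ≠ 0 := fun h => h3 (by simp [h])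
    rw [hs]
    field_simp
  rw [h1, Finset.sum_congr rfl fun x _ => ite_zero_smul .. |>.trans (by rw [one_smul]),
    ← Finset.sum_filter]
  refine Finset.sum_nbij' (fun x => if h : x.1 < p ∧ x.2 < p then (⟨x.1, h.1⟩, ⟨x.2, h.2⟩) else
    (m, m)) (fun x => ((x.1 : ℕ), (x.2 : ℕ))) ?_ ?_ ?_ ?_ ?_
  · intro x hx
    rw [Finset.HasAntidiagonal.mem_antidiagonal] at hx
    have hm := m.2
    rw [dif_pos ⟨by omega, by omega⟩]
    simpa using hx
  · intro x hx
    simpa using hx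
  · intro x hx
    rw [Finset.HasAntidiagonal.mem_antidiagonal] at hx
    have hm := m.2
    rw [dif_pos ⟨by omega, by omega⟩]
  · intro x hx
    simp
  · intro x hx
    rw [Finset.HasAntidiagonal.mem_antidiagonal] at hx
    have hm := m.2
    rw [dif_pos ⟨by omega, by omega⟩]

/-- The ordered product of divided powers. -/
def divMonomial (K : Type*) {H : Type*} [Field K] [Ring H] [Algebra K H] {N p : ℕ} (y : Fin N → H)
    (a : Fin N → Fin p) : H := (List.ofFn fun i => divPowElem K (y i) (a i)).prod

theorem divMonomial_eq_smul (y : Fin N → H) (a : Fin N → Fin p) :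
    divMonomial K y a = (∏ i, ((a i : ℕ)! : K)⁻¹) • orderedMonomial y fun i => (a i : ℕ) := by
  rw [divMonomial, orderedMonomial, ← prod_ofFn_smul]; rfl

theorem comul_divMonomial (Δ : H →ₐ[K] H ⊗[K] H) {y : Fin N → H}
    (hy : ∀ i, Δ (y i) = y i ⊗ₜ[K] 1 + 1 ⊗ₜ[K] y i) (a : Fin N → Fin p) :
    Δ (divMonomial K y a) = ∑ b : Fin N → Fin p, ∑ e : Fin N → Fin p,
      (if ∀ i, (b i : ℕ) + e i = a i then (1 : K) else 0) •
        (divMonomial K y b ⊗ₜ[K] divMonomial K y e) := by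
  rw [divMonomial, map_list_prod, List.map_ofFn]
  have h1 : (Δ ∘ fun i => divPowElem K (y i) (a i)) = fun i => ∑ x : Fin p × Fin p,
      (if (x.1 : ℕ) + x.2 = a i then (1 : K) else 0) •
        (divPowElem K (y i) x.1 ⊗ₜ[K] divPowElem K (y i) x.2) := by
    ext1 i; exact comul_divPowElem Δ (hy i) (a i)
  rw [h1, prod_ofFn_sum, ← Fintype.sum_prod_type',
    ← (Equiv.arrowProdEquivProdArrow (Fin N) (fun _ => Fin p) fun _ => Fin p).sum_comp]
  refine Finset.sum_congr rfl fun b _ => ?_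
  rw [prod_ofFn_smul_tmul, Finset.prod_ite_zero]
  simp only [Equiv.arrowProdEquivProdArrow, divMonomial, Finset.mem_univ, true_imp_iff,
    Finset.prod_const_one]
  rfl

theorem divMonomial_of_sum_eq_zero (y : Fin N → H) {b : Fin N → Fin p}
    (hb : ∑ i, (b i : ℕ) = 0) : divMonomial K y b = 1 := by
  have : ∀ i, (b i : ℕ) = 0 := by simpa using hb
  simp only [divMonomial, this, divPowElem, Nat.factorial_zero, Nat.cast_one, inv_one, pow_zero,
    one_smul, prod_ofFn_one]

theorem divMonomial_of_sum_eq_one (y : Fin N → H) {b : Fin N → Fin p}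
    (hb : ∑ i, (b i : ℕ) = 1) :
    ∃ j, (∀ i, (b i : ℕ) = if i = j then 1 else 0) ∧ divMonomial K y b = y j := by
  obtain ⟨j, hj⟩ : ∃ j, (b j : ℕ) ≠ 0 := by
    by_contra h
    push Not at h
    simp [h] at hb
  have h1 := Finset.add_sum_erase Finset.univ (fun i => (b i : ℕ)) (Finset.mem_univ j)
  simp only [hb] at h1
  have h2 : ∑ i ∈ Finset.univ.erase j, (b i : ℕ) = 0 := by omega
  have h3 : (b j : ℕ) = 1 := by omega
  have h4 : ∀ i, (b i : ℕ) = if i = j then 1 else 0 := by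
    intro i
    split_ifs with h
    · rw [h, h3]
    · exact Finset.sum_eq_zero_iff.1 h2 i (Finset.mem_erase.2 ⟨h, Finset.mem_univ i⟩)
  refine ⟨j, h4, ?_⟩
  rw [divMonomial]
  have h5 : (fun i => divPowElem K (y i) (b i)) = Pi.mulSingle j (y j) := by
    ext i
    by_cases h : i = j
    · subst h; simp [h4, divPowElem]
    · simp [h4, h, divPowElem]
  rw [h5, prod_ofFn_mulSingle]

/-- Ordered monomials with exponents below `p` in linearly independent primitive elements of a
bialgebra of characteristic `p` are linearly independent. -/
theorem linearIndependent_divMonomial (Δ : H →ₐ[K] H ⊗[K] H) (η : H →ₐ[K] K) {y : Fin N → H}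
    (hy : ∀ i, Δ (y i) = y i ⊗ₜ[K] 1 + 1 ⊗ₜ[K] y i) (hη : ∀ i, η (y i) = 0)
    (hli : LinearIndependent K y) :
    LinearIndependent K (divMonomial (p := p) K y) := by
  have hp : 1 < p := (Fact.out : p.Prime).one_lt
  obtain ⟨ξ, hξ1, hξy⟩ : ∃ ξ : Fin N → (H →ₗ[K] K), (∀ j, ξ j 1 = 0) ∧
      ∀ j i, ξ j (y i) = if i = j then 1 else 0 := by
    have hex : ∀ j, ∃ ζ : H →ₗ[K] K, ∀ i, ζ (y i) = if i = j then 1 else 0 := by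
      intro j
      obtain ⟨ζ, hζ⟩ := (Module.Basis.span hli).constr K (fun i => if i = j then (1 : K) else 0) |>.exists_extend
      refine ⟨ζ, fun i => ?_⟩
      have h1 := LinearMap.congr_fun hζ (Module.Basis.span hli i)
      rw [Module.Basis.constr_basis] at h1
      rw [← h1]
      simp [Module.Basis.span_apply]
    choose ζ hζ using hex
    exact ⟨fun j => ζ j - ζ j 1 • η.toLinearMap, fun j => by simp, fun j i => by simp [hη, hζ]⟩
  have key : ∀ d : ℕ, ∀ c : (Fin N → Fin p) → K, (∀ a, d < ∑ i, (a i : ℕ) → c a = 0) →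
      ∑ a, c a • divMonomial K y a = 0 → c = 0 := by
    intro d
    induction d with
    | zero =>
      intro c hc hsum
      let o : Fin N → Fin p := fun _ => ⟨0, by omega⟩
      have h0 : ∑ i : Fin N, (o i : ℕ) = 0 := by simp [o]
      have hne : ∀ a, a ≠ o → c a = 0 := by
        intro a ha
        refine hc a (Nat.pos_of_ne_zero fun h => ha ?_)
        have : ∀ i, (a i : ℕ) = 0 := by simpa using h
        ext i; exact this i
      rw [Finset.sum_eq_single o (fun a _ ha => by rw [hne a ha, zero_smul])
        (by simp), divMonomial_of_sum_eq_zero y h0] at hsum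
      have h1 := congrArg η hsum
      simp only [map_smul, map_one, smul_eq_mul, mul_one, map_zero] at h1
      ext a
      by_cases ha : a = o
      · rw [ha, h1]; rfl
      · exact hne a ha
    | succ d ih =>
      intro c hc hsum
      have htop : ∀ a, d < ∑ i, (a i : ℕ) → c a = 0 := by
        intro a ha
        by_cases ha1 : d + 1 < ∑ i, (a i : ℕ)
        · exact hc a ha1
        have hda : ∑ i, (a i : ℕ) = d + 1 := by omega
        obtain ⟨j, hj⟩ : ∃ j, (a j : ℕ) ≠ 0 := by
          by_contra h
          push Not at h
          simp [h] at ha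
        set c' : (Fin N → Fin p) → K := fun e => ∑ a', ∑ b : Fin N → Fin p,
          c a' * ((if ∀ i, (b i : ℕ) + e i = a' i then (1 : K) else 0) *
            ξ j (divMonomial K y b)) with hc'
        have hdeg : ∀ a' b e : Fin N → Fin p, (∀ i, (b i : ℕ) + e i = a' i) →
            ∑ i, (b i : ℕ) + ∑ i, (e i : ℕ) = ∑ i, (a' i : ℕ) := by
          intro a' b e h
          rw [← Finset.sum_add_distrib]
          exact Finset.sum_congr rfl fun i _ => h i
        have hsum' : ∑ e, c' e • divMonomial K y e = 0 := by
          have h1 := congrArg (fun w => TensorProduct.lid K H ((ξ j).rTensor H (Δ w))) hsum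
          simp only [map_sum, map_smul, comul_divMonomial Δ hy, LinearMap.rTensor_tmul,
            TensorProduct.lid_tmul, map_zero] at h1
          rw [← h1]
          simp only [hc', Finset.sum_smul, Finset.smul_sum, smul_smul]
          rw [Finset.sum_comm]
          refine Finset.sum_congr rfl fun a' _ => ?_
          rw [Finset.sum_comm]
        have hterm : ∀ a' b e : Fin N → Fin p, d ≤ ∑ i, (e i : ℕ) → c a' * ((if ∀ i, (b i : ℕ) + e i = a' i then
            (1 : K) else 0) * ξ j (divMonomial K y b)) ≠ 0 →
            (∀ i, (b i : ℕ) = if i = j then 1 else 0) ∧ (∀ i, (b i : ℕ) + e i = a' i) ∧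
              ∑ i, (e i : ℕ) = d := by
          intro a' b e he hne
          have hca := left_ne_zero_of_mul hne
          have hM := left_ne_zero_of_mul (right_ne_zero_of_mul hne)
          have hξ := right_ne_zero_of_mul (right_ne_zero_of_mul hne)
          have hM' : ∀ i, (b i : ℕ) + e i = a' i := by
            by_contra h
            rw [if_neg h] at hM
            exact hM rfl
          have h1 := hdeg a' b e hM'
          have h2 : ¬ d + 1 < ∑ i, (a' i : ℕ) := fun h => hca (hc a' h)
          have h3 : ∑ i, (b i : ℕ) ≠ 0 := fun h => hξ (by
            rw [divMonomial_of_sum_eq_zero y h, hξ1])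
          have h4 : ∑ i, (b i : ℕ) = 1 := by omega
          obtain ⟨j', hj', hbj⟩ := divMonomial_of_sum_eq_one (K := K) y h4
          rw [hbj, hξy] at hξ
          have : j' = j := by
            by_contra h
            rw [if_neg h] at hξ
            exact hξ rfl
          subst this
          exact ⟨hj', hM', by omega⟩
        have hc'0 : c' = 0 := by
          refine ih c' (fun e he => ?_) hsum'
          refine Finset.sum_eq_zero fun a' _ => Finset.sum_eq_zero fun b _ => ?_
          by_contra hne
          have := (hterm a' b e he.le hne).2.2
          omega
        let e : Fin N → Fin p := fun i => ⟨(a i : ℕ) - if i = j then 1 else 0,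
          lt_of_le_of_lt (Nat.sub_le _ _) (a i).2⟩
        let b : Fin N → Fin p := fun i => if i = j then ⟨1, hp⟩ else ⟨0, by omega⟩
        have hb : ∀ i, (b i : ℕ) = if i = j then 1 else 0 := by
          intro i; simp only [b]; split_ifs <;> rfl
        have hbe : ∀ i, (b i : ℕ) + e i = a i := by
          intro i
          rw [hb]
          simp only [e]
          split_ifs with h
          · subst h; omega
          · omega
        have hbsum : ∑ i, (b i : ℕ) = 1 := by simp [hb]
        have hesum : ∑ i, (e i : ℕ) = d := by
          have := hdeg a b e hbe
          omega
        have h1 := congrFun hc'0 e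
        simp only [hc', Pi.zero_apply] at h1
        rw [Finset.sum_eq_single a, Finset.sum_eq_single b] at h1
        · obtain ⟨j', hj', hbj⟩ := divMonomial_of_sum_eq_one (K := K) y hbsum
          have hjj : j' = j := by
            have h2 := hj' j'
            rw [hb, if_pos rfl] at h2
            by_contra h
            rw [if_neg h] at h2
            omega
          rwa [if_pos hbe, one_mul, hbj, hξy, if_pos hjj, mul_one] at h1
        · intro b' _ hb'
          by_contra hne
          obtain ⟨h2, -, -⟩ := hterm a b' e hesum.ge hne
          exact hb' (funext fun i => Fin.ext (by rw [h2, hb]))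
        · simp
        · intro a' _ ha'
          refine Finset.sum_eq_zero fun b' _ => ?_
          by_contra hne
          obtain ⟨h2, h3, -⟩ := hterm a' b' e hesum.ge hne
          exact ha' (funext fun i => Fin.ext (by rw [← h3, h2, ← hbe, hb]))
        · simp
      exact ih c htop hsum
  rw [Fintype.linearIndependent_iff]
  intro c hc a
  have := key (∑ i : Fin N, p) c (fun a' ha' => absurd ha' (not_lt.2
    (Finset.sum_le_sum fun i _ => (a' i).2.le))) hc
  rw [this]; rfl

theorem linearIndependent_orderedMonomial (Δ : H →ₐ[K] H ⊗[K] H) (η : H →ₐ[K] K) {y : Fin N → H}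
    (hy : ∀ i, Δ (y i) = y i ⊗ₜ[K] 1 + 1 ⊗ₜ[K] y i) (hη : ∀ i, η (y i) = 0)
    (hli : LinearIndependent K y) :
    LinearIndependent K fun a : Fin N → Fin p => orderedMonomial y fun i => (a i : ℕ) := by
  have h := linearIndependent_divMonomial (p := p) Δ η hy hη hli
  have hne : ∀ a : Fin N → Fin p, (∏ i, ((a i : ℕ)! : K)⁻¹) ≠ 0 := fun a =>
    Finset.prod_ne_zero_iff.2 fun i _ => inv_ne_zero (factorial_cast_ne_zero K (a i).2)
  have h2 := h.units_smul fun a => (Units.mk0 _ (hne a))⁻¹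
  convert h2 using 1
  ext a
  rw [Pi.smul_apply', Units.smul_def, divMonomial_eq_smul, smul_smul, Units.val_inv_eq_inv_val,
    Units.val_mk0, inv_mul_cancel₀ (hne a), one_smul]

end Independence

/-! ### Spanning by ordered monomials -/

section Spanning

variable {K A : Type*} [Field K] [Ring A] [Algebra K A] {p N : ℕ} {y : Fin N → A}

/-- The span of the words of length at most `d` in the `y i`. -/
def wordSpan (K : Type*) {A : Type*} [Field K] [Ring A] [Algebra K A] {N : ℕ} (y : Fin N → A)
    (d : ℕ) : Submodule K A :=
  Submodule.span K {w | ∃ l : List (Fin N), l.length ≤ d ∧ w = (l.map y).prod}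

theorem mul_mem_wordSpan (i : Fin N) {d : ℕ} {w : A} (hw : w ∈ wordSpan K y d) :
    y i * w ∈ wordSpan K y (d + 1) := by
  induction hw using Submodule.span_induction with
  | mem w hw =>
    obtain ⟨l, hl, rfl⟩ := hw
    exact Submodule.subset_span ⟨i :: l, by simpa using hl, by simp⟩
  | zero => rw [mul_zero]; exact zero_mem _
  | add a b _ _ ha hb => rw [mul_add]; exact add_mem ha hb
  | smul c a _ ha => rw [mul_smul_comm]; exact Submodule.smul_mem _ _ ha

theorem prod_perm_sub_mem
    (hcomm : ∀ i j, y i * y j - y j * y i ∈ Submodule.span K (Set.range y))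
    {l l' : List (Fin N)} (h : l.Perm l') :
    (l.map y).prod - (l'.map y).prod ∈ wordSpan K y (l.length - 1) := by
  induction h with
  | nil => simp
  | @cons i l₁ l₂ h ih =>
    rw [List.map_cons, List.prod_cons, List.map_cons, List.prod_cons, ← mul_sub]
    cases l₁ with
    | nil => rw [List.nil_perm.1 h]; simp
    | cons j l₁ => exact mul_mem_wordSpan i ih
  | swap i j l =>
    simp only [List.map_cons, List.prod_cons, ← mul_assoc, ← sub_mul]
    have h1 : ∀ w ∈ Submodule.span K (Set.range y),
        w * (l.map y).prod ∈ wordSpan K y (l.length + 1) := by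
      intro w hw
      induction hw using Submodule.span_induction with
      | mem w hw =>
        obtain ⟨i, rfl⟩ := hw
        exact mul_mem_wordSpan i (Submodule.subset_span ⟨l, le_rfl, rfl⟩)
      | zero => rw [zero_mul]; exact zero_mem _
      | add a b _ _ ha hb => rw [add_mul]; exact add_mem ha hb
      | smul c a _ ha => rw [smul_mul_assoc]; exact Submodule.smul_mem _ _ ha
    exact h1 _ (hcomm _ _)
  | trans h1 h2 ih1 ih2 =>
    rw [← h1.length_eq] at ih2
    simpa using add_mem ih1 ih2

/-- The sorted word with prescribed multiplicities. -/
def sortedWord {N : ℕ} (a : Fin N → ℕ) : List (Fin N) :=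
  (List.ofFn fun i => List.replicate (a i) i).flatten

theorem prod_sortedWord (a : Fin N → ℕ) : ((sortedWord a).map y).prod = orderedMonomial y a := by
  rw [sortedWord, List.map_flatten, List.prod_flatten, List.map_map, List.map_ofFn, orderedMonomial]
  congr 2
  ext i
  simp

theorem count_sortedWord (a : Fin N → ℕ) (i : Fin N) : (sortedWord a).count i = a i := by
  rw [sortedWord, List.count_flatten, List.map_ofFn, List.sum_ofFn]
  simp [List.count_replicate]

theorem length_sortedWord (a : Fin N → ℕ) : (sortedWord a).length = ∑ i, a i := by
  rw [sortedWord, List.length_flatten, List.map_ofFn, List.sum_ofFn]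
  simp

theorem perm_sortedWord (l : List (Fin N)) : l.Perm (sortedWord fun i => l.count i) :=
  List.perm_iff_count.2 fun i => (count_sortedWord (fun i => l.count i) i).symm

theorem orderedMonomial_reduce {i : Fin N} {c : K} (hi : y i ^ p = c • y i) {a : Fin N → ℕ}
    (ha : p ≤ a i) :
    orderedMonomial y a = c • orderedMonomial y (Function.update a i (a i - p + 1)) := by
  have h1 : c = ∏ j, (Pi.mulSingle i c : Fin N → K) j := by simp
  conv_rhs => rw [h1]
  rw [orderedMonomial, orderedMonomial, ← prod_ofFn_smul]
  congr 2
  ext j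
  by_cases h : j = i
  · subst h
    have : a j = a j - p + p := by omega
    conv_lhs => rw [this, pow_add, hi]
    simp [pow_succ]
  · simp [h]

theorem wordSpan_le_span_orderedMonomial (hp : 1 < p)
    (hcomm : ∀ i j, y i * y j - y j * y i ∈ Submodule.span K (Set.range y))
    (hpow : ∀ i, ∃ c : K, y i ^ p = c • y i) (d : ℕ) :
    wordSpan K y d ≤ Submodule.span K
      (Set.range fun a : Fin N → Fin p => orderedMonomial y fun i => (a i : ℕ)) := by
  induction d using Nat.strong_induction_on with
  | _ d ih =>
    refine Submodule.span_le.2 ?_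
    rintro _ ⟨l, hl, rfl⟩
    have hsorted : orderedMonomial y (fun i => l.count i) ∈ Submodule.span K
        (Set.range fun a : Fin N → Fin p => orderedMonomial y fun i => (a i : ℕ)) := by
      by_cases hlt : ∀ i, l.count i < p
      · exact Submodule.subset_span ⟨fun i => ⟨l.count i, hlt i⟩, rfl⟩
      · push Not at hlt
        obtain ⟨i, hi⟩ := hlt
        obtain ⟨c, hc⟩ := hpow i
        rw [orderedMonomial_reduce hc hi, ← prod_sortedWord]
        have hlen : l.length = ∑ i, l.count i := by
          rw [(perm_sortedWord l).length_eq, length_sortedWord]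
        have hlt : ∑ j, Function.update (fun i => l.count i) i (l.count i - p + 1) j <
            l.length := by
          rw [hlen]
          refine Finset.sum_lt_sum (fun j _ => ?_) ⟨i, Finset.mem_univ i, ?_⟩
          · by_cases h : j = i
            · subst h; rw [Function.update_self]; omega
            · simp [h]
          · rw [Function.update_self]; omega
        refine Submodule.smul_mem _ _ (ih _ (lt_of_lt_of_le hlt hl) (Submodule.subset_span ⟨_, ?_, rfl⟩))
        rw [length_sortedWord]
    by_cases h0 : l = []
    · subst h0
      simpa [orderedMonomial, prod_ofFn_one] using hsorted
    · have hpos : 0 < l.length := List.length_pos_iff.2 h0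
      have h1 := ih (l.length - 1) (by omega) (prod_perm_sub_mem hcomm (perm_sortedWord l))
      rw [prod_sortedWord] at h1
      simpa using add_mem h1 hsorted

theorem span_orderedMonomial_eq_top (hp : 1 < p)
    (hcomm : ∀ i j, y i * y j - y j * y i ∈ Submodule.span K (Set.range y))
    (hpow : ∀ i, ∃ c : K, y i ^ p = c • y i) (hgen : Algebra.adjoin K (Set.range y) = ⊤) :
    Submodule.span K
      (Set.range fun a : Fin N → Fin p => orderedMonomial y fun i => (a i : ℕ)) = ⊤ := by
  rw [eq_top_iff, ← Algebra.top_toSubmodule, ← hgen, Algebra.adjoin_eq_span]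
  refine Submodule.span_le.2 fun w hw => ?_
  obtain ⟨l, hl, rfl⟩ := Submonoid.exists_list_of_mem_closure hw
  obtain ⟨l', rfl⟩ : ∃ l' : List (Fin N), l = l'.map y := by
    have : l ∈ Set.range (List.map y) := by
      rw [Set.range_list_map]; exact hl
    obtain ⟨l', h⟩ := this
    exact ⟨l', h.symm⟩
  exact wordSpan_le_span_orderedMonomial hp hcomm hpow l'.length
    (Submodule.subset_span ⟨l', le_rfl, rfl⟩)

end Spanning

/-! ### The universal property of `u(S(n;1))` and of `u_{t,q}` -/

theorem charP_of_algebra (K A : Type*) (p : ℕ) [Field K] [CharP K p] [Ring A] [Nontrivial A]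
    [Algebra K A] : CharP A p :=
  charP_of_injective_algebraMap (algebraMap K A).injective p

theorem commute_add_pow_prime (K : Type*) {A : Type*} {p : ℕ} [Field K] [Fact p.Prime] [CharP K p]
    [Ring A] [Algebra K A] {a b : A} (h : Commute a b) : (a + b) ^ p = a ^ p + b ^ p := by
  rcases subsingleton_or_nontrivial A with h0 | h0
  · exact Subsingleton.elim _ _
  · have := charP_of_algebra K A p
    exact add_pow_char_of_commute _ h

section Universal

variable {K : Type*} [Field K] {n p : ℕ} [CharP K p]

/-- A linear map from `S(n;1)` to an associative algebra that respects the bracket and the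
`p`-th powers of the elements `D_ij(x^(α))`. -/
structure IsRestricted {A : Type*} [Ring A] [Algebra K A] (θ : S K n p →ₗ[K] A) : Prop where
  lie : ∀ y w, θ ⁅y, w⁆ = θ y * θ w - θ w * θ y
  toral : ∀ i j : Fin n, j < i → θ (DS i j (ε i + ε j)) ^ p = θ (DS i j (ε i + ε j))
  nil : ∀ i j : Fin n, j < i → ∀ α : Fin n →₀ ℕ, (∀ m, α m < p) → α ≠ ε i + ε j →
    θ (DS i j α) ^ p = 0

section

attribute [local instance] LieRing.ofAssociativeRing

variable {A : Type*} [Ring A] [Algebra K A] {θ : S K n p →ₗ[K] A}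

theorem IsRestricted.exists_lift (hθ : IsRestricted θ) :
    ∃ f : u K n p →ₐ[K] A, ∀ y, f (ιu K n p y) = θ y := by
  let θ' : S K n p →ₗ⁅K⁆ A := { θ with map_lie' := fun {y w} => hθ.lie y w }
  have hι : ∀ y, UniversalEnvelopingAlgebra.lift K θ' (UniversalEnvelopingAlgebra.ι K y) = θ y :=
    fun y => UniversalEnvelopingAlgebra.lift_ι_apply K θ' y
  have hrel : ∀ ⦃a b : U K n p⦄, RestrictedRel K n p a b →
      UniversalEnvelopingAlgebra.lift K θ' a = UniversalEnvelopingAlgebra.lift K θ' b := by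
    intro a b h
    cases h with
    | toral i j hij => rw [map_pow, genU, hι]; exact hθ.toral i j hij
    | nil i j hij α hα hne => rw [map_pow, map_zero, genU, hι]; exact hθ.nil i j hij α hα hne
  refine ⟨RingQuot.liftAlgHom K ⟨UniversalEnvelopingAlgebra.lift K θ', hrel⟩, fun y => ?_⟩
  rw [← hι]
  exact RingQuot.liftAlgHom_mkAlgHom_apply K _ hrel _

theorem u_hom_ext {f g : u K n p →ₐ[K] A} (h : ∀ y, f (ιu K n p y) = g (ιu K n p y)) : f = g := by
  apply RingQuot.ringQuot_ext' K
  apply UniversalEnvelopingAlgebra.hom_ext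
  ext y
  exact h y

variable (K n p) in
theorem isRestricted_ιu : IsRestricted (ιu K n p) where
  lie y w := by
    change RingQuot.mkAlgHom K _ (UniversalEnvelopingAlgebra.ι K ⁅y, w⁆) = _
    rw [LieHom.map_lie, LieRing.of_associative_ring_bracket, map_sub, map_mul, map_mul]
    rfl
  toral i j hij := by
    have := RingQuot.mkAlgHom_rel K (RestrictedRel.toral (K := K) (n := n) (p := p) i j hij)
    rwa [map_pow] at this
  nil i j hij α hα hne := by
    have := RingQuot.mkAlgHom_rel K (RestrictedRel.nil (K := K) (n := n) (p := p) i j hij α hα hne)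
    rwa [map_pow, map_zero] at this

end

variable {A : Type*} [Ring A] [Algebra K A] {θ : S K n p →ₗ[K] A}

/-- The algebra map out of `u(S(n;1))` given by a restricted map. -/
def IsRestricted.lift (hθ : IsRestricted θ) : u K n p →ₐ[K] A := hθ.exists_lift.choose

theorem IsRestricted.lift_ιu (hθ : IsRestricted θ) (y : S K n p) : hθ.lift (ιu K n p y) = θ y :=
  hθ.exists_lift.choose_spec y

theorem IsRestricted.comp (hθ : IsRestricted θ) {B : Type*} [Ring B] [Algebra K B]
    (f : A →ₐ[K] B) : IsRestricted (f.toLinearMap ∘ₗ θ) where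
  lie y w := by
    change f (θ ⁅y, w⁆) = f (θ y) * f (θ w) - f (θ w) * f (θ y)
    rw [hθ.lie, map_sub, map_mul, map_mul]
  toral i j hij := by simp [← map_pow, hθ.toral i j hij]
  nil i j hij α hα hne := by simp [← map_pow, hθ.nil i j hij α hα hne]

variable (K n p) in
theorem adjoin_range_ιu : Algebra.adjoin K (Set.range (ιu K n p)) = ⊤ := by
  set B := Algebra.adjoin K (Set.range (ιu K n p)) with hB
  have hι := isRestricted_ιu K n p
  let ψ : S K n p →ₗ[K] B := (ιu K n p).codRestrict (Subalgebra.toSubmodule B)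
    fun y => Algebra.subset_adjoin ⟨y, rfl⟩
  have hψ : ∀ y, (ψ y : u K n p) = ιu K n p y := fun y => rfl
  have hr : IsRestricted ψ :=
    { lie := fun y w => Subtype.ext (by simpa [hψ] using hι.lie y w)
      toral := fun i j hij => Subtype.ext (by simpa [hψ] using hι.toral i j hij)
      nil := fun i j hij α hα hne => Subtype.ext (by simpa [hψ] using hι.nil i j hij α hα hne) }
  have h1 : B.val.comp hr.lift = AlgHom.id K _ := u_hom_ext fun y => by
    simp [hr.lift_ιu, hψ]
  rw [eq_top_iff]
  intro w _
  have := AlgHom.congr_fun h1 w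
  simp only [AlgHom.comp_apply, AlgHom.id_apply] at this
  rw [← this]
  exact (hr.lift w).2

variable (K n p) in
theorem isRestricted_zero [Fact p.Prime] (A : Type*) [Ring A] [Algebra K A] :
    IsRestricted (0 : S K n p →ₗ[K] A) where
  lie y w := by simp
  toral i j hij := by simp [(Fact.out : p.Prime).ne_zero]
  nil i j hij α hα hne := by simp [(Fact.out : p.Prime).ne_zero]

theorem IsRestricted.neg_op (hθ : IsRestricted θ) (hp : Odd p) :
    IsRestricted (-((MulOpposite.opLinearEquiv K).toLinearMap ∘ₗ θ) : S K n p →ₗ[K] Aᵐᵒᵖ) where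
  lie y w := by
    simp only [LinearMap.neg_apply, LinearMap.comp_apply, LinearEquiv.coe_coe,
      MulOpposite.coe_opLinearEquiv, hθ.lie]
    apply MulOpposite.unop_injective
    simp
  toral i j hij := by
    apply MulOpposite.unop_injective
    simpa [hp.neg_pow] using hθ.toral i j hij
  nil i j hij α hα hne := by
    apply MulOpposite.unop_injective
    simpa [hp.neg_pow] using hθ.nil i j hij α hα hne

/-- The map `y ↦ θ(y) ⊗ 1 + 1 ⊗ θ(y)`. -/
def primMap (R : Type*) {A : Type*} [CommRing R] [Ring A] [Algebra R A] [Algebra K R] [Algebra K A]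
    [IsScalarTower K R A] (θ : S K n p →ₗ[K] A) : S K n p →ₗ[K] A ⊗[R] A :=
  ((Algebra.TensorProduct.includeLeft : A →ₐ[R] A ⊗[R] A).restrictScalars K).toLinearMap ∘ₗ θ +
    ((Algebra.TensorProduct.includeRight : A →ₐ[R] A ⊗[R] A).restrictScalars K).toLinearMap ∘ₗ θ

theorem primMap_apply (R : Type*) {A : Type*} [CommRing R] [Ring A] [Algebra R A] [Algebra K R]
    [Algebra K A] [IsScalarTower K R A] (θ : S K n p →ₗ[K] A) (y : S K n p) :
    primMap R θ y = θ y ⊗ₜ[R] 1 + 1 ⊗ₜ[R] θ y := rfl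

theorem IsRestricted.prim [Fact p.Prime] {R : Type*} [CommRing R] [Algebra R A] [Algebra K R]
    [IsScalarTower K R A] (hθ : IsRestricted θ) : IsRestricted (primMap R θ) := by
  have hpow : ∀ y, primMap R θ y ^ p = (θ y ^ p) ⊗ₜ[R] 1 + 1 ⊗ₜ[R] (θ y ^ p) := by
    intro y
    have hc : Commute (θ y ⊗ₜ[R] (1 : A)) (1 ⊗ₜ[R] θ y) := by simp [Commute, SemiconjBy]
    rw [primMap_apply, commute_add_pow_prime K hc, Algebra.TensorProduct.tmul_pow,
      Algebra.TensorProduct.tmul_pow, one_pow]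
  have hne := (Fact.out : p.Prime).ne_zero
  refine ⟨fun y w => ?_, fun i j hij => ?_, fun i j hij α hα hα' => ?_⟩
  · simp only [primMap_apply, hθ.lie, TensorProduct.sub_tmul, TensorProduct.tmul_sub, mul_add,
      add_mul, Algebra.TensorProduct.tmul_mul_tmul, mul_one, one_mul]
    abel
  · rw [hpow, hθ.toral i j hij, primMap_apply]
  · rw [hpow, hθ.nil i j hij α hα hα']; simp

theorem IsRestricted.toral' [Fact p.Prime] (hθ : IsRestricted θ) (hp : Odd p) {i j : Fin n} (hij : i ≠ j) :
    θ (DS i j (ε i + ε j)) ^ p = θ (DS i j (ε i + ε j)) := by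
  rcases lt_or_gt_of_ne hij with h | h
  · have e : (DS i j (ε i + ε j) : S K n p) = -DS j i (ε j + ε i) := by
      rw [add_comm]
      exact inclS_injective (DijW_swap i j _)
    rw [e, map_neg, hp.neg_pow, hθ.toral j i h]
  · exact hθ.toral i j h

theorem IsRestricted.nil' [Fact p.Prime] (hθ : IsRestricted θ) (hp : Odd p) {i j : Fin n} (hij : i ≠ j)
    {α : Fin n →₀ ℕ} (hα : ∀ m, α m < p) (hne : α ≠ ε i + ε j) : θ (DS i j α) ^ p = 0 := by
  rcases lt_or_gt_of_ne hij with h | h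
  · have e : (DS i j α : S K n p) = -DS j i α := inclS_injective (DijW_swap i j _)
    rw [e, map_neg, hp.neg_pow, hθ.nil j i h α hα (by rwa [add_comm]), neg_zero]
  · exact hθ.nil i j h α hα hne

theorem IsRestricted.toral_hS [Fact p.Prime] (hθ : IsRestricted θ) (hp : Odd p) {k k' : Fin n} (hk : k ≠ k') :
    θ (hS K p k k') ^ p = θ (hS K p k k') := hθ.toral' hp hk

theorem IsRestricted.nil_eS [Fact p.Prime] (hθ : IsRestricted θ) (hp : 2 < p) {k k' : Fin n}
    (hk : k ≠ k') : θ (eS K p k k') ^ p = 0 := by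
  have hodd : Odd p := (Fact.out : p.Prime).odd_of_ne_two hp.ne'
  rw [eS, map_smul, smul_pow, hθ.nil' hodd hk (e_idx_lt hp hk), smul_zero]
  intro h
  have := DFunLike.congr_fun h k
  simp [hk.symm] at this

theorem IsRestricted.comm_hS_eS [Fact p.Prime] (hθ : IsRestricted θ) {k k' : Fin n}
    (hk : k ≠ k') : θ (hS K p k k') * θ (eS K p k k') =
      θ (eS K p k k') * (θ (hS K p k k') + 1) := by
  have := hθ.lie (hS K p k k') (eS K p k k')
  rw [lie_hS_eS hk] at this
  rw [mul_add, mul_one, add_comm]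
  exact (eq_sub_iff_add_eq.1 this).symm

end Universal

/-! ### The faithful representation and the dimension of `u(S(n;1))` -/

section Dimension

variable {K : Type*} [Field K] {n p : ℕ} [Fact p.Prime] [CharP K p]

variable (K n p) in
/-- The representation of `S(n;1)` on `O(n;1)`. -/
def naturalRep : S K n p →ₗ[K] Module.End K (O K n p) where
  toFun y := (inclS K n p y : O K n p →ₗ[K] O K n p)
  map_add' _ _ := rfl
  map_smul' _ _ := rfl

theorem naturalRep_injective : Function.Injective (naturalRep K n p) := by
  intro y w h
  apply inclS_injective
  exact W_ext fun i => LinearMap.congr_fun h (x i)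

theorem isRestricted_naturalRep : IsRestricted (naturalRep K n p) where
  lie y w := by
    refine LinearMap.ext fun f => ?_
    change inclS K n p ⁅y, w⁆ f = inclS K n p y (inclS K n p w f) - inclS K n p w (inclS K n p y f)
    rw [inclS_lie, Derivation.commutator_apply]
  toral i j hij := DijW_toral_pow
  nil i j hij α hα hne := DijW_nil_pow hij.ne' hne

variable (K n p) in
theorem ιu_injective : Function.Injective (ιu K n p) := by
  intro y w h
  apply naturalRep_injective
  rw [← isRestricted_naturalRep.lift_ιu, h, isRestricted_naturalRep.lift_ιu]

variable (K n p) in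
/-- The counit of `u(S(n;1))`. -/
def counitU : u K n p →ₐ[K] K := (isRestricted_zero K n p K).lift

theorem counitU_ιu (y : S K n p) : counitU K n p (ιu K n p y) = 0 :=
  (isRestricted_zero K n p K).lift_ιu y

variable (K n p) in
/-- The standard coproduct of `u(S(n;1))`. -/
def comulU : u K n p →ₐ[K] u K n p ⊗[K] u K n p := ((isRestricted_ιu K n p).prim (R := K)).lift

theorem comulU_ιu (y : S K n p) :
    comulU K n p (ιu K n p y) = ιu K n p y ⊗ₜ[K] 1 + 1 ⊗ₜ[K] ιu K n p y :=
  ((isRestricted_ιu K n p).prim (R := K)).lift_ιu y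

instance : Nontrivial (u K n p) := (counitU K n p).toRingHom.domain_nontrivial

theorem linearIndependent_orderedMonomial_ιu {N : ℕ} {y : Fin N → S K n p}
    (hy : LinearIndependent K y) : LinearIndependent K fun a : Fin N → Fin p =>
      orderedMonomial (fun i => ιu K n p (y i)) fun i => (a i : ℕ) :=
  linearIndependent_orderedMonomial (comulU K n p) (counitU K n p) (fun i => comulU_ιu (y i))
    (fun i => counitU_ιu (y i)) (hy.map' _ (LinearMap.ker_eq_bot.2 (ιu_injective K n p)))

variable (K n p) in
theorem exists_basis_S : ∃ b : Module.Basis (Fin (Module.finrank K (S K n p))) K (S K n p),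
    ∀ m, ∃ i j : Fin n, j < i ∧ ∃ α : Idx n p, b m = DS i j α.1 := by
  classical
  let b := Module.Basis.ofSpan (span_DS K n p).ge
  have : Fintype ((linearIndepOn_empty K (id : S K n p → S K n p)).extend
      (Set.empty_subset {y : S K n p | ∃ i j : Fin n, j < i ∧ ∃ α : Idx n p, y = DS i j α.1})) :=
    FiniteDimensional.fintypeBasisIndex b
  refine ⟨b.reindex (Fintype.equivFinOfCardEq (Module.finrank_eq_card_basis b).symm), fun m => ?_⟩
  rw [Module.Basis.reindex_apply]
  exact Module.Basis.ofSpan_subset (span_DS K n p).ge ⟨_, rfl⟩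

variable (K n p) in
/-- A basis of `u(S(n;1))` that consists of ordered monomials. -/
theorem exists_basis_u :
    Nonempty (Module.Basis (Fin (Module.finrank K (S K n p)) → Fin p) K (u K n p)) := by
  obtain ⟨b, hb⟩ := exists_basis_S K n p
  have hι := isRestricted_ιu K n p
  have hspan : Submodule.span K (Set.range fun i => ιu K n p (b i)) =
      LinearMap.range (ιu K n p) := by
    have : (Set.range fun i => ιu K n p (b i)) = ιu K n p '' Set.range b := by
      rw [← Set.range_comp]; rfl
    rw [this, ← Submodule.map_span, b.span_eq, Submodule.map_top]
  refine ⟨Module.Basis.mk (linearIndependent_orderedMonomial_ιu b.linearIndependent) ?_⟩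
  refine (span_orderedMonomial_eq_top (Fact.out : p.Prime).one_lt (fun i j => ?_) (fun i => ?_) ?_).ge
  · rw [hspan, ← hι.lie]; exact ⟨_, rfl⟩
  · obtain ⟨i', j', hij, α, hα⟩ := hb i
    rw [hα]
    by_cases h : α.1 = ε i' + ε j'
    · exact ⟨1, by rw [h, hι.toral i' j' hij, one_smul]⟩
    · exact ⟨0, by rw [hι.nil i' j' hij α.1 α.2 h, zero_smul]⟩
  · rw [eq_top_iff, ← adjoin_range_ιu, Algebra.adjoin_le_iff]
    rintro _ ⟨y, rfl⟩
    have h1 : ιu K n p y ∈ Submodule.span K (Set.range fun i => ιu K n p (b i)) :=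
      hspan ▸ ⟨y, rfl⟩
    exact Algebra.span_le_adjoin K _ h1

instance : Module.Finite K (u K n p) :=
  Module.Finite.of_basis (exists_basis_u K n p).some

variable (K n p) in
theorem finrank_u (hn : 1 ≤ n) : Module.finrank K (u K n p) = p ^ ((n - 1) * (p ^ n - 1)) := by
  rw [Module.finrank_eq_card_basis (exists_basis_u K n p).some, ← finrank_S K n p hn]
  simp

variable (K p) in
theorem truncPoly_monic (q : K) :
    (Polynomial.X ^ p - Polynomial.C q * Polynomial.X : Polynomial K).Monic := by
  refine Polynomial.monic_X_pow_sub (lt_of_le_of_lt (Polynomial.degree_C_mul_X_le q) ?_)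
  exact_mod_cast (Fact.out : p.Prime).one_lt

variable (K p) in
theorem truncPoly_natDegree (q : K) :
    (Polynomial.X ^ p - Polynomial.C q * Polynomial.X : Polynomial K).natDegree = p := by
  rw [Polynomial.natDegree_sub_eq_left_of_natDegree_lt] <;> rw [Polynomial.natDegree_X_pow]
  exact lt_of_le_of_lt (Polynomial.natDegree_C_mul_le q Polynomial.X |>.trans Polynomial.natDegree_X_le) (Fact.out : p.Prime).one_lt

instance (q : K) : Module.Finite K (TruncRing K p q) :=
  (truncPoly_monic K p q).finite_adjoinRoot

variable (K p) in
theorem finrank_truncRing (q : K) : Module.finrank K (TruncRing K p q) = p := by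
  rw [(AdjoinRoot.powerBasis' (truncPoly_monic K p q)).finrank, AdjoinRoot.powerBasis'_dim,
    truncPoly_natDegree]

variable (K p) in
theorem linearIndependent_t_pow (q : K) : LinearIndependent K fun i : Fin p => t K p q ^ (i : ℕ) := by
  let b := AdjoinRoot.powerBasis' (truncPoly_monic K p q)
  have hdim : b.dim = p := by
    rw [AdjoinRoot.powerBasis'_dim, truncPoly_natDegree]
  have h := b.basis.linearIndependent
  have h2 := h.comp (Fin.cast hdim.symm) (Fin.cast_injective _)
  have h3 : (b.basis ∘ Fin.cast hdim.symm) = fun i : Fin p => t K p q ^ (i : ℕ) := by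
    ext i
    simp [b, t]
  exact h3 ▸ h2

instance (q : K) : Nontrivial (TruncRing K p q) := by
  refine AdjoinRoot.nontrivial _ ?_
  intro h
  have := Polynomial.natDegree_eq_of_degree_eq_some h
  rw [truncPoly_natDegree] at this
  exact (Fact.out : p.Prime).ne_zero this

instance (q : K) : Module.Finite K (utq K n p q) :=
  Module.Finite.tensorProduct K (TruncRing K p q) (u K n p)

variable (K n p) in
theorem finrank_utq (hn : 1 ≤ n) (q : K) :
    Module.finrank K (utq K n p q) = p ^ (1 + (n - 1) * (p ^ n - 1)) := by
  rw [Module.finrank_tensorProduct, finrank_truncRing, finrank_u K n p hn, pow_add, pow_one]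

end Dimension

section ToralComul

variable {p : ℕ} [Fact p.Prime] {R B : Type*} [CommRing R] [Ring B] [Algebra R B]
  [CharP B p] {h z : B}

theorem ToralPair.sum_scal_eigenIdem (H : ToralPair p h z) :
    ∑ s : ZMod p, scal B s * eigenIdem h s = h := by
  simp only [← mul_eigenIdem H.toral, ← Finset.mul_sum, sum_eigenIdem, mul_one]

/-- The conjugate of the toral element by the twist. -/
theorem ToralPair.twistF_conj_h (H : ToralPair p h z) :
    twistF p R h z * (h ⊗ₜ[R] 1 + 1 ⊗ₜ[R] h) * twistFinv p R h z =
      h ⊗ₜ[R] unip z (-1 : ZMod p) + 1 ⊗ₜ[R] h := by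
  have h0 : h * h = h * (h + scal B (0 : ZMod p)) := by simp
  rw [twistF_conj_weight H h0, unip_zero]
  have h1 : ∀ s : ZMod p, unip z s * h * unip z (-s) =
      h - scal B s * (z * unip z (-1 : ZMod p)) := by
    intro s
    rw [H.unip_mul_h, sub_mul, mul_assoc, unip_mul_neg H.nil, mul_one, mul_assoc, mul_assoc,
      ← unip_add H.nil]
    congr 4
    ring
  have h2 : (1 : B) - z * unip z (-1 : ZMod p) = unip z (-1 : ZMod p) := by
    have : (1 + z) * unip z (-1 : ZMod p) = 1 := by
      rw [← unip_one (p := p) H.nil, unip_mul_neg H.nil]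
    conv_lhs => rw [← this]
    noncomm_ring
  have h3 : ∀ s : ZMod p, eigenIdem h s ⊗ₜ[R] (h - scal B s * (z * unip z (-1 : ZMod p))) =
      eigenIdem h s ⊗ₜ[R] h - (scal B s * eigenIdem h s) ⊗ₜ[R] (z * unip z (-1 : ZMod p)) := by
    intro s
    rw [TensorProduct.tmul_sub, scal_eq_natCast, ← nsmul_eq_mul, ← nsmul_eq_mul,
      TensorProduct.smul_tmul]
  simp only [h1, h3, Finset.sum_sub_distrib, ← TensorProduct.sum_tmul, sum_eigenIdem,
    H.sum_scal_eigenIdem]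
  rw [← h2, TensorProduct.tmul_sub, h2]
  abel

end ToralComul

theorem coassoc_of_primitive {R B : Type*} [CommRing R] [Ring B] [Algebra R B]
    {Δ : B →ₐ[R] B ⊗[R] B} {b : B} (hb : Δ b = b ⊗ₜ[R] 1 + 1 ⊗ₜ[R] b) :
    Algebra.TensorProduct.assoc R R R B B B
        (Algebra.TensorProduct.map Δ (AlgHom.id R B) (Δ b)) =
      Algebra.TensorProduct.map (AlgHom.id R B) Δ (Δ b) := by
  simp only [hb, map_add, Algebra.TensorProduct.map_tmul, map_one, AlgHom.id_apply,
    TensorProduct.add_tmul, TensorProduct.tmul_add, Algebra.TensorProduct.assoc_tmul,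
    Algebra.TensorProduct.one_def, add_assoc]

/-! ### The Hopf structure of `u_{t,q}` -/

section BaseHopf

variable {K : Type*} [Field K] {n p : ℕ} [Fact p.Prime] [CharP K p] {q : K}

variable (K n p q) in
/-- The linear map `y ↦ emb y`. -/
def embL : S K n p →ₗ[K] utq K n p q :=
  (Algebra.TensorProduct.includeRight : u K n p →ₐ[K] utq K n p q).toLinearMap ∘ₗ ιu K n p

theorem embL_apply (y : S K n p) : embL K n p q y = emb y := rfl

variable (K n p q) in
theorem isRestricted_embL : IsRestricted (embL K n p q) :=
  (isRestricted_ιu K n p).comp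
    (Algebra.TensorProduct.includeRight : u K n p →ₐ[K] utq K n p q)

/-- The map of `K[t]/(t^p - qt)`-algebras out of `u_{t,q}` given by a restricted map. -/
def IsRestricted.liftR {A : Type*} [Ring A] [Algebra K A] [Algebra (TruncRing K p q) A]
    [IsScalarTower K (TruncRing K p q) A] {θ : S K n p →ₗ[K] A} (hθ : IsRestricted θ) :
    utq K n p q →ₐ[TruncRing K p q] A :=
  Algebra.TensorProduct.lift (Algebra.ofId (TruncRing K p q) A) hθ.lift
    fun r _ => Algebra.commute_algebraMap_left r _

theorem IsRestricted.liftR_emb {A : Type*} [Ring A] [Algebra K A] [Algebra (TruncRing K p q) A]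
    [IsScalarTower K (TruncRing K p q) A] {θ : S K n p →ₗ[K] A} (hθ : IsRestricted θ)
    (y : S K n p) : hθ.liftR (q := q) (emb y) = θ y := by
  refine (Algebra.TensorProduct.lift_tmul _ _ _ _ _).trans ?_
  rw [map_one, one_mul, hθ.lift_ιu]

variable (K n p q) in
theorem adjoin_range_emb :
    Algebra.adjoin (TruncRing K p q) (Set.range (emb : S K n p → utq K n p q)) = ⊤ := by
  rw [eq_top_iff]
  intro w _
  have key : ∀ b : u K n p, (1 : TruncRing K p q) ⊗ₜ[K] b ∈
      Algebra.adjoin (TruncRing K p q) (Set.range (emb : S K n p → utq K n p q)) := by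
    intro b
    have hb : b ∈ Algebra.adjoin K (Set.range (ιu K n p)) := adjoin_range_ιu K n p ▸ Algebra.mem_top
    induction hb using Algebra.adjoin_induction with
    | mem b hb => obtain ⟨y, rfl⟩ := hb; exact Algebra.subset_adjoin ⟨y, rfl⟩
    | algebraMap r =>
      have e : (1 : TruncRing K p q) ⊗ₜ[K] algebraMap K (u K n p) r =
          algebraMap (TruncRing K p q) (utq K n p q) (algebraMap K _ r) := by
        rw [Algebra.algebraMap_eq_smul_one, TensorProduct.tmul_smul, TensorProduct.smul_tmul',
          Algebra.TensorProduct.algebraMap_apply, ← Algebra.algebraMap_eq_smul_one]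
        rfl
      rw [e]
      exact Subalgebra.algebraMap_mem _ _
    | add x y _ _ hx hy => rw [TensorProduct.tmul_add]; exact add_mem hx hy
    | mul x y _ _ hx hy =>
      have := mul_mem hx hy
      rwa [Algebra.TensorProduct.tmul_mul_tmul, one_mul] at this
  induction w using TensorProduct.induction_on with
  | zero => exact zero_mem _
  | add x y hx hy => exact add_mem (hx trivial) (hy trivial)
  | tmul r b =>
    have e : r ⊗ₜ[K] b = r • ((1 : TruncRing K p q) ⊗ₜ[K] b) := by
      rw [TensorProduct.smul_tmul', smul_eq_mul, mul_one]
    rw [e]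
    exact Subalgebra.smul_mem _ (key b) r

variable (K n p q)

/-- The counit of `u_{t,q}`. -/
def counitR : utq K n p q →ₐ[TruncRing K p q] TruncRing K p q :=
  (isRestricted_zero K n p (TruncRing K p q)).liftR

theorem counitR_emb (y : S K n p) : counitR K n p q (emb y) = 0 :=
  (isRestricted_zero K n p (TruncRing K p q)).liftR_emb y

/-- The standard coproduct of `u_{t,q}`. -/
def comulR : utq K n p q →ₐ[TruncRing K p q] utq K n p q ⊗[TruncRing K p q] utq K n p q :=
  ((isRestricted_embL K n p q).prim (R := TruncRing K p q)).liftR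

theorem comulR_emb (y : S K n p) :
    comulR K n p q (emb y) = emb y ⊗ₜ[TruncRing K p q] 1 + 1 ⊗ₜ[TruncRing K p q] emb y :=
  ((isRestricted_embL K n p q).prim (R := TruncRing K p q)).liftR_emb y

/-- The standard antipode of `u_{t,q}`. -/
def antiR (hp : Odd p) : utq K n p q →ₐ[TruncRing K p q] (utq K n p q)ᵐᵒᵖ :=
  ((isRestricted_embL K n p q).neg_op hp).liftR

theorem antiR_emb (hp : Odd p) (y : S K n p) :
    HopfStructure.antiLin (antiR K n p q hp) (emb y) = -emb y := by
  rw [HopfStructure.antiLin_apply, antiR, IsRestricted.liftR_emb]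
  rfl

/-- The undeformed Hopf structure of `u_{t,q}`: the elements of `S(n;1)` are primitive. -/
def baseHopf (hp : Odd p) : HopfStructure (TruncRing K p q) (utq K n p q) :=
  HopfStructure.ofGenerators (comulR K n p q) (counitR K n p q) (antiR K n p q hp) _
    (adjoin_range_emb K n p q)
    (by
      rintro _ ⟨y, rfl⟩
      exact coassoc_of_primitive (comulR_emb K n p q y))
    (by rintro _ ⟨y, rfl⟩; simp [comulR_emb, counitR_emb])
    (by rintro _ ⟨y, rfl⟩; simp [comulR_emb, counitR_emb])
    (by
      rintro _ ⟨y, rfl⟩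
      simp [comulR_emb, counitR_emb, antiR_emb, HopfStructure.antiLin_one])
    (by
      rintro _ ⟨y, rfl⟩
      simp [comulR_emb, counitR_emb, antiR_emb, HopfStructure.antiLin_one])

instance : Nontrivial (utq K n p q) := (counitR K n p q).toRingHom.domain_nontrivial

instance : Nontrivial (utq K n p q ⊗[TruncRing K p q] utq K n p q) :=
  (Algebra.TensorProduct.lift (counitR K n p q) (counitR K n p q)
    fun _ _ => Commute.all _ _).toRingHom.domain_nontrivial

instance : CharP (TruncRing K p q) p := charP_of_algebra K _ p

instance : CharP (utq K n p q) p := charP_of_algebra K _ p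

instance : CharP (utq K n p q ⊗[TruncRing K p q] utq K n p q) p := charP_of_algebra K _ p

end BaseHopf

/-! ### Twisting a Hopf structure in which `S(n;1)` is primitive -/

section PrimitiveTwist

variable {K : Type*} [Field K] {n p : ℕ} [Fact p.Prime] [CharP K p]
  {R B : Type*} [CommRing R] [Ring B] [Algebra R B] [Algebra K R] [Algebra K B]
  [IsScalarTower K R B] [CharP B p] {θ : S K n p →ₗ[K] B}

theorem IsRestricted.hS_mul (hθ : IsRestricted θ) {k k' : Fin n} {y : S K n p} {c : ℤ}
    (hy : ⁅hS K p k k', y⁆ = (c : K) • y) :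
    θ (hS K p k k') * θ y = θ y * (θ (hS K p k k') + scal B (c : ZMod p)) := by
  have h1 : θ ((c : K) • y) = θ y * (c : B) := by
    rw [map_smul, Int.cast_smul_eq_zsmul, zsmul_eq_mul, (Int.cast_commute c _).eq]
  rw [map_intCast, mul_add, ← h1, ← hy, hθ.lie]
  abel

/-- The nilpotent element `-τ e`. -/
def twistZ (θ : S K n p →ₗ[K] B) (τ : R) (k k' : Fin n) : B := -(τ • θ (eS K p k k'))

theorem twistZ_pow (θ : S K n p →ₗ[K] B) (τ : R) (k k' : Fin n) (m : ℕ) :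
    twistZ θ τ k k' ^ m = ((-1) ^ m * τ ^ m) • θ (eS K p k k') ^ m := by
  rw [twistZ, ← neg_smul, smul_pow, neg_pow]

variable (hθ : IsRestricted θ) (hp : 2 < p) {k k' : Fin n} (hk : k ≠ k') (τ : R)
include hθ

include hp hk in
theorem IsRestricted.toralPair : ToralPair p (θ (hS K p k k')) (twistZ θ τ k k') where
  toral := hθ.toral_hS ((Fact.out : p.Prime).odd_of_ne_two hp.ne') hk
  nil := by rw [twistZ, ← neg_smul, smul_pow, hθ.nil_eS hp hk, smul_zero]
  comm := by rw [twistZ, mul_neg, mul_smul_comm, hθ.comm_hS_eS hk, neg_mul, smul_mul_assoc]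

theorem IsRestricted.iterate_commutator (y : S K n p) (ℓ : ℕ) :
    ((LinearMap.mulRight R (twistZ θ τ k k') - LinearMap.mulLeft R (twistZ θ τ k k')) ^ ℓ) (θ y) =
      τ ^ ℓ • θ ((LieAlgebra.ad K (S K n p) (eS K p k k') ^ ℓ) y) := by
  induction ℓ with
  | zero => simp
  | succ ℓ ih =>
    rw [pow_succ', Module.End.mul_apply, ih, map_smul, pow_succ' (LieAlgebra.ad K _ _),
      Module.End.mul_apply, LieAlgebra.ad_apply, hθ.lie, pow_succ, mul_smul]
    congr 1
    rw [LinearMap.sub_apply, LinearMap.mulRight_apply, LinearMap.mulLeft_apply, twistZ, mul_neg,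
      neg_mul, mul_smul_comm, smul_mul_assoc, smul_sub]
    abel

theorem IsRestricted.iterate_commutator_dOp (y : S K n p) {ℓ : ℕ} (hℓ : ℓ < p) :
    ((LinearMap.mulRight R (twistZ θ τ k k') - LinearMap.mulLeft R (twistZ θ τ k k')) ^ ℓ) (θ y) =
      (ℓ ! : B) * (τ ^ ℓ • θ (dOp k k' ℓ y)) := by
  rw [hθ.iterate_commutator, mul_smul_comm]
  congr 1
  rw [dOp, map_smul, mul_smul_comm, ← nsmul_eq_mul, ← Nat.cast_smul_eq_nsmul K, smul_smul,
    inv_mul_cancel₀ (factorial_cast_ne_zero K hℓ), one_smul]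

/-- The twisted coproduct of a primitive `D_ij(x^(α))`. -/
theorem IsRestricted.twistF_conj_DS (i j : Fin n) (α : Fin n →₀ ℕ) :
    twistF p R (θ (hS K p k k')) (twistZ θ τ k k') *
      (θ (DS i j α) ⊗ₜ[R] 1 + 1 ⊗ₜ[R] θ (DS i j α)) *
      twistFinv p R (θ (hS K p k k')) (twistZ θ τ k k') =
    θ (DS i j α) ⊗ₜ[R] ((unipUnit (hθ.toralPair hp hk τ).nil ^ wt k k' i j α : Bˣ) : B) +
      ∑ ℓ ∈ Finset.range p, (-1 : ℤ) ^ ℓ • (rising (θ (hS K p k k')) 0 ℓ ⊗ₜ[R]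
        (τ ^ ℓ • (((unipUnit (hθ.toralPair hp hk τ).nil ^ (-(ℓ : ℤ)) : Bˣ) : B) *
          θ (dOp k k' ℓ (DS i j α))))) := by
  have H := hθ.toralPair hp hk τ
  rw [twistF_conj_weight H (hθ.hS_mul (lie_hS_DS hk i j α)), unipUnit_zpow,
    sum_eigenIdem_tmul_conj H (W := fun ℓ => τ ^ ℓ • θ (dOp k k' ℓ (DS i j α)))
      (fun ℓ hℓ => hθ.iterate_commutator_dOp τ _ hℓ)]
  congr 1
  refine Finset.sum_congr rfl fun ℓ _ => ?_
  rw [unipUnit_zpow, mul_smul_comm, Int.cast_neg, Int.cast_natCast]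

/-- The twisted antipode of a primitive `D_ij(x^(α))`. -/
theorem IsRestricted.V_conj_DS (i j : Fin n) (α : Fin n →₀ ℕ) :
    ToralPair.V p (θ (hS K p k k')) (-twistZ θ τ k k') *
      (-θ (DS i j α) * ToralPair.V p (θ (hS K p k k')) (twistZ θ τ k k')) =
    -(((unipUnit (hθ.toralPair hp hk τ).nil ^ (-wt k k' i j α) : Bˣ) : B) *
      ∑ ℓ ∈ Finset.range p, τ ^ ℓ •
        (θ (dOp k k' ℓ (DS i j α)) * rising (θ (hS K p k k')) 1 ℓ)) := by
  have H := hθ.toralPair hp hk τ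
  rw [neg_mul, mul_neg, mul_V_eq H (hθ.hS_mul (lie_hS_DS hk i j α))
      (W := fun ℓ => τ ^ ℓ • θ (dOp k k' ℓ (DS i j α)))
      (fun ℓ hℓ => hθ.iterate_commutator_dOp τ _ hℓ) (fun ℓ _ => ?_), ← mul_assoc,
    H.V_neg_mul_V, one_mul, unipUnit_zpow, Int.cast_neg]
  · simp only [smul_mul_assoc]
  · rw [mul_smul_comm, smul_mul_assoc]
    congr 1
    have := hθ.hS_mul (k := k) (k' := k') (y := dOp k k' ℓ (DS i j α))
      (c := wt k k' i j α + ℓ) (by rw [lie_hS_dOp hk]; push_cast; rfl)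
    rw [this]
    push_cast
    rfl

/-- The twist of a Hopf structure in which the elements of `S(n;1)` are primitive. -/
def primitiveTwist [CharP R p] [CharP (B ⊗[R] B) p] (X : HopfStructure R B) (S₀ : B →ₐ[R] Bᵐᵒᵖ)
    (hS₀ : X.antipode = HopfStructure.antiLin S₀)
    (hΔ : ∀ y, X.Δ (θ y) = θ y ⊗ₜ[R] 1 + 1 ⊗ₜ[R] θ y) (hε : ∀ y, X.counit (θ y) = 0)
    (hanti : ∀ y, X.antipode (θ y) = -θ y) : HopfStructure R B :=
  X.twist hp S₀ hS₀ (hθ.toralPair hp hk τ) (hΔ _)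
    (by
      rw [twistZ, map_neg, map_smul, hΔ, smul_add, neg_add, TensorProduct.neg_tmul,
        TensorProduct.tmul_neg, TensorProduct.smul_tmul', TensorProduct.tmul_smul])
    (hε _) (by rw [twistZ, map_neg, map_smul, hε, smul_zero, neg_zero])
    (hanti _) (by rw [twistZ, map_neg, map_smul, hanti, smul_neg])

theorem primitiveTwist_comul [CharP R p] [CharP (B ⊗[R] B) p] (X : HopfStructure R B)
    (S₀ : B →ₐ[R] Bᵐᵒᵖ) (hS₀ : X.antipode = HopfStructure.antiLin S₀)
    (hΔ : ∀ y, X.Δ (θ y) = θ y ⊗ₜ[R] 1 + 1 ⊗ₜ[R] θ y) (hε : ∀ y, X.counit (θ y) = 0)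
    (hanti : ∀ y, X.antipode (θ y) = -θ y) (b : B) :
    (primitiveTwist hθ hp hk τ X S₀ hS₀ hΔ hε hanti).Δ b =
      twistF p R (θ (hS K p k k')) (twistZ θ τ k k') * X.Δ b *
        twistFinv p R (θ (hS K p k k')) (twistZ θ τ k k') :=
  conjHom_apply _ _ _ (twistF_mul_inv (hθ.toralPair hp hk τ))
    (twistFinv_mul (hθ.toralPair hp hk τ)) b

end PrimitiveTwist

/-! ### The twisted Hopf structure of `u_{t,q}` -/

section TwistedHopf

variable {K : Type*} [Field K] {n p : ℕ} [Fact p.Prime] [CharP K p] {q : K}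

variable (K p q) in
/-- The nilpotent element `-et` of `u_{t,q}`. -/
def zR (k k' : Fin n) : utq K n p q := twistZ (embL K n p q) (t K p q) k k'

theorem zR_pow (k k' : Fin n) (m : ℕ) :
    zR K p q k k' ^ m = ((-1) ^ m * t K p q ^ m) ⊗ₜ[K] (ιu K n p (eS K p k k') ^ m) := by
  rw [zR, twistZ_pow, embL_apply, emb, Algebra.TensorProduct.tmul_pow, one_pow,
    TensorProduct.smul_tmul', smul_eq_mul, mul_one]

theorem toralPair_zR (hp : 2 < p) {k k' : Fin n} (hk : k ≠ k') :
    ToralPair p (emb (hS K p k k')) (zR K p q k k') :=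
  (isRestricted_embL K n p q).toralPair hp hk (t K p q)

variable (K q) in
/-- The unit `1 - et` of `u_{t,q}`. -/
def unitR (hp : 2 < p) {k k' : Fin n} (hk : k ≠ k') : (utq K n p q)ˣ :=
  unipUnit (toralPair_zR (K := K) (q := q) hp hk).nil

theorem unitR_val (hp : 2 < p) {k k' : Fin n} (hk : k ≠ k') :
    (unitR K q hp hk : utq K n p q) = 1 - t K p q • emb (eS K p k k') :=
  (sub_eq_add_neg (1 : utq K n p q) _).symm

/-- The Hopf structure of `u_{t,q}` given by the twist. -/
def twistedHopf (hp : 2 < p) {k k' : Fin n} (hk : k ≠ k') :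
    HopfStructure (TruncRing K p q) (utq K n p q) :=
  have hodd : Odd p := (Fact.out : p.Prime).odd_of_ne_two hp.ne'
  primitiveTwist (isRestricted_embL K n p q) hp hk (t K p q) (baseHopf K n p q hodd)
    (antiR K n p q hodd) rfl (comulR_emb K n p q) (counitR_emb K n p q) (antiR_emb K n p q hodd)

theorem twistedHopf_comul_emb (hp : 2 < p) {k k' : Fin n} (hk : k ≠ k') (y : S K n p) :
    (twistedHopf hp hk).Δ (emb y : utq K n p q) =
      twistF p (TruncRing K p q) (emb (hS K p k k')) (zR K p q k k') *
        (emb y ⊗ₜ[TruncRing K p q] 1 + 1 ⊗ₜ[TruncRing K p q] emb y) *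
        twistFinv p (TruncRing K p q) (emb (hS K p k k')) (zR K p q k k') := by
  rw [← comulR_emb]
  exact primitiveTwist_comul (isRestricted_embL K n p q) hp hk (t K p q)
    (baseHopf K n p q ((Fact.out : p.Prime).odd_of_ne_two hp.ne')) (antiR K n p q _) rfl
    (comulR_emb K n p q) (counitR_emb K n p q) (antiR_emb K n p q _) (emb y)

theorem twistedHopf_counit_emb (hp : 2 < p) {k k' : Fin n} (hk : k ≠ k') (y : S K n p) :
    (twistedHopf hp hk).counit (emb y : utq K n p q) = 0 := counitR_emb K n p q y

theorem twistedHopf_comul_DS (hp : 2 < p) {k k' : Fin n} (hk : k ≠ k') (i j : Fin n)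
    (α : Fin n →₀ ℕ) : (twistedHopf hp hk).Δ (emb (DS i j α)) =
      emb (DS i j α) ⊗ₜ[TruncRing K p q]
        ((unitR K q hp hk ^ wt k k' i j α : (utq K n p q)ˣ) : utq K n p q) +
      ∑ ℓ ∈ Finset.range p, (-1 : ℤ) ^ ℓ •
        (rising (emb (hS K p k k')) 0 ℓ ⊗ₜ[TruncRing K p q]
          (t K p q ^ ℓ • (((unitR K q hp hk ^ (-(ℓ : ℤ)) : (utq K n p q)ˣ) : utq K n p q) *
            emb (dOp k k' ℓ (DS i j α))))) :=
  (twistedHopf_comul_emb hp hk _).trans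
    ((isRestricted_embL K n p q).twistF_conj_DS hp hk (t K p q) i j α)

theorem twistedHopf_antipode_DS (hp : 2 < p) {k k' : Fin n} (hk : k ≠ k') (i j : Fin n)
    (α : Fin n →₀ ℕ) : (twistedHopf hp hk).antipode (emb (DS i j α)) =
      -(((unitR K q hp hk ^ (-wt k k' i j α) : (utq K n p q)ˣ) : utq K n p q) *
        ∑ ℓ ∈ Finset.range p, t K p q ^ ℓ •
          (emb (dOp k k' ℓ (DS i j α)) * rising (emb (hS K p k k')) 1 ℓ)) := by
  refine Eq.trans ?_ ((isRestricted_embL K n p q).V_conj_DS hp hk (t K p q) i j α)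
  have := antiR_emb K n p q ((Fact.out : p.Prime).odd_of_ne_two hp.ne') (DS i j α)
  exact congrArg (fun w => ToralPair.V p (emb (hS K p k k')) (-zR K p q k k') *
    (w * ToralPair.V p (emb (hS K p k k')) (zR K p q k k'))) this

/-- The extension to `u_{t,q}` of a linear functional of `u(S(n;1))`. -/
def functionalR (ξ : u K n p →ₗ[K] K) : utq K n p q →ₗ[TruncRing K p q] TruncRing K p q :=
  (TensorProduct.AlgebraTensorModule.rid K (TruncRing K p q) (TruncRing K p q)).toLinearMap ∘ₗ
    ξ.baseChange (TruncRing K p q)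

theorem functionalR_tmul (ξ : u K n p →ₗ[K] K) (r : TruncRing K p q) (b : u K n p) :
    functionalR ξ (r ⊗ₜ[K] b) = ξ b • r := by
  simp [functionalR]

/-- A linear functional of `u(S(n;1))` with given values at `h` and `e`. -/
theorem exists_functional (hp : 2 < p) {k k' : Fin n} (hk : k ≠ k') (c d : K) :
    ∃ ξ : u K n p →ₗ[K] K, ξ (ιu K n p (hS K p k k')) = c ∧ ξ (ιu K n p (eS K p k k')) = d := by
  have h1 := (linearIndependent_hS_eS (K := K) hp hk).map' (ιu K n p)
    (LinearMap.ker_eq_bot.2 (ιu_injective K n p))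
  obtain ⟨ξ, hξ⟩ := LinearMap.exists_extend
    ((Module.Basis.span h1).constr K (![c, d] : Fin 2 → K))
  have h2 : ∀ i, ξ ((ιu K n p ∘ ![hS K p k k', eS K p k k']) i) = (![c, d] : Fin 2 → K) i := by
    intro i
    have := LinearMap.congr_fun hξ (Module.Basis.span h1 i)
    rw [Module.Basis.constr_basis, LinearMap.comp_apply, Submodule.subtype_apply,
      Module.Basis.span_apply] at this
    exact this
  exact ⟨ξ, h2 0, h2 1⟩

theorem emb_eS_ne_zero (hp : 2 < p) {k k' : Fin n} (hk : k ≠ k') :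
    (emb (eS K p k k') : utq K n p q) ≠ 0 := by
  obtain ⟨ξ, -, hξ⟩ := exists_functional (K := K) hp hk 0 1
  intro h
  have := congrArg (functionalR ξ) h
  rw [map_zero, emb, functionalR_tmul, hξ, one_smul] at this
  exact one_ne_zero this

theorem emb_lie (y w : S K n p) :
    (emb ⁅y, w⁆ : utq K n p q) = emb y * emb w - emb w * emb y :=
  (isRestricted_embL K n p q).lie y w

theorem emb_hS_mul_emb_eS_ne (hp : 2 < p) {k k' : Fin n} (hk : k ≠ k') :
    (emb (hS K p k k') * emb (eS K p k k') : utq K n p q) ≠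
      emb (eS K p k k') * emb (hS K p k k') := by
  intro h
  have h2 := emb_lie (q := q) (hS K p k k') (eS K p k k')
  rw [lie_hS_eS hk, h, sub_self] at h2
  exact emb_eS_ne_zero hp hk h2

theorem twistedHopf_comul_hS (hp : 2 < p) {k k' : Fin n} (hk : k ≠ k') :
    (twistedHopf hp hk).Δ (emb (hS K p k k') : utq K n p q) =
      emb (hS K p k k') ⊗ₜ[TruncRing K p q] unip (zR K p q k k') (-1 : ZMod p) +
        1 ⊗ₜ[TruncRing K p q] emb (hS K p k k') := by
  rw [twistedHopf_comul_emb, (toralPair_zR hp hk).twistF_conj_h]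

theorem twistedHopf_noncocommutative (hp : 2 < p) {k k' : Fin n} (hk : k ≠ k') :
    (twistedHopf (K := K) (q := q) hp hk).Noncocommutative := by
  obtain ⟨ξ, hξ, -⟩ := exists_functional (K := K) hp hk 1 0
  obtain ⟨η, hηh, hηe⟩ := exists_functional (K := K) hp hk 0 1
  refine ⟨emb (hS K p k k'), fun h => ?_⟩
  rw [twistedHopf_comul_hS, map_add, TensorProduct.comm_tmul, TensorProduct.comm_tmul] at h
  have h1 := congrArg (LinearMap.mul' (TruncRing K p q) (TruncRing K p q) ∘ₗ
    TensorProduct.map (functionalR ξ) (functionalR η)) h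
  have e1 : functionalR (q := q) ξ (emb (hS K p k k')) = 1 := by
    rw [emb, functionalR_tmul, hξ, one_smul]
  have e2 : functionalR (q := q) η (emb (hS K p k k')) = 0 := by
    rw [emb, functionalR_tmul, hηh, zero_smul]
  simp only [map_add, LinearMap.comp_apply, TensorProduct.map_tmul, LinearMap.mul'_apply, e1, e2,
    mul_zero, one_mul, zero_add, add_zero] at h1
  have hval : (-1 : ZMod p) = ((p - 1 : ℕ) : ZMod p) := by
    rw [Nat.cast_sub (Fact.out : p.Prime).one_le]; simp
  have hpow : ∀ m : ℕ, functionalR η (zR K p q k k' ^ m) =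
      ((-1) ^ m * η (ιu K n p (eS K p k k') ^ m)) • t K p q ^ m := by
    intro m
    rw [zR_pow, functionalR_tmul, Algebra.smul_def, Algebra.smul_def]
    simp only [map_mul, map_pow, map_neg, map_one]
    ring
  have hli := linearIndependent_t_pow K p q
  rw [Fintype.linearIndependent_iff] at hli
  have hp1 : 1 < p := (Fact.out : p.Prime).one_lt
  have h3 := hli (fun i => if (i : ℕ) = 0 then 0 else
    ((p - 1).choose i : K) * ((-1) ^ (i : ℕ) * η (ιu K n p (eS K p k k') ^ (i : ℕ)))) ?_ ⟨1, hp1⟩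
  · rw [if_neg one_ne_zero, Nat.choose_one_right, pow_one, pow_one, hηe, mul_one,
      Nat.cast_sub hp1.le] at h3
    simp at h3
  · have h4 : functionalR η (unip (zR K p q k k') (-1 : ZMod p)) = ∑ i : Fin p,
        (((p - 1).choose i : K) * ((-1) ^ (i : ℕ) * η (ιu K n p (eS K p k k') ^ (i : ℕ)))) •
          t K p q ^ (i : ℕ) := by
      rw [hval, unip_natCast (toralPair_zR hp hk).nil, add_comm, (Commute.one_right _).add_pow,
        map_sum, Nat.sub_add_cancel hp1.le, Finset.sum_range]
      refine Finset.sum_congr rfl fun i _ => ?_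
      rw [one_pow, mul_one, ← (Nat.cast_commute _ _).eq, ← nsmul_eq_mul, map_nsmul, hpow,
        ← Nat.cast_smul_eq_nsmul K, smul_smul]
    have h5 : functionalR η (1 : utq K n p q) = η 1 • (1 : TruncRing K p q) :=
      functionalR_tmul η 1 1
    rw [h4, h5] at h1
    have h0 : 0 < p := (Fact.out : p.Prime).pos
    rw [← Finset.add_sum_erase _ _ (Finset.mem_univ (⟨0, h0⟩ : Fin p))] at h1 ⊢
    simp only [pow_zero, Nat.choose_zero_right, Nat.cast_one, one_mul, left_eq_add] at h1
    simp only [if_true, zero_smul, zero_add]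
    rw [← h1]
    refine Finset.sum_congr rfl fun i hi => ?_
    rw [if_neg fun hi0 => (Finset.mem_erase.1 hi).1 (Fin.ext hi0)]

end TwistedHopf

section ToralRadford

variable {p : ℕ} [Fact p.Prime] {A : Type*} [Ring A] [CharP A p] {h z : A}

theorem unip_pow_prime (hz : z ^ p = 0) (s : ZMod p) : unip z s ^ p = 1 := by
  rw [unip, ← pow_mul, mul_comm, pow_mul, one_add_pow_prime hz, one_pow]

theorem unip_neg_one_pow (hz : z ^ p = 0) : unip z (-1 : ZMod p) ^ (p - 1) = 1 + z := by
  have h1 : unip z (-1 : ZMod p) * (1 + z) = 1 := by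
    rw [← unip_one (p := p) hz, unip_neg_mul hz]
  have h2 : unip z (-1 : ZMod p) ^ (p - 1) * unip z (-1 : ZMod p) = 1 := by
    rw [← pow_succ, Nat.sub_add_cancel (Fact.out : p.Prime).one_le, unip_pow_prime hz]
  exact left_inv_eq_right_inv h2 h1

theorem ToralPair.commutator_unip_neg_one (H : ToralPair p h z) :
    h * unip z (-1 : ZMod p) - unip z (-1 : ZMod p) * h =
      unip z (-1 : ZMod p) ^ 2 - unip z (-1 : ZMod p) := by
  have h1 : (1 + z) * unip z (-1 : ZMod p) = 1 := by
    rw [← unip_one (p := p) H.nil, unip_mul_neg H.nil]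
  have h2 : unip z (-1 - 1 : ZMod p) = unip z (-1 : ZMod p) ^ 2 := by
    rw [sub_eq_add_neg, unip_add H.nil, sq]
  have h3 : unip z (-1 : ZMod p) = (1 + z) * unip z (-1 : ZMod p) ^ 2 := by
    rw [sq, ← mul_assoc, h1, one_mul]
  rw [H.unip_mul_h, h2, map_neg, map_one]
  conv_rhs => enter [2]; rw [h3]
  noncomm_ring

theorem ToralPair.h_mul_V (H : ToralPair p h z) :
    h * ToralPair.V p h z = ToralPair.V p h z * (h * (1 + z)) := by
  refine ext_eigenIdem (h := h) (p := p) fun s => ?_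
  have h1 := H.eigenIdem_unip_mul_h s 0
  rw [add_zero, map_zero, sub_zero] at h1
  rw [← mul_assoc, ← (eigenIdem_commute h s).eq, mul_eigenIdem H.toral, mul_assoc,
    H.eigenIdem_mul_V, ← mul_assoc (eigenIdem h s), H.eigenIdem_mul_V, ← mul_assoc _ h, h1,
    ← unip_one (p := p) H.nil, mul_assoc, mul_assoc, ← unip_add H.nil, sub_add_cancel]

theorem ToralPair.h_mul_one_add_z_pow (H : ToralPair p h z) :
    (h * (1 + z)) ^ p = h * (1 + z) := by
  have h1 : SemiconjBy (ToralPair.V p h z) (h * (1 + z)) h := H.h_mul_V.symm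
  have h2 := (h1.pow_right p).eq
  rw [H.toral, H.h_mul_V] at h2
  have h3 := congrArg (ToralPair.V p h (-z) * ·) h2
  simpa only [← mul_assoc, H.V_neg_mul_V, one_mul] using h3

/-- The relations of the Radford algebra. -/
structure IsRadfordPair (p : ℕ) {A : Type*} [Ring A] (α υ : A) : Prop where
  a_pow : α ^ p = 1
  y_pow : υ ^ p = υ
  comm : υ * α - α * υ = α ^ 2 - α

theorem ToralPair.isRadfordPair (H : ToralPair p h z) :
    IsRadfordPair p (unip z (-1 : ZMod p)) h where
  a_pow := unip_pow_prime H.nil _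
  y_pow := H.toral
  comm := H.commutator_unip_neg_one

namespace IsRadfordPair

variable {α υ : A} (P : IsRadfordPair p α υ)
include P

theorem pow_mul_self : α ^ (p - 1) * α = 1 := by
  rw [← pow_succ, Nat.sub_add_cancel (Fact.out : p.Prime).one_le, P.a_pow]

theorem self_mul_pow : α * α ^ (p - 1) = 1 := by
  rw [← pow_succ', Nat.sub_add_cancel (Fact.out : p.Prime).one_le, P.a_pow]

theorem y_mul_inv : υ * α ^ (p - 1) = α ^ (p - 1) * υ + α ^ (p - 1) - 1 := by
  set b := α ^ (p - 1) with hb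
  have h1 : b * α = 1 := P.pow_mul_self
  have h2 : α * b = 1 := P.self_mul_pow
  have h3 : b * (υ * α - α * υ) * b = b * (α ^ 2 - α) * b := by rw [P.comm]
  have e1 : b * (υ * α - α * υ) * b = b * υ * (α * b) - b * α * (υ * b) := by noncomm_ring
  have e2 : b * (α ^ 2 - α) * b = b * α * (α * b) - b * α * b := by noncomm_ring
  rw [e1, e2, h1, h2, mul_one, mul_one, one_mul, one_mul, sub_eq_sub_iff_add_eq_add] at h3
  rw [eq_sub_iff_add_eq, add_comm, ← h3]

theorem antipode_mul_add : -(υ * α ^ (p - 1)) * α + υ = 0 := by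
  rw [neg_mul, mul_assoc, P.pow_mul_self, mul_one, neg_add_cancel]

theorem toralPair : ToralPair p υ (α ^ (p - 1) - 1) where
  toral := P.y_pow
  nil := by
    rw [sub_pow_prime (Commute.one_right _), ← pow_mul, mul_comm, pow_mul, P.a_pow, one_pow,
      one_pow, sub_self]
  comm := by
    rw [mul_sub, P.y_mul_inv]
    noncomm_ring

theorem unip_neg_one : unip (α ^ (p - 1) - 1) (-1 : ZMod p) = α := by
  have hz := P.toralPair.nil
  refine left_inv_eq_right_inv (a := 1 + (α ^ (p - 1) - 1)) ?_ ?_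
  · rw [← unip_one (p := p) hz, unip_neg_mul hz]
  · rw [add_sub_cancel, P.pow_mul_self]

theorem op (hp : Odd p) : IsRadfordPair p (MulOpposite.op (α ^ (p - 1)))
    (MulOpposite.op (-(υ * α ^ (p - 1)))) where
  a_pow := by
    rw [← MulOpposite.op_pow, ← pow_mul, mul_comm, pow_mul, P.a_pow, one_pow, MulOpposite.op_one]
  y_pow := by
    have h1 := P.toralPair.h_mul_one_add_z_pow
    rw [add_sub_cancel] at h1
    rw [← MulOpposite.op_pow, hp.neg_pow, h1]
  comm := by
    have h1 := P.y_mul_inv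
    set b := α ^ (p - 1) with hb
    have h2 : υ * b * b = b * (υ * b) + b * b - b :=
      (congrArg (· * b) h1).trans (by noncomm_ring)
    apply MulOpposite.unop_injective
    simp only [MulOpposite.unop_sub, MulOpposite.unop_mul, MulOpposite.unop_op,
      MulOpposite.unop_pow, neg_mul, mul_neg, h2]
    noncomm_ring

theorem tensor (K : Type*) [Field K] [CharP K p] [Algebra K A] :
    IsRadfordPair p (α ⊗ₜ[K] α) (υ ⊗ₜ[K] α + 1 ⊗ₜ[K] υ) where
  a_pow := by rw [Algebra.TensorProduct.tmul_pow, P.a_pow, Algebra.TensorProduct.one_def]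
  y_pow := by
    have H := P.toralPair
    set z := α ^ (p - 1) - 1 with hz
    have h1 := H.twistF_conj_h (R := K)
    rw [P.unip_neg_one] at h1
    have h2 : (υ ⊗ₜ[K] (1 : A) + 1 ⊗ₜ[K] υ) ^ p = υ ⊗ₜ[K] 1 + 1 ⊗ₜ[K] υ := by
      have hc : Commute (υ ⊗ₜ[K] (1 : A)) (1 ⊗ₜ[K] υ) := by simp [Commute, SemiconjBy]
      rw [commute_add_pow_prime K hc, Algebra.TensorProduct.tmul_pow,
        Algebra.TensorProduct.tmul_pow, one_pow, P.y_pow]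
    have h3 : SemiconjBy (twistF p K υ z) (υ ⊗ₜ[K] (1 : A) + 1 ⊗ₜ[K] υ)
        (υ ⊗ₜ[K] α + 1 ⊗ₜ[K] υ) := by
      rw [SemiconjBy, ← h1, mul_assoc, twistFinv_mul H, mul_one]
    have h4 := (h3.pow_right p).eq
    rw [h2, h3.eq] at h4
    have h5 := congrArg (· * twistFinv p K υ z) h4
    simpa only [mul_assoc, twistF_mul_inv H, mul_one] using h5.symm
  comm := by
    have h1 : υ * α = α * υ + (α ^ 2 - α) := sub_eq_iff_eq_add'.1 P.comm
    simp only [add_mul, mul_add, sq, Algebra.TensorProduct.tmul_mul_tmul, one_mul, mul_one, h1,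
      TensorProduct.add_tmul, TensorProduct.tmul_add, TensorProduct.sub_tmul,
      TensorProduct.tmul_sub]
    abel

theorem range_subset_span (K : Type*) [CommRing K] [Algebra K A] (i j : Fin 2) :
    ![υ, α ^ (p - 1) - 1] i * ![υ, α ^ (p - 1) - 1] j -
      ![υ, α ^ (p - 1) - 1] j * ![υ, α ^ (p - 1) - 1] i ∈
      Submodule.span K (Set.range ![υ, α ^ (p - 1) - 1]) := by
  have H := P.toralPair
  set z := α ^ (p - 1) - 1 with hz
  have h1 : υ * z - z * υ = z := by rw [H.comm]; noncomm_ring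
  have h2 : z * υ - υ * z = -z := by rw [← neg_sub, h1]
  have hz : z ∈ Submodule.span K (Set.range ![υ, z]) := Submodule.subset_span ⟨1, rfl⟩
  fin_cases i <;> fin_cases j
  · simp
  · simpa [h1] using hz
  · simpa [h2] using hz
  · simp

end IsRadfordPair

end ToralRadford

/-! ### The Radford algebra -/

namespace Radford

variable {K : Type*} [Field K] {p : ℕ} {A : Type*} [Ring A] [Algebra K A]

theorem exists_lift {α υ : A} (P : IsRadfordPair p α υ) :
    ∃ f : Radford K p →ₐ[K] A, f (a K p) = α ∧ f (y K p) = υ := by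
  let f₀ : FreeAlgebra K Bool →ₐ[K] A := FreeAlgebra.lift K fun b => if b then α else υ
  have ha : f₀ (FreeAlgebra.ι K true) = α := by simp [f₀]
  have hy : f₀ (FreeAlgebra.ι K false) = υ := by simp [f₀]
  have hrel : ∀ ⦃v w : FreeAlgebra K Bool⦄, RadfordRel K p v w → f₀ v = f₀ w := by
    intro v w h
    cases h with
    | a_pow => rw [map_pow, ha, P.a_pow, map_one]
    | y_pow => rw [map_pow, hy, P.y_pow]
    | comm => simp only [map_sub, map_mul, map_pow, ha, hy, P.comm]
  exact ⟨RingQuot.liftAlgHom K ⟨f₀, hrel⟩,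
    (RingQuot.liftAlgHom_mkAlgHom_apply K _ hrel _).trans ha,
    (RingQuot.liftAlgHom_mkAlgHom_apply K _ hrel _).trans hy⟩

/-- The algebra map out of the Radford algebra with given values at the generators. -/
def lift {α υ : A} (P : IsRadfordPair p α υ) : Radford K p →ₐ[K] A := (exists_lift P).choose

theorem lift_a {α υ : A} (P : IsRadfordPair p α υ) : lift (K := K) P (a K p) = α :=
  (exists_lift P).choose_spec.1

theorem lift_y {α υ : A} (P : IsRadfordPair p α υ) : lift (K := K) P (y K p) = υ :=
  (exists_lift P).choose_spec.2

theorem hom_ext {f g : Radford K p →ₐ[K] A} (ha : f (a K p) = g (a K p))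
    (hy : f (y K p) = g (y K p)) : f = g := by
  apply RingQuot.ringQuot_ext' K
  apply FreeAlgebra.hom_ext
  funext b
  cases b
  · exact hy
  · exact ha

variable (K p)

theorem isRadfordPair : IsRadfordPair p (a K p) (y K p) where
  a_pow := by
    have := RingQuot.mkAlgHom_rel K (RadfordRel.a_pow (K := K) (p := p))
    rwa [map_pow, map_one] at this
  y_pow := by
    have := RingQuot.mkAlgHom_rel K (RadfordRel.y_pow (K := K) (p := p))
    rwa [map_pow] at this
  comm := by
    have := RingQuot.mkAlgHom_rel K (RadfordRel.comm (K := K) (p := p))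
    simp only [map_sub, map_mul, map_pow] at this
    exact this

theorem adjoin_generators : Algebra.adjoin K {a K p, y K p} = ⊤ := by
  set B := Algebra.adjoin K {a K p, y K p} with hB
  have ha : a K p ∈ B := Algebra.subset_adjoin (by simp)
  have hy : y K p ∈ B := Algebra.subset_adjoin (by simp)
  let f : Radford K p →ₐ[K] B := lift
    (α := (⟨a K p, ha⟩ : B)) (υ := ⟨y K p, hy⟩) ⟨Subtype.ext (isRadfordPair K p).a_pow,
      Subtype.ext (isRadfordPair K p).y_pow, Subtype.ext (isRadfordPair K p).comm⟩
  have h1 : B.val.comp f = AlgHom.id K _ := hom_ext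
    (by simp only [AlgHom.comp_apply, f, lift_a]; rfl)
    (by simp only [AlgHom.comp_apply, f, lift_y]; rfl)
  rw [eq_top_iff]
  intro w _
  have h2 : B.val (f w) = w := AlgHom.congr_fun h1 w
  rw [← h2]
  exact (f w).2

variable [Fact p.Prime]

/-- The counit of the Radford algebra. -/
def counit : Radford K p →ₐ[K] K :=
  lift (α := 1) (υ := 0) ⟨one_pow p, zero_pow (Fact.out : p.Prime).ne_zero, by simp⟩

theorem counit_a : counit K p (a K p) = 1 := lift_a ..

theorem counit_y : counit K p (y K p) = 0 := lift_y ..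

instance : Nontrivial (Radford K p) := (counit K p).toRingHom.domain_nontrivial

variable [CharP K p]

instance : CharP (Radford K p) p := charP_of_algebra K _ p

/-- The nilpotent element `a⁻¹ - 1` of the Radford algebra. -/
def z : Radford K p := a K p ^ (p - 1) - 1

/-- The coproduct of the Radford algebra. -/
def comul : Radford K p →ₐ[K] Radford K p ⊗[K] Radford K p := lift ((isRadfordPair K p).tensor K)

theorem comul_a : comul K p (a K p) = a K p ⊗ₜ[K] a K p := lift_a ..

theorem comul_y : comul K p (y K p) = y K p ⊗ₜ[K] a K p + 1 ⊗ₜ[K] y K p := lift_y ..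

/-- The antipode of the Radford algebra. -/
def anti (hp : Odd p) : Radford K p →ₐ[K] (Radford K p)ᵐᵒᵖ := lift ((isRadfordPair K p).op hp)

theorem anti_a (hp : Odd p) :
    HopfStructure.antiLin (anti K p hp) (a K p) = a K p ^ (p - 1) := by
  rw [HopfStructure.antiLin_apply, anti, lift_a, MulOpposite.unop_op]

theorem anti_y (hp : Odd p) :
    HopfStructure.antiLin (anti K p hp) (y K p) = -(y K p * a K p ^ (p - 1)) := by
  rw [HopfStructure.antiLin_apply, anti, lift_y, MulOpposite.unop_op]

/-- The Hopf structure of the Radford algebra. -/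
def hopf (hp : Odd p) : HopfStructure K (Radford K p) :=
  HopfStructure.ofGenerators (comul K p) (counit K p) (anti K p hp) _ (adjoin_generators K p)
    (by
      rintro _ (rfl | rfl)
      · simp [comul_a]
      · simp only [comul_a, comul_y, map_add, Algebra.TensorProduct.map_tmul, map_one,
          AlgHom.id_apply, TensorProduct.add_tmul, TensorProduct.tmul_add,
          Algebra.TensorProduct.assoc_tmul, Algebra.TensorProduct.one_def, add_assoc])
    (by rintro _ (rfl | rfl) <;> simp [comul_a, comul_y, counit_a, counit_y])
    (by rintro _ (rfl | rfl) <;> simp [comul_a, comul_y, counit_a, counit_y])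
    (by
      rintro _ (rfl | rfl)
      · simp [comul_a, counit_a, anti_a, (isRadfordPair K p).pow_mul_self]
      · simpa [comul_y, counit_y, anti_y, HopfStructure.antiLin_one] using
          (isRadfordPair K p).antipode_mul_add)
    (by
      rintro _ (rfl | rfl)
      · simp [comul_a, counit_a, anti_a, (isRadfordPair K p).self_mul_pow]
      · simp [comul_y, counit_y, anti_y, anti_a])

theorem isRadfordHopf (hp : Odd p) : IsRadfordHopf (hopf K p hp) where
  Δ_a := comul_a K p
  Δ_y := comul_y K p
  counit_a := counit_a K p
  counit_y := counit_y K p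
  antipode_a := anti_a K p hp
  antipode_y := anti_y K p hp

variable {K p}

/-- The algebra map out of the Radford algebra given by a toral pair. -/
def ofToralPair [CharP A p] {h w : A} (H : ToralPair p h w) : Radford K p →ₐ[K] A :=
  lift H.isRadfordPair

variable [CharP A p] {h w : A} (H : ToralPair p h w)

theorem ofToralPair_a : ofToralPair (K := K) H (a K p) = unip w (-1 : ZMod p) := lift_a ..

theorem ofToralPair_y : ofToralPair (K := K) H (y K p) = h := lift_y ..

theorem ofToralPair_z : ofToralPair (K := K) H (z K p) = w := by
  rw [z, map_sub, map_pow, map_one, ofToralPair_a, unip_neg_one_pow H.nil, add_sub_cancel_left]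

theorem span_monomials : Submodule.span K (Set.range fun c : Fin 2 → Fin p =>
    orderedMonomial ![y K p, z K p] fun i => (c i : ℕ)) = ⊤ := by
  refine span_orderedMonomial_eq_top (Fact.out : p.Prime).one_lt
    ((isRadfordPair K p).range_subset_span K) (fun i => ?_) ?_
  · fin_cases i
    · exact ⟨1, by simp [(isRadfordPair K p).y_pow]⟩
    · exact ⟨0, (isRadfordPair K p).toralPair.nil.trans (zero_smul _ _).symm⟩
  · rw [eq_top_iff, ← adjoin_generators, Algebra.adjoin_le_iff]
    have h1 : ∀ i, ![y K p, z K p] i ∈ Algebra.adjoin K (Set.range ![y K p, z K p]) :=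
      fun i => Algebra.subset_adjoin ⟨i, rfl⟩
    rintro _ (rfl | rfl)
    · rw [← (isRadfordPair K p).unip_neg_one]
      exact pow_mem (add_mem (one_mem _) (h1 1)) _
    · exact h1 0

/-- A map out of the Radford algebra is injective if it maps the monomials in `y` and `z` to
linearly independent elements. -/
theorem ofToralPair_injective (hli : LinearIndependent K fun c : Fin 2 → Fin p =>
    h ^ (c 0 : ℕ) * w ^ (c 1 : ℕ)) : Function.Injective (ofToralPair (K := K) H) := by
  set v : (Fin 2 → Fin p) → Radford K p := fun c =>
    orderedMonomial ![y K p, z K p] fun i => (c i : ℕ) with hv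
  have h1 : ∀ c, ofToralPair (K := K) H (v c) = h ^ (c 0 : ℕ) * w ^ (c 1 : ℕ) := by
    intro c
    simp [hv, orderedMonomial, ofToralPair_y, ofToralPair_z]
  rw [injective_iff_map_eq_zero]
  intro c hc
  have hmem : c ∈ Submodule.span K (Set.range v) := span_monomials (K := K) (p := p) ▸ Submodule.mem_top
  obtain ⟨l, rfl⟩ := (Submodule.mem_span_range_iff_exists_fun K).1 hmem
  rw [map_sum] at hc
  simp only [map_smul, h1] at hc
  have := Fintype.linearIndependent_iff.1 hli l hc
  simp [this]

end Radford

section TwistOnToralPair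

variable {p : ℕ} [Fact p.Prime] {R B : Type*} [CommRing R] [Ring B] [Algebra R B]
  [CharP B p] {h z : B}

theorem ToralPair.twistF_conj_unip (H : ToralPair p h z) (Δ : B →ₐ[R] B ⊗[R] B)
    (hΔz : Δ z = z ⊗ₜ[R] 1 + 1 ⊗ₜ[R] z) (r : ZMod p) :
    twistF p R h z * Δ (unip z r) * twistFinv p R h z = unip z r ⊗ₜ[R] unip z r := by
  rw [twistF_mul_unip H Δ hΔz, mul_assoc, twistF_mul_inv H, mul_one]

theorem ToralPair.V_conj_unip (H : ToralPair p h z) (r : ZMod p) :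
    ToralPair.V p h (-z) * (unip (-z) r * ToralPair.V p h z) = unip z (-r) := by
  rw [H.unip_neg_mul_V, ← mul_assoc, H.V_neg_mul_V, one_mul]

theorem ToralPair.V_conj_neg_h (H : ToralPair p h z) :
    ToralPair.V p h (-z) * (-h * ToralPair.V p h z) = -(h * (1 + z)) := by
  rw [neg_mul, H.h_mul_V, mul_neg, ← mul_assoc, H.V_neg_mul_V, one_mul]

/-- The anti-endomorphism `b ↦ V(-z) S(b) V(z)`. -/
def ToralPair.conjAnti (H : ToralPair p h z) (S : B →ₐ[R] Bᵐᵒᵖ) : B →ₐ[R] Bᵐᵒᵖ :=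
  conjHom S (MulOpposite.op (ToralPair.V p h z)) (MulOpposite.op (ToralPair.V p h (-z)))
    (by rw [← MulOpposite.op_mul, H.V_neg_mul_V, MulOpposite.op_one])
    (by rw [← MulOpposite.op_mul, H.V_mul_V_neg, MulOpposite.op_one])

theorem ToralPair.antiLin_conjAnti (H : ToralPair p h z) (S : B →ₐ[R] Bᵐᵒᵖ) (b : B) :
    HopfStructure.antiLin (H.conjAnti S) b =
      ToralPair.V p h (-z) * (HopfStructure.antiLin S b * ToralPair.V p h z) := by
  rw [HopfStructure.antiLin_apply, ToralPair.conjAnti, conjHom_apply]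
  rfl

theorem antiLin_unip (S : B →ₐ[R] Bᵐᵒᵖ) (hz : HopfStructure.antiLin S z = -z) (r : ZMod p) :
    HopfStructure.antiLin S (unip z r) = unip (-z) r := by
  rw [unip, HopfStructure.antiLin_pow, map_add, HopfStructure.antiLin_one, hz, unip]

end TwistOnToralPair

section TwistZ

variable {K : Type*} [Field K] {n p : ℕ} [Fact p.Prime] [CharP K p]
  {R B : Type*} [CommRing R] [Ring B] [Algebra R B] [Algebra K R] [Algebra K B]
  [IsScalarTower K R B] {θ : S K n p →ₗ[K] B} (τ : R) (k k' : Fin n)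

theorem comul_twistZ (Δ : B →ₐ[R] B ⊗[R] B) (hΔ : ∀ y, Δ (θ y) = θ y ⊗ₜ[R] 1 + 1 ⊗ₜ[R] θ y) :
    Δ (twistZ θ τ k k') = twistZ θ τ k k' ⊗ₜ[R] 1 + 1 ⊗ₜ[R] twistZ θ τ k k' := by
  rw [twistZ, map_neg, map_smul, hΔ, smul_add, neg_add, TensorProduct.neg_tmul,
    TensorProduct.tmul_neg, TensorProduct.smul_tmul', TensorProduct.tmul_smul]

theorem map_twistZ_eq_zero (ε : B →ₗ[R] R) (hε : ∀ y, ε (θ y) = 0) :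
    ε (twistZ θ τ k k') = 0 := by rw [twistZ, map_neg, map_smul, hε, smul_zero, neg_zero]

theorem map_twistZ_eq_neg (f : B →ₗ[R] B) (hf : ∀ y, f (θ y) = -θ y) :
    f (twistZ θ τ k k') = -twistZ θ τ k k' := by rw [twistZ, map_neg, map_smul, hf, smul_neg]

end TwistZ

/-- A map out of the Radford algebra is a map of Hopf algebras if it is so on the generators. -/
theorem Radford.isHopfMap {K : Type*} [Field K] {p : ℕ} [Fact p.Prime] [CharP K p] (hp : Odd p)
    {R B : Type*} [CommRing R] [Ring B] [Algebra R B] [Algebra K R] [Algebra K B]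
    [IsScalarTower K R B] (Y : HopfStructure R B) (T : B →ₐ[R] Bᵐᵒᵖ)
    (hT : Y.antipode = HopfStructure.antiLin T) (f : Radford K p →ₐ[K] B) {α υ : B}
    (ha : f (Radford.a K p) = α) (hy : f (Radford.y K p) = υ)
    (hΔa : Y.Δ α = α ⊗ₜ[R] α) (hΔy : Y.Δ υ = υ ⊗ₜ[R] α + 1 ⊗ₜ[R] υ)
    (hεa : Y.counit α = 1) (hεy : Y.counit υ = 0)
    (hSa : Y.antipode α = α ^ (p - 1)) (hSy : Y.antipode υ = -(υ * α ^ (p - 1))) :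
    IsHopfMap (Radford.hopf K p hp) Y f where
  Δ c := by
    have h : (Y.Δ.restrictScalars K).comp f =
        ((Algebra.TensorProduct.mapOfCompatibleSMul R K K B B).comp
          (Algebra.TensorProduct.map f f)).comp (Radford.comul K p) := by
      refine Radford.hom_ext ?_ ?_
      · simp [ha, hΔa, Radford.comul_a]
      · simp [ha, hy, hΔy, Radford.comul_y]
    exact AlgHom.congr_fun h c
  counit c := by
    have h : (Y.counit.restrictScalars K).comp f =
        (Algebra.ofId K R).comp (Radford.counit K p) := by
      refine Radford.hom_ext ?_ ?_
      · simp [ha, hεa, Radford.counit_a]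
      · simp [hy, hεy, Radford.counit_y]
    exact AlgHom.congr_fun h c
  antipode c := by
    have h1 : ∀ b, Y.antipode b = (T b).unop := fun b => by
      rw [hT, HopfStructure.antiLin_apply]
    have h : (T.restrictScalars K).comp f = f.op.comp (Radford.anti K p hp) := by
      refine Radford.hom_ext ?_ ?_ <;> apply MulOpposite.unop_injective
      · change (T (f _)).unop = f (HopfStructure.antiLin (Radford.anti K p hp) _)
        rw [Radford.anti_a, map_pow, ← h1, ha, hSa]
      · change (T (f _)).unop = f (HopfStructure.antiLin (Radford.anti K p hp) _)
        rw [Radford.anti_y, ← h1, hy, hSy, ← hy, ← ha, map_neg, map_mul, map_pow]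
    rw [h1]
    exact congrArg MulOpposite.unop (AlgHom.congr_fun h c)

section RadfordEmbedding

variable {K : Type*} [Field K] {n p : ℕ} [Fact p.Prime] [CharP K p] {q : K}

theorem twistedHopf_comul (hp : 2 < p) {k k' : Fin n} (hk : k ≠ k') (b : utq K n p q) :
    (twistedHopf hp hk).Δ b = twistF p (TruncRing K p q) (emb (hS K p k k')) (zR K p q k k') *
      comulR K n p q b * twistFinv p (TruncRing K p q) (emb (hS K p k k')) (zR K p q k k') :=
  primitiveTwist_comul (isRestricted_embL K n p q) hp hk (t K p q)
    (baseHopf K n p q ((Fact.out : p.Prime).odd_of_ne_two hp.ne')) (antiR K n p q _) rfl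
    (comulR_emb K n p q) (counitR_emb K n p q) (antiR_emb K n p q _) b

theorem twistedHopf_antipode (hp : 2 < p) {k k' : Fin n} (hk : k ≠ k') :
    (twistedHopf (K := K) (q := q) hp hk).antipode =
      HopfStructure.antiLin ((toralPair_zR hp hk).conjAnti
        (antiR K n p q ((Fact.out : p.Prime).odd_of_ne_two hp.ne'))) := by
  refine LinearMap.ext fun b => ?_
  rw [ToralPair.antiLin_conjAnti]
  rfl

variable (K q) in
/-- The embedding of the Radford algebra. -/
def radfordEmb (hp : 2 < p) {k k' : Fin n} (hk : k ≠ k') : Radford K p →ₐ[K] utq K n p q :=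
  Radford.ofToralPair (toralPair_zR hp hk)

theorem radfordEmb_y (hp : 2 < p) {k k' : Fin n} (hk : k ≠ k') :
    radfordEmb K q hp hk (Radford.y K p) = emb (hS K p k k') := Radford.ofToralPair_y _

theorem radfordEmb_a (hp : 2 < p) {k k' : Fin n} (hk : k ≠ k') :
    radfordEmb K q hp hk (Radford.a K p) = unip (zR K p q k k') (-1 : ZMod p) :=
  Radford.ofToralPair_a _

theorem radfordEmb_isHopfMap (hp : 2 < p) {k k' : Fin n} (hk : k ≠ k') :
    IsHopfMap (Radford.hopf K p ((Fact.out : p.Prime).odd_of_ne_two hp.ne'))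
      (twistedHopf (q := q) hp hk) (radfordEmb K q hp hk) := by
  have hodd : Odd p := (Fact.out : p.Prime).odd_of_ne_two hp.ne'
  have H := toralPair_zR (K := K) (q := q) hp hk
  have hz := unip_neg_one_pow H.nil
  refine Radford.isHopfMap hodd _ _ (twistedHopf_antipode hp hk) _ (radfordEmb_a hp hk)
    (radfordEmb_y hp hk) ?_ (twistedHopf_comul_hS hp hk) ?_ (twistedHopf_counit_emb hp hk _) ?_ ?_
  · rw [twistedHopf_comul]
    exact H.twistF_conj_unip _ (comul_twistZ _ k k' _ (comulR_emb K n p q)) _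
  · have h0 : counitR K n p q (zR K p q k k') = 0 :=
      map_twistZ_eq_zero (θ := embL K n p q) (t K p q) k k' (counitR K n p q).toLinearMap (counitR_emb K n p q)
    refine (map_unip (counitR K n p q).toRingHom _ _).trans ?_
    change unip (counitR K n p q (zR K p q k k')) _ = 1
    rw [h0, unip, add_zero, one_pow]
  · have h0 : HopfStructure.antiLin (antiR K n p q hodd) (zR K p q k k') = -zR K p q k k' :=
      map_twistZ_eq_neg (θ := embL K n p q) (t K p q) k k' _ (antiR_emb K n p q hodd)
    rw [twistedHopf_antipode, H.antiLin_conjAnti, antiLin_unip _ h0, hz, ← unip_one (p := p) H.nil]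
    exact (H.V_conj_unip (-1)).trans (by rw [neg_neg])
  · rw [twistedHopf_antipode, H.antiLin_conjAnti, antiR_emb, hz]
    exact H.V_conj_neg_h

theorem radfordEmb_injective (hp : 2 < p) {k k' : Fin n} (hk : k ≠ k') :
    Function.Injective (radfordEmb K q hp hk) := by
  refine Radford.ofToralPair_injective _ ?_
  have h1 := (linearIndependent_t_pow K p q).tmul_of_isDomain
    (linearIndependent_orderedMonomial_ιu (linearIndependent_hS_eS (K := K) hp hk))
  have h2 := (h1.comp (fun c : Fin 2 → Fin p => (c 1, c)) fun c d h => (Prod.ext_iff.1 h).2).units_smul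
    fun c => (-1 : Kˣ) ^ (c 1 : ℕ)
  have h3 : (fun c : Fin 2 → Fin p => (-1 : Kˣ) ^ (c 1 : ℕ)) •
      ((fun i : Fin p × (Fin 2 → Fin p) => (t K p q ^ (i.1 : ℕ)) ⊗ₜ[K]
        orderedMonomial (fun j => ιu K n p (![hS K p k k', eS K p k k'] j))
          fun j => (i.2 j : ℕ)) ∘ fun c : Fin 2 → Fin p => (c 1, c)) =
      fun c => emb (hS K p k k') ^ (c 0 : ℕ) * zR K p q k k' ^ (c 1 : ℕ) := by
    funext c
    have h4 : orderedMonomial (fun j => ιu K n p (![hS K p k k', eS K p k k'] j))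
        (fun j => (c j : ℕ)) =
        ιu K n p (hS K p k k') ^ (c 0 : ℕ) * ιu K n p (eS K p k k') ^ (c 1 : ℕ) := by
      simp [orderedMonomial]
    rw [zR_pow, emb, Algebra.TensorProduct.tmul_pow, one_pow, Algebra.TensorProduct.tmul_mul_tmul,
      one_mul, ← h4, Pi.smul_apply', Function.comp_apply, Units.smul_def, TensorProduct.smul_tmul',
      Algebra.smul_def]
    simp only [Units.val_pow_eq_pow_val, Units.val_neg, Units.val_one, map_pow, map_neg, map_one]
  exact h3 ▸ h2

end RadfordEmbedding

end SpecialAlgebra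

end

open SpecialAlgebra

theorem theorem3p5 {K : Type*} [Field K] (p : ℕ) [Fact p.Prime] [CharP K p] (hp : 2 < p)
    (n : ℕ) (k k' : Fin n) (hk : k ≠ k') (q : K) :
    Module.Finite K (utq K n p q) ∧
    Module.finrank K (utq K n p q) = p ^ (1 + (n - 1) * (p ^ n - 1)) ∧
    (∃ a b : utq K n p q, a * b ≠ b * a) ∧
    ∃ g : (utq K n p q)ˣ, (g : utq K n p q) = 1 - t K p q • emb (eS K p k k') ∧
    ∃ X : HopfStructure (TruncRing K p q) (utq K n p q),
      X.Noncocommutative ∧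
      (∀ (i j : Fin n) (α : Fin n →₀ ℕ), (∀ m, α m < p) →
        X.Δ (emb (DS i j α)) =
          emb (DS i j α) ⊗ₜ[TruncRing K p q] ((g ^ wt k k' i j α : (utq K n p q)ˣ) : utq K n p q) +
          ∑ ℓ ∈ Finset.range p, (-1 : ℤ) ^ ℓ •
            (rising (emb (hS K p k k')) 0 ℓ ⊗ₜ[TruncRing K p q]
              (t K p q ^ ℓ • (((g ^ (-(ℓ : ℤ)) : (utq K n p q)ˣ) : utq K n p q) *
                emb (dOp k k' ℓ (DS i j α))))) ∧
        X.antipode (emb (DS i j α)) =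
          -(((g ^ (-wt k k' i j α) : (utq K n p q)ˣ) : utq K n p q) *
            ∑ ℓ ∈ Finset.range p, t K p q ^ ℓ •
              (emb (dOp k k' ℓ (DS i j α)) * rising (emb (hS K p k k')) 1 ℓ)) ∧
        X.counit (emb (DS i j α)) = 0) ∧
      ∃ R : HopfStructure K (Radford K p), IsRadfordHopf R ∧
        ∃ f : Radford K p →ₐ[K] utq K n p q, Function.Injective f ∧ IsHopfMap R X f ∧
          f (Radford.y K p) = emb (hS K p k k') ∧
          f (Radford.a K p) = ((g⁻¹ : (utq K n p q)ˣ) : utq K n p q) := by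
  have hn : 1 ≤ n := k.pos
  have hodd : Odd p := (Fact.out : p.Prime).odd_of_ne_two hp.ne'
  have hinv : (((unitR K q hp hk)⁻¹ : (utq K n p q)ˣ) : utq K n p q) =
      unip (zR K p q k k') (-1 : ZMod p) := rfl
  refine ⟨inferInstance, finrank_utq K n p hn q, ⟨_, _, emb_hS_mul_emb_eS_ne hp hk⟩,
    unitR K q hp hk, unitR_val hp hk, twistedHopf hp hk, twistedHopf_noncocommutative hp hk,
    fun i j α _ => ⟨twistedHopf_comul_DS hp hk i j α, twistedHopf_antipode_DS hp hk i j α,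
      twistedHopf_counit_emb hp hk _⟩,
    Radford.hopf K p hodd, Radford.isRadfordHopf K p hodd, radfordEmb K q hp hk,
    radfordEmb_injective hp hk, radfordEmb_isHopfMap hp hk, radfordEmb_y hp hk, ?_⟩
  rw [hinv, radfordEmb_a]
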